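/- Let $N\ge 2$ and $0\le L\le N/2$ be integers and $0<\kappa<8$. Put $\alpha_+=\frac{\sqrt\kappa}{2}$, $\alpha_-=-\frac{2}{\sqrt\kappa}$, $\alpha_0=\frac12(\alpha_++\alpha_-)$, $\alpha=\frac1{\sqrt\kappa}$ and $\beta=N\alpha+L\alpha_-=\frac{N-2L}{\sqrt\kappa}$. **Fock space and $G_f$.** Let $\hat F_\beta$ be the completed charged Fock space: formal, possibly infinite, linear combinations of the vectors $a_{-n_1}\cdots a_{-n_k}v_\beta$, $1\le n_1\le\dots\le n_k$, where $[a_n,a_m]=2n\,\delta_{n+m,0}$, $a_0v_\beta=2\beta v_\beta$ and $a_nv_\beta=0$ for $n>0$. Let $L_n=\frac14\sum_{j\in\mathbb Z}{:}a_{n-j}a_j{:}-\alpha_0(n+1)a_n$. Let $f(z)=z+\sum_{m\le-2}f_mz^{1+m}$ with formal variables $f_{-2},f_{-3},\dots$, and let $G_f=\sum_{d\ge0}G_d$ act on $\hat F_\beta$ with coefficients polynomial in the $f_m$, where $G_0=1$ and, for $d\ge1$, $$d\,G_d=\sum_{k\le -2}\ \sum_{k\le m\le-2} m\,f_m\Big(\operatorname{Res}_w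 w^{1+m}\frac{f'(w)}{f(w)^{2+k}}\Big)G_{d+k}L_k ,\qquad G_{d'}:=0\ \text{ for } d'<0 .$$ **Partition function.** Let $U$ be an open set of $N$-tuples $x=(x_1,\dots,x_N)$ of distinct real numbers (for instance all tuples with a prescribed order), and let $$h(x,w)=\prod_{I<J}(x_J-x_I)^{2/\kappa}\prod_{R<S}(w_S-w_R)^{8/\kappa}\prod_{I,R}(x_I-w_R)^{-4/\kappa},\qquad w=(w_1,\dots,w_L).$$ Let $\Gamma$ consist, for each $x\in U$, of closed contours in $\mathbb C$ for $w_1,\dots,w_L$, which avoid each other and the points $x_I$ and depend smoothly on $x$ (for instance, not at all), with a branch of $h$ continuous along the contours and in $x$, such that $h$ takes the same value at the two endpoints of the contour of each $w_R$. Put $$U^-(x,w)=\exp\Big(\sum_{n\ge1}\frac1n\Big(\sum_I\alpha x_I^n+\sum_R\alpha_-w_R^n\Big)a_{-n}\Big),\qquad Z(x)=\int_\Gamma h(x,w)\,dw_1\cdots dw_L ,$$ $$\Psi(x,f)=G_f\int_\Gamma h(x,w)\,U^-(x,w)\,v_\beta\,dw_1\cdots dw_L .$$ **Drift operators.** For $I=1,\dots,N$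 let $$\mathcal A_I=\frac\kappa2\frac{\partial^2}{\partial x_I^2}+\sum_{J\ne I}\Big(\frac{2}{x_J-x_I}\frac{\partial}{\partial x_J}+\frac{(\kappa-6)/\kappa}{(x_J-x_I)^2}\Big)+2\sum_{m\le-2}p_m\frac{\partial}{\partial f_m},\qquad p_m=\operatorname{Res}_v\frac{v^{-2-m}}{f(v)-x_I},$$ with $\frac1{f(v)-x_I}$ expanded at $v=\infty$. **Theorem.** 1. $G_f$ has its defining properties: $G_f=1$ when all $f_m=0$, and $\frac{\partial}{\partial f_m}G_f=-\sum_{k\le m}\big(\operatorname{Res}_w w^{1+m}\frac{f'(w)}{f(w)^{2+k}}\big)G_fL_k$ for all $m\le-2$. 2. Every coefficient of $\Psi$ in the basis $a_{-n_1}\cdots a_{-n_k}v_\beta$ belongs to $C^\infty(U\to\mathbb C)[f_{-2},f_{-3},\dots]$, and $\mathcal A_I\Psi=0$ on $U$ for every $I=1,\dots,N$. 3. Suppose that a constant multiple of $Z$ is positive on $U$, and consider a multiple SLE$_\kappa$ with partition function $Z$ on $[0,\tau)$, where $\tau$ is a stopping time with $X_t\in U$ for $t<\tau$. That is, for atomless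 adapted clocks $\langle A^I\rangle$ and deterministic $X_0$, let $$dX^I_t=\sqrt\kappa\,dA^I_t+\sum_{J\ne I}\frac{2}{X^I_t-X^J_t}\,d\langle A^J\rangle_t+\kappa\,(\partial_{x_I}\log Z)(X_t)\,d\langle A^I\rangle_t,\qquad \langle A^I,A^J\rangle=0\ (I\ne J),$$ $$dg_t(z)=\sum_I\frac{2}{g_t(z)-X^I_t}\,d\langle A^I\rangle_t,\qquad g_0(z)=z,\qquad g_t(z)=z+\sum_{m\le-2}g^{(t)}_mz^{1+m},$$ where this system is understood weakly, as the local martingale problem for $(X_t;g^{(t)}_{-2},g^{(t)}_{-3},\dots)$ with smooth test functions of $X$ and finitely many of the $g_m$. Then the screened Coulomb-gas state $\Psi(X_t,g_t)/Z(X_t)$ is an $\hat F_\beta$-valued local martingale on $[0,\tau)$: each of its coefficients in the basis $a_{-n_1}\cdots a_{-n_k}v_\beta$ is a local martingale. -/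

import Mathlib

open MeasureTheory Set
open scoped NNReal

noncomputable section

namespace CoulombGas

/-! ### Completed charged Fock space -/

/-- The completed charged Fock space with coefficients in `R`. The monomial `∏ X_n ^ (μ n)` stands
for the basis vector `∏ a_{-n} ^ (μ n) v_β`; arbitrary infinite combinations are allowed, which is
the same as the product over all levels `m` of the finite-dimensional spaces of level `m`. -/
abbrev Fock (R : Type*) := MvPowerSeries ℕ+ R

/-- The level `∑ n * μ n` of the basis vector `∏ a_{-n} ^ (μ n) v_β`. -/
def level (μ : ℕ+ →₀ ℕ) : ℕ := μ.sum fun n k => (n : ℕ) * k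

section Heisenberg

variable {R : Type*} [CommRing R] [Algebra ℂ R]

/-- The Heisenberg generator `a_n` acting on the Fock space of charge `β`: `a_{-n}` creates
(multiplication by `X_n`), `a_0 = 2β`, and `a_n = 2 n ∂/∂X_n` for `n > 0`, so that
`[a_n, a_m] = 2 n δ_{n+m,0}`, `a_0 v_β = 2 β v_β` and `a_n v_β = 0` for `n > 0`. -/
def mode (β : ℂ) (n : ℤ) (u : Fock R) : Fock R :=
  if n < 0 then MvPowerSeries.X (-n).toNat.toPNat' * u
  else if n = 0 then (2 * β) • u
  else fun μ => (2 * (n : R) * ((μ n.toNat.toPNat' : R) + 1)) *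
    MvPowerSeries.coeff (μ + Finsupp.single n.toNat.toPNat' 1) u

/-- The normally ordered product of `a_n` and `a_m`. -/
def normalOrdered (β : ℂ) (n m : ℤ) (u : Fock R) : Fock R :=
  if n ≤ m then mode β n (mode β m u) else mode β m (mode β n u)

/-- The Virasoro generator `L_n = (1/4) ∑_j :a_{n-j} a_j: - α₀ (n+1) a_n`. In each coefficient
only finitely many terms of the sum over `j` are non-zero. -/
def virasoro (β α₀ : ℂ) (n : ℤ) (u : Fock R) : Fock R := fun μ =>
  (1 / 4 : ℂ) • (∑ᶠ j : ℤ, MvPowerSeries.coeff μ (normalOrdered β (n - j) j u)) -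
    (α₀ * ((n : ℂ) + 1)) • MvPowerSeries.coeff μ (mode β n u)

end Heisenberg

/-- `U⁻(z) v = exp (∑_{n ≥ 1} (1/n) (∑_i a_i z_i ^ n) a_{-n}) v` for charges `a_i` at the points
`z_i`. The `a_{-n}` commute, so the coefficient of `∏ a_{-n} ^ (μ n) v` in the exponential is
`∏_n ((∑_i a_i z_i ^ n) / n) ^ (μ n) / (μ n)!`. -/
def Uminus {ι : Type*} [Fintype ι] (a z : ι → ℂ) : Fock ℂ := fun μ =>
  μ.prod fun n k => ((∑ i, a i * z i ^ (n : ℕ)) / ((n : ℕ) : ℂ)) ^ k / (k.factorial : ℂ)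

/-! ### The formal conformal map and the operator `G_f`

The polynomial variable with index `i : ℕ` is the coefficient `f_{-2-i}` of
`f(z) = z + ∑_{m ≤ -2} f_m z^{1+m}`. Laurent series at infinity are written as power series in
`1/z`, up to a power of `z`. -/

section FormalMap

variable (A : Type*) [CommRing A]

/-- The power series `F` in `1/z` with `f(z) = z F(1/z)`. -/
def fSeries : PowerSeries (MvPolynomial ℕ A) := PowerSeries.mk fun n =>
  if n = 0 then 1 else if n = 1 then 0 else MvPolynomial.X (n - 2)

/-- The derivative `f'(z) = 1 + ∑_{m ≤ -2} (1+m) f_m z^m`, as a power series in `1/z`. -/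
def fDerivSeries : PowerSeries (MvPolynomial ℕ A) := PowerSeries.mk fun n =>
  if n = 0 then 1 else if n = 1 then 0 else (1 - (n : MvPolynomial ℕ A)) * MvPolynomial.X (n - 2)

/-- For `m = -2-i` and `k = -2-j` with `k ≤ m`, the residue
`Res_w w^{1+m} f'(w) / f(w)^{2+k}`. As `f(w)^{-2-k} = w^j F(1/w)^j`, the residue, which is the
coefficient of `w^{-1}`, is the coefficient of `w^{-(j-i)}` in `f'(w) F(1/w)^j`. -/
def residueG (i j : ℕ) : MvPolynomial ℕ A :=
  PowerSeries.coeff (j - i) (fDerivSeries A * fSeries A ^ j)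

variable {A}

/-- For `m = -2-i`, the polynomial
`p_m(-x, f_{-2}, f_{-3}, …) = Res_v v^{-2-m} / (f(v) - x)`, where `1 / (f(v) - x)` is expanded at
`v = ∞`. As `f(v) - x = v (F(1/v) - x/v)`, it is the coefficient of `v^{-i}` in the inverse series
of `F(1/v) - x/v`. -/
def pPoly (x : A) (i : ℕ) : MvPolynomial ℕ A :=
  PowerSeries.coeff i (PowerSeries.invOfUnit
    (fSeries A - PowerSeries.C (MvPolynomial.C x) * PowerSeries.X) 1)

variable [Algebra ℂ A]

/-- The part of `G_f` of degree `d`, where `f_m` has degree `-m`: from `∂_{f_m} G_f =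
-∑_{k ≤ m} (Res_w w^{1+m} f'(w) / f(w)^{2+k}) G_f L_k` and Euler's identity
`∑_m (-m) f_m ∂_{f_m} G_d = d G_d`, one gets
`d G_d = -∑_{k ≤ -2} (∑_{k ≤ m ≤ -2} (-m) f_m Res_w w^{1+m} f'(w) / f(w)^{2+k}) G_{d+k} L_k`. -/
def Gpart (β α₀ : ℂ) : ℕ → Fock A → Fock (MvPolynomial ℕ A)
  | 0, u => MvPowerSeries.map MvPolynomial.C u
  | d + 1, u => (-1 / ((d : ℂ) + 1)) • ∑ j : Fin d,
      (∑ i ∈ Finset.range (j.val + 1),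
        ((i : MvPolynomial ℕ A) + 2) * MvPolynomial.X i * residueG A i j.val) •
      Gpart β α₀ (d - 1 - j.val) (virasoro β α₀ (-2 - (j.val : ℤ)) u)
termination_by d _ => d
decreasing_by omega

/-- The operator `G_f`, the sum of its homogeneous parts. The part of degree `d` raises the level
by `d`, so only `d ≤ level μ` contribute to the coefficient at `μ`. -/
def opG (β α₀ : ℂ) (u : Fock A) : Fock (MvPolynomial ℕ A) := fun μ =>
  ∑ d ∈ Finset.range (level μ + 1), MvPowerSeries.coeff μ (Gpart β α₀ d u)

/-- The defining properties of `G_f`: it is the identity for `f = id` (all `f_m = 0`), and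
`∂_{f_m} G_f = -∑_{k ≤ m} (Res_w w^{1+m} f'(w) / f(w)^{2+k}) G_f L_k` for all `m ≤ -2`. Since
`G_f L_{-2-j}` raises the level by at least `2 + j`, the sum may be cut at `j ≤ level μ`. -/
def IsConformalOperator (β α₀ : ℂ) (G : Fock A → Fock (MvPolynomial ℕ A)) : Prop :=
  ∀ (u : Fock A) (μ : ℕ+ →₀ ℕ),
    MvPolynomial.constantCoeff (MvPowerSeries.coeff μ (G u)) = MvPowerSeries.coeff μ u ∧
    ∀ i : ℕ, MvPolynomial.pderiv i (MvPowerSeries.coeff μ (G u)) =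
      -∑ j ∈ Finset.Icc i (level μ),
        residueG A i j * MvPowerSeries.coeff μ (G (virasoro β α₀ (-2 - (j : ℤ)) u))

end FormalMap

/-! ### Functions of the SLE data and the operators `𝒜_I` -/

variable {N : ℕ}

/-- The partial derivative `∂φ/∂x_J`. -/
def partialX (J : Fin N) (φ : (Fin N → ℝ) → ℂ) (x : Fin N → ℝ) : ℂ :=
  fderiv ℝ φ x (Pi.single J 1)

/-- Polynomials in `f_{-2}, f_{-3}, …` whose coefficients are functions of `x_1, …, x_N`. -/
abbrev SLEData (N : ℕ) := MvPolynomial ℕ ((Fin N → ℝ) → ℂ)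

/-- `η` belongs to `C^∞(U → ℂ)[f_{-2}, f_{-3}, …]`. -/
def SLEData.SmoothOn (U : Set (Fin N → ℝ)) (η : SLEData N) : Prop :=
  ∀ s : ℕ →₀ ℕ, ContDiffOn ℝ (⊤ : ℕ∞) (MvPolynomial.coeff s η) U

/-- The value of `η` at the point `x` and the coefficients `f_{-2-i} = g i`. -/
def SLEData.value (η : SLEData N) (x : Fin N → ℝ) (g : ℕ → ℝ) : ℂ :=
  MvPolynomial.eval (fun i => (g i : ℂ)) (MvPolynomial.map (Pi.evalRingHom (fun _ => ℂ) x) η)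

/-- The null field operator `𝒟_I`, for `N` curves with the same `κ` and no passive points. -/
def nullOp (κ : ℝ) (I : Fin N) (φ : (Fin N → ℝ) → ℂ) : (Fin N → ℝ) → ℂ := fun x =>
  (κ : ℂ) / 2 * partialX I (partialX I φ) x +
    ∑ J ∈ Finset.univ.erase I,
      (2 / ((x J : ℂ) - (x I : ℂ)) * partialX J φ x +
        (((κ : ℂ) - 6) / (κ : ℂ)) / ((x J : ℂ) - (x I : ℂ)) ^ 2 * φ x)

/-- `𝒜_I = 𝒟_I + 2 ∑_{m ≤ -2} p_m(-x_I, f_{-2}, …) ∂/∂f_m`, with `𝒟_I` acting on the coefficients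
of the polynomial `η`; the derivatives in variables which `η` does not contain vanish. -/
def driftOp (κ : ℝ) (I : Fin N) (η : SLEData N) : SLEData N :=
  (∑ s ∈ η.support, MvPolynomial.monomial s (nullOp κ I (MvPolynomial.coeff s η))) +
    2 * ∑ i ∈ η.vars, pPoly (fun x : Fin N → ℝ => (x I : ℂ)) i * MvPolynomial.pderiv i η

/-! ### Screening contours and the screened state -/

/-- Contours for `L` screening charges, over a set `U` of positions `x` of the curves: for every
`x ∈ U` and every `R` a closed curve `[0,1] → ℂ` for `w_R`, depending smoothly on `x` (a fixed
contour is the special case of a constant family), together with a continuous choice along the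
contours of the logarithms of `x_J - x_I` (`I < J`), `w_S - w_R` (`R < S`) and `x_I - w_R`. In
particular the contours avoid each other and the points `x_I`. -/
structure Contours (N L : ℕ) (U : Set (Fin N → ℝ)) where
  curve : (Fin N → ℝ) → Fin L → ℝ → ℂ
  smooth : ∀ R, ContDiffOn ℝ (⊤ : ℕ∞) (fun p : (Fin N → ℝ) × ℝ => curve p.1 R p.2) (U ×ˢ univ)
  closed : ∀ x ∈ U, ∀ R, curve x R 0 = curve x R 1
  logXX : Fin N → Fin N → (Fin N → ℝ) → ℂ
  logXX_continuous : ∀ I J, I < J → ContinuousOn (logXX I J) U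
  exp_logXX : ∀ I J, I < J → ∀ x ∈ U, Complex.exp (logXX I J x) = (x J : ℂ) - (x I : ℂ)
  logWW : Fin L → Fin L → (Fin N → ℝ) → ℝ → ℝ → ℂ
  logWW_continuous : ∀ R S, R < S → ContinuousOn
    (fun p : (Fin N → ℝ) × ℝ × ℝ => logWW R S p.1 p.2.1 p.2.2) (U ×ˢ (Icc 0 1 ×ˢ Icc 0 1))
  exp_logWW : ∀ R S, R < S → ∀ x ∈ U, ∀ r ∈ Icc (0 : ℝ) 1, ∀ s ∈ Icc (0 : ℝ) 1,
    Complex.exp (logWW R S x r s) = curve x S s - curve x R r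
  logXW : Fin N → Fin L → (Fin N → ℝ) → ℝ → ℂ
  logXW_continuous : ∀ I R, ContinuousOn
    (fun p : (Fin N → ℝ) × ℝ => logXW I R p.1 p.2) (U ×ˢ Icc 0 1)
  exp_logXW : ∀ I R, ∀ x ∈ U, ∀ r ∈ Icc (0 : ℝ) 1,
    Complex.exp (logXW I R x r) = (x I : ℂ) - curve x R r

namespace Contours

variable {L : ℕ} {U : Set (Fin N → ℝ)}

/-- The branch along the contours, at `w_R = curve x R (t R)`, of the function
`h = ∏_{I<J} (x_J - x_I)^{2/κ} ∏_{R<S} (w_S - w_R)^{8/κ} ∏_{I,R} (x_I - w_R)^{-4/κ}`. -/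
def h (Γ : Contours N L U) (κ : ℝ) (x : Fin N → ℝ) (t : Fin L → ℝ) : ℂ :=
  Complex.exp
    ((2 / κ : ℂ) * (∑ I, ∑ J ∈ Finset.Ioi I, Γ.logXX I J x) +
      (8 / κ : ℂ) * (∑ R, ∑ S ∈ Finset.Ioi R, Γ.logWW R S x (t R) (t S)) -
      (4 / κ : ℂ) * (∑ I, ∑ R, Γ.logXW I R x (t R)))

/-- `h` takes the same value at the two endpoints of the contour of every `w_R`. -/
def SameEndValues (Γ : Contours N L U) (κ : ℝ) : Prop :=
  ∀ x ∈ U, ∀ t ∈ Icc (0 : Fin L → ℝ) 1, ∀ R,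
    Γ.h κ x (Function.update t R 0) = Γ.h κ x (Function.update t R 1)

/-- The vector `∫_Γ dw_1 ⋯ dw_L h(x, w) U⁻(x, w) v_β`, whose coefficients are functions of `x`.
The charge is `1/√κ` at each `x_I` and `α_- = -2/√κ` at each `w_R`. -/
def screened (Γ : Contours N L U) (κ : ℝ) : Fock ((Fin N → ℝ) → ℂ) := fun μ x =>
  ∫ t in Icc (0 : Fin L → ℝ) 1,
    Γ.h κ x t *
      MvPowerSeries.coeff μ (Uminus
        (Sum.elim (fun _ : Fin N => 1 / ((√κ : ℝ) : ℂ)) (fun _ : Fin L => -2 / ((√κ : ℝ) : ℂ)))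
        (Sum.elim (fun I => (x I : ℂ)) (fun R => Γ.curve x R (t R)))) *
      ∏ R, deriv (Γ.curve x R) (t R)

/-- The partition function `Z(x) = ∫_Γ h(x, w) dw_1 ⋯ dw_L`. -/
def partitionFunction (Γ : Contours N L U) (κ : ℝ) (x : Fin N → ℝ) : ℂ :=
  ∫ t in Icc (0 : Fin L → ℝ) 1, Γ.h κ x t * ∏ R, deriv (Γ.curve x R) (t R)

end Contours

/-- The total charge `β = (N - 2L)/√κ`. -/
def totalCharge (N L : ℕ) (κ : ℝ) : ℂ := ((N : ℂ) - 2 * (L : ℂ)) / ((√κ : ℝ) : ℂ)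

/-- `α₀ = (α_+ + α_-)/2` with `α_+ = √κ/2` and `α_- = -2/√κ`. -/
def backgroundCharge (κ : ℝ) : ℂ := (((√κ : ℝ) : ℂ) / 2 + -2 / ((√κ : ℝ) : ℂ)) / 2

/-- The unnormalized multiple SLE state `G_f ∫_Γ dw h(x, w) U⁻(x, w) v_β`. -/
def Contours.state {L : ℕ} {U : Set (Fin N → ℝ)} (Γ : Contours N L U) (κ : ℝ) :
    Fock (SLEData N) :=
  opG (totalCharge N L κ) (backgroundCharge κ) (Γ.screened κ)

/-! ### Multiple SLE and local martingales -/

/-- `M` is a local martingale on the random interval `[0, τ)`. -/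
def IsLocalMartingaleOn {Ω : Type*} {mΩ : MeasurableSpace Ω} (ℱ : Filtration ℝ≥0 mΩ)
    (P : Measure Ω) (τ : Ω → WithTop ℝ≥0) (M : ℝ≥0 → Ω → ℂ) : Prop :=
  ∃ σ : ℕ → Ω → WithTop ℝ≥0,
    (∀ n, IsStoppingTime ℱ (σ n)) ∧
    (∀ ω, Monotone fun n => σ n ω) ∧
    (∀ n ω, σ n ω < τ ω) ∧
    (∀ᵐ ω ∂P, Filter.Tendsto (fun n => σ n ω) Filter.atTop (nhds (τ ω))) ∧
    ∀ n, Martingale (stoppedProcess M (σ n)) ℱ P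

/-- The generator, with respect to the clock of the `I`-th curve, of the system
`dX^I = √κ dA^I + ∑_{J≠I} 2/(X^I - X^J) d⟨A^J⟩ + κ ∂_I log Z d⟨A^I⟩`,
`dg_m = ∑_I 2 p_m(-X^I, g_{-2}, g_{-3}, …) d⟨A^I⟩`,
applied to a function `Φ` of `x` and of the first `k` of the coefficients `g`. -/
def generator (κ : ℝ) (Z : (Fin N → ℝ) → ℂ) (I : Fin N) {k : ℕ}
    (Φ : (Fin N → ℝ) × (Fin k → ℝ) → ℂ) (x : Fin N → ℝ) (g : ℕ → ℝ) : ℂ :=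
  (κ : ℂ) / 2 * partialX I (partialX I fun x' => Φ (x', fun i => g i)) x +
    (κ : ℂ) * (partialX I Z x / Z x) * partialX I (fun x' => Φ (x', fun i => g i)) x +
    (∑ J ∈ Finset.univ.erase I,
      2 / ((x J : ℂ) - (x I : ℂ)) * partialX J (fun x' => Φ (x', fun i => g i)) x) +
    ∑ i : Fin k, 2 * ((MvPolynomial.eval g (pPoly (x I) i) : ℝ) : ℂ) *
      fderiv ℝ (fun y => Φ (x, y)) (fun i => g i) (Pi.single i 1)

/-- Multiple SLE with partition function `Z`, up to the stopping time `τ`, as a weak solution: the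
driving processes `X^1, …, X^N`, started at `x₀`, the coefficients `g_{-2-i}` of the conformal maps
`g_t(z) = z + ∑_{m ≤ -2} g_m z^{1+m}`, and the clocks `⟨A^I⟩_t = q I ([0, t])`, given as atomless
random measures. The Loewner equation `dg_t(z) = ∑_I 2 / (g_t(z) - X^I_t) d⟨A^I⟩_t` is written in
the coefficients of its expansion at `z = ∞`. The stochastic differential equations for the
driving processes and for the coefficients are imposed in the form of the local martingale problem
for the joint process; that there are no mixed second derivatives in `x` expresses
`⟨A^I, A^J⟩ = 0` for `I ≠ J`. -/
structure IsMultipleSLE {Ω : Type*} {mΩ : MeasurableSpace Ω} (ℱ : Filtration ℝ≥0 mΩ)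
    (P : Measure Ω) (κ : ℝ) (U : Set (Fin N → ℝ)) (Z : (Fin N → ℝ) → ℂ) (x₀ : Fin N → ℝ)
    (τ : Ω → WithTop ℝ≥0) (X : ℝ≥0 → Ω → Fin N → ℝ) (g : ℝ≥0 → Ω → ℕ → ℝ)
    (q : Fin N → Ω → Measure ℝ≥0) : Prop where
  /-- A constant multiple of the partition function is positive. -/
  partition_pos : ∃ c : ℂ, ∀ x ∈ U, ∃ r : ℝ, 0 < r ∧ c * Z x = (r : ℂ)
  stopping : IsStoppingTime ℱ τ
  X_adapted : ∀ t I, StronglyMeasurable[ℱ t] fun ω => X t ω I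
  g_adapted : ∀ t i, StronglyMeasurable[ℱ t] fun ω => g t ω i
  q_adapted : ∀ t I, Measurable[ℱ t] fun ω => q I ω (Iic t)
  X_zero : ∀ ω, X 0 ω = x₀
  g_zero : ∀ ω, g 0 ω = 0
  X_mem : ∀ ω (t : ℝ≥0), (t : WithTop ℝ≥0) < τ ω → X t ω ∈ U
  X_continuous : ∀ ω, ContinuousOn (fun t => X t ω) {t : ℝ≥0 | (t : WithTop ℝ≥0) < τ ω}
  g_continuous : ∀ ω, ContinuousOn (fun t => g t ω) {t : ℝ≥0 | (t : WithTop ℝ≥0) < τ ω}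
  q_atomless : ∀ I ω t, q I ω {t} = 0
  q_finite : ∀ I ω (t : ℝ≥0), (t : WithTop ℝ≥0) < τ ω → q I ω (Iic t) < ⊤
  loewner : ∀ ω (t : ℝ≥0), (t : WithTop ℝ≥0) < τ ω → ∀ i,
    g t ω i = ∑ I, ∫ s in Iic t, 2 * MvPolynomial.eval (g s ω) (pPoly (X s ω I) i) ∂(q I ω)
  martingale_problem : ∀ (k : ℕ) (Φ : (Fin N → ℝ) × (Fin k → ℝ) → ℂ),
    ContDiffOn ℝ (⊤ : ℕ∞) Φ (U ×ˢ univ) →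
    IsLocalMartingaleOn ℱ P τ fun t ω =>
      Φ (X t ω, fun i => g t ω i) -
        ∑ I, ∫ s in Iic t, generator κ Z I Φ (X s ω) (g s ω) ∂(q I ω)

end CoulombGas

end

open CoulombGas

noncomputable section

namespace CoulombGas

set_option linter.unusedSectionVars false

/-! ### The level grading and explicit Virasoro generators -/

section Level

/-! The theorem rests on one cancellation. Let `u` be the screened vector, the contour integral of
`h U⁻ v`. The part of `𝒜_I` that differentiates in `x` acts on `u` as `2 ∑_j x_I^j L_{-2-j}`, while
the Loewner field `2 ∑_m p_m ∂/∂f_m` turns `G_f` into `-2 ∑_j x_I^j G_f L_{-2-j}`. Since `G_f` does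
not involve `x`, the two contributions to `𝒜_I G_f u` cancel (`coeff_driftOp_state`).

Loewner half. Contracting the residues in the equations for `∂G_f/∂f_m` with `p_m` gives `Res f' f^j
/ (f - x) = x^j` (`sum_pPoly_mul_residue`). The equations themselves form an overdetermined system,
of which the recursion defining `Gpart` is only the contraction with the Euler field. The full
system follows (`pderiv_gCoeff`) from flatness: the Virasoro relations, which have no central term
among negative modes (`virasoro_comm`), match a Maurer-Cartan equation for the residues
(`sum_residue_mul_residue`), obtained from the Wronskian of two powers of `w` expanded in `1/f`.

Null field half. `U⁻` is a coherent vector, so `∑_j z_i^j L_{-2-j}` is computed explicitly on it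
(`sum_virasoro_Uminus`). At a point whose charge satisfies `κ a² = 1` the result is a second order
differential operator, conjugated by `h`, in all the points including the screening charges
(`nabla_nabla_Uminus`). A charge `a` has weight `a² - 2 α₀ a`: this is `(6 - κ)/(2κ)` at the `x_I`,
which gives the potential in `𝒜_I`, and `1` at the `w_R`. Weight one makes the contribution of `w_R`
a total derivative, which integrates to zero because the contours are closed and `h` agrees at their
ends (`pairing_nabla_inr`). Letting the contours move with `x` also adds only total derivatives
(`hasFDerivAt_pairing`). The outcome is `nullOp_screened`.

Martingale. At level zero the null field equation says that `Z` is annihilated. Hence the generator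
of multiple SLE is `𝒜_I` conjugated by `Z` (`generator_value`); it kills the coefficients of `Ψ /
Z`, and the martingale problem concludes.

Throughout, `L_{-2-j}` and `G_f` have complex structure constants and so commute with every ℂ-linear
map of the coefficients (`virasoro_mapLin`, `coeff_opG_mapLin`). Integration, evaluation and
differential operators in `x` are passed through them in this way. -/

lemma level_add (μ ν : ℕ+ →₀ ℕ) : level (μ + ν) = level μ + level ν :=
  Finsupp.sum_add_index' (by simp) (by intros; ring)

lemma level_single (n : ℕ+) : level (Finsupp.single n 1) = n := by
  simp [level]

lemma single_le_of_one_le {μ : ℕ+ →₀ ℕ} {n : ℕ+} (h : 1 ≤ μ n) : Finsupp.single n 1 ≤ μ := by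
  simpa using h

lemma level_sub_single {μ : ℕ+ →₀ ℕ} {n : ℕ+} (h : 1 ≤ μ n) :
    level (μ - Finsupp.single n 1) + n = level μ := by
  conv_rhs => rw [← tsub_add_cancel_of_le (single_le_of_one_le h), level_add, level_single]

end Level

/-! ### The generators `L_{-2-j}` in coordinates -/

section Modes

variable {R : Type*} [CommRing R] [Algebra ℂ R]

lemma coeff_smul_fock {S : Type*} [Semiring S] [Module S R] (c : S) (u : Fock R)
    (μ : ℕ+ →₀ ℕ) : MvPowerSeries.coeff μ (c • u) = c • MvPowerSeries.coeff μ u := rfl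

lemma coeff_X_mul (n : ℕ+) (u : Fock R) (μ : ℕ+ →₀ ℕ) :
    MvPowerSeries.coeff μ (MvPowerSeries.X n * u) =
      if 1 ≤ μ n then MvPowerSeries.coeff (μ - Finsupp.single n 1) u else 0 := by
  rw [MvPowerSeries.X_def, MvPowerSeries.coeff_monomial_mul]
  simp

lemma coeff_X_mul_of_level_lt {n : ℕ+} (u : Fock R) {μ : ℕ+ →₀ ℕ} (h : level μ < n) :
    MvPowerSeries.coeff μ (MvPowerSeries.X n * u) = 0 := by
  rw [coeff_X_mul, if_neg]
  intro h1
  have := level_sub_single h1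
  omega

/-- The operator `(l + 1) ∂/∂X_{l+1}`, which is half of `a_{l+1}`. -/
def lower (l : ℕ) (u : Fock R) : Fock R := fun μ =>
  (((l : R) + 1) * ((μ l.succPNat : R) + 1)) *
    MvPowerSeries.coeff (μ + Finsupp.single l.succPNat 1) u

lemma coeff_lower (l : ℕ) (u : Fock R) (μ : ℕ+ →₀ ℕ) :
    MvPowerSeries.coeff μ (lower l u) = (((l : R) + 1) * ((μ l.succPNat : R) + 1)) *
      MvPowerSeries.coeff (μ + Finsupp.single l.succPNat 1) u := rfl

lemma mode_neg (β : ℂ) (n : ℕ) (u : Fock R) :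
    mode β (-((n : ℤ) + 1)) u = MvPowerSeries.X n.succPNat * u := by
  have h : (-((n : ℤ) + 1)) < 0 := by omega
  have h2 : (- -((n : ℤ) + 1)).toNat = n + 1 := by omega
  rw [mode, if_pos h, h2]
  rfl

lemma mode_zero (β : ℂ) (u : Fock R) : mode β 0 u = (2 * β) • u := by
  simp [mode]

lemma mode_pos (β : ℂ) (l : ℕ) (u : Fock R) :
    mode β ((l : ℤ) + 1) u = (2 : ℂ) • lower l u := by
  have h : ¬ ((l : ℤ) + 1 < 0) := by omega
  have h' : ¬ ((l : ℤ) + 1 = 0) := by omega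
  have h2 : ((l : ℤ) + 1).toNat = l + 1 := by omega
  refine (if_neg h).trans ((if_neg h').trans ?_)
  rw [h2]
  ext μ
  change (2 * (((l : ℤ) + 1 : ℤ) : R) * ((μ l.succPNat : R) + 1)) *
    MvPowerSeries.coeff (μ + Finsupp.single l.succPNat 1) u = (2 : ℂ) • ((((l : R) + 1) *
    ((μ l.succPNat : R) + 1)) * MvPowerSeries.coeff (μ + Finsupp.single l.succPNat 1) u)
  rw [ofNat_smul_eq_nsmul, nsmul_eq_mul]
  push_cast
  ring

lemma normalOrdered_comm (β : ℂ) (n m : ℤ) (u : Fock R) :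
    normalOrdered β n m u = normalOrdered β m n u := by
  unfold normalOrdered
  rcases lt_trichotomy n m with h | h | h
  · rw [if_pos h.le, if_neg (not_le.2 h)]
  · subst h; rfl
  · rw [if_neg (not_le.2 h), if_pos h.le]

lemma normalOrdered_pos (β : ℂ) (j l : ℕ) (u : Fock R) :
    normalOrdered β (-2 - (j : ℤ) - ((l : ℤ) + 1)) ((l : ℤ) + 1) u =
      (2 : ℂ) • (MvPowerSeries.X (l + j + 2).succPNat * lower l u) := by
  rw [normalOrdered, if_pos (by omega), mode_pos]
  have : (-2 - (j : ℤ) - ((l : ℤ) + 1)) = -(((l + j + 2 : ℕ) : ℤ) + 1) := by push_cast; ring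
  rw [this, mode_neg, mul_smul_comm]

lemma normalOrdered_zero (β : ℂ) (j : ℕ) (u : Fock R) :
    normalOrdered β (-2 - (j : ℤ) - 0) 0 u =
      (2 * β) • (MvPowerSeries.X (j + 1).succPNat * u) := by
  rw [normalOrdered, if_pos (by omega), mode_zero]
  have : (-2 - (j : ℤ) - 0) = -(((j + 1 : ℕ) : ℤ) + 1) := by push_cast; ring
  rw [this, mode_neg, mul_smul_comm]

lemma normalOrdered_neg (β : ℂ) (a b : ℕ) (u : Fock R) :
    normalOrdered β (-((a : ℤ) + 1)) (-((b : ℤ) + 1)) u =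
      MvPowerSeries.X a.succPNat * (MvPowerSeries.X b.succPNat * u) := by
  rw [normalOrdered, mode_neg, mode_neg, mode_neg, mode_neg, mul_left_comm]
  simp only [ite_self]

/-- The generator `L_{-2-j}` in coordinates; all but finitely many terms of the sum vanish. -/
theorem coeff_virasoro (β α₀ : ℂ) (j M : ℕ) (u : Fock R) {μ : ℕ+ →₀ ℕ} (hM : level μ ≤ M) :
    MvPowerSeries.coeff μ (virasoro β α₀ (-2 - (j : ℤ)) u) =
      (1 / 4 : ℂ) • (∑ p ∈ Finset.HasAntidiagonal.antidiagonal j, MvPowerSeries.coeff μ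
          (MvPowerSeries.X p.1.succPNat * (MvPowerSeries.X p.2.succPNat * u))) +
        ∑ l ∈ Finset.range M,
          MvPowerSeries.coeff μ (MvPowerSeries.X (l + j + 2).succPNat * lower l u) +
        (β + α₀ * (j + 1)) •
          MvPowerSeries.coeff μ (MvPowerSeries.X (j + 1).succPNat * u) := by
  set S : ℤ → R := fun l => MvPowerSeries.coeff μ (normalOrdered β (-2 - (j : ℤ) - l) l u) with hS
  -- Normal ordering is symmetric, so terms pair up under `l ↔ -2-j-l`; this doubling turns the
  -- prefactor 1/4 into 1 on the mixed terms and into `β` on the zero mode.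
  have hsymm : ∀ l, S (-2 - j - l) = S l := by
    intro l
    simp only [hS]
    rw [normalOrdered_comm]
    congr 2
    ring
  have hpos : ∀ l : ℕ, S ((l : ℤ) + 1) = (2 : ℂ) • MvPowerSeries.coeff μ
      (MvPowerSeries.X (l + j + 2).succPNat * lower l u) := by
    intro l
    simp only [hS]
    rw [normalOrdered_pos, coeff_smul_fock]
  have hzero : S 0 = (2 * β) • MvPowerSeries.coeff μ (MvPowerSeries.X (j + 1).succPNat * u) := by
    simp only [hS]
    rw [normalOrdered_zero, coeff_smul_fock]
  have hneg : ∀ a b : ℕ, a + b = j → S (-((b : ℤ) + 1)) = MvPowerSeries.coeff μ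
      (MvPowerSeries.X a.succPNat * (MvPowerSeries.X b.succPNat * u)) := by
    intro a b hab
    simp only [hS]
    have : -2 - (j : ℤ) - (-((b : ℤ) + 1)) = -((a : ℤ) + 1) := by subst hab; push_cast; ring
    rw [this, normalOrdered_neg]
  have hbig : ∀ l : ℤ, (M : ℤ) < l → S l = 0 := by
    intro l hl
    obtain ⟨m, rfl⟩ : ∃ m : ℕ, l = (m : ℤ) + 1 := ⟨(l - 1).toNat, by omega⟩
    rw [hpos, coeff_X_mul_of_level_lt, smul_zero]
    simp only [Nat.succPNat_coe]
    omega
  -- The window is `-(M+j+2) ≤ l ≤ M`, cut into the blocks `l ≤ -2-j`, `-1-j ≤ l ≤ -1` and `l ≥ 0`.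
  -- The middle block consists of pairs of creation operators; the outer two are exchanged by the
  -- reflection.
  have hfin : ∑ᶠ l : ℤ, S l =
      ∑ k ∈ Finset.range ((M + 1) + (j + 1) + (M + 1)), S ((k : ℤ) - (M + j + 2)) := by
    rw [← Finset.sum_image (s := Finset.range ((M + 1) + (j + 1) + (M + 1)))
      (g := fun k : ℕ => (k : ℤ) - (M + j + 2)) (f := S) (by intro a _ b _ h; simpa using h)]
    apply finsum_eq_sum_of_support_subset
    intro l hl
    rw [Function.mem_support] at hl
    simp only [Finset.coe_image, Set.mem_image, Finset.coe_range, Set.mem_Iio]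
    have h1 : l ≤ M := by
      by_contra h
      exact hl (hbig l (by omega))
    have h2 : -2 - j - l ≤ M := by
      by_contra h
      exact hl (by rw [← hsymm]; exact hbig _ (by omega))
    exact ⟨(l + (M + j + 2)).toNat, by omega, by omega⟩
  have hlast : ∑ k ∈ Finset.range (M + 1), S (k : ℤ) =
      (2 : ℂ) • (∑ l ∈ Finset.range M,
          MvPowerSeries.coeff μ (MvPowerSeries.X (l + j + 2).succPNat * lower l u)) +
      (2 * β) • MvPowerSeries.coeff μ (MvPowerSeries.X (j + 1).succPNat * u) := by
    rw [Finset.sum_range_succ', Finset.smul_sum]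
    congr 1
    apply Finset.sum_congr rfl
    intro l _
    rw [← hpos]
    push_cast
    rfl
  have hfirst : ∑ k ∈ Finset.range (M + 1), S ((k : ℤ) - (M + j + 2)) =
      ∑ k ∈ Finset.range (M + 1), S (k : ℤ) := by
    rw [← Finset.sum_range_reflect]
    apply Finset.sum_congr rfl
    intro k hk
    rw [Finset.mem_range] at hk
    rw [← hsymm (k : ℤ)]
    congr 1
    omega
  have hmid : ∑ k ∈ Finset.range (j + 1), S (((M + 1 + k : ℕ) : ℤ) - (M + j + 2)) =
      ∑ p ∈ Finset.HasAntidiagonal.antidiagonal j, MvPowerSeries.coeff μ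
          (MvPowerSeries.X p.1.succPNat * (MvPowerSeries.X p.2.succPNat * u)) := by
    rw [Finset.Nat.sum_antidiagonal_eq_sum_range_succ_mk]
    apply Finset.sum_congr rfl
    intro k hk
    rw [Finset.mem_range] at hk
    rw [← hneg k (j - k) (by omega)]
    congr 1
    push_cast
    omega
  have hlast' : ∑ k ∈ Finset.range (M + 1),
      S (((M + 1 + (j + 1) + k : ℕ) : ℤ) - (M + j + 2)) =
      ∑ k ∈ Finset.range (M + 1), S (k : ℤ) := by
    apply Finset.sum_congr rfl
    intro k _
    congr 1
    push_cast
    ring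
  have htop : MvPowerSeries.coeff μ (mode β (-2 - (j : ℤ)) u) =
      MvPowerSeries.coeff μ (MvPowerSeries.X (j + 1).succPNat * u) := by
    have : (-2 - (j : ℤ)) = -(((j + 1 : ℕ) : ℤ) + 1) := by push_cast; ring
    rw [this, mode_neg]
  change (1 / 4 : ℂ) • (∑ᶠ l : ℤ, S l) - (α₀ * (((-2 - (j : ℤ) : ℤ) : ℂ) + 1)) •
    MvPowerSeries.coeff μ (mode β (-2 - (j : ℤ)) u) = _
  rw [hfin, Finset.sum_range_add, Finset.sum_range_add, hfirst, hmid, hlast', hlast, htop]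
  push_cast
  module

end Modes

/-! ### Naturality under linear maps of the coefficients -/

section Natural

variable {R S : Type*} [CommRing R] [Algebra ℂ R] [CommRing S] [Algebra ℂ S]

/-- A linear map applied to all coefficients. -/
def mapLin (T : R →ₗ[ℂ] S) (u : Fock R) : Fock S := fun ν => T (MvPowerSeries.coeff ν u)

lemma coeff_mapLin (T : R →ₗ[ℂ] S) (u : Fock R) (ν : ℕ+ →₀ ℕ) :
    MvPowerSeries.coeff ν (mapLin T u) = T (MvPowerSeries.coeff ν u) := rfl

lemma map_natCast_mul (T : R →ₗ[ℂ] S) (n : ℕ) (a : R) : T ((n : R) * a) = n * T a := by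
  rw [← nsmul_eq_mul, map_nsmul, nsmul_eq_mul]

lemma X_mul_mapLin (T : R →ₗ[ℂ] S) (n : ℕ+) (u : Fock R) :
    MvPowerSeries.X n * mapLin T u = mapLin T (MvPowerSeries.X n * u) := by
  ext μ
  rw [coeff_mapLin, coeff_X_mul, coeff_X_mul]
  split_ifs <;> simp [coeff_mapLin]

lemma lower_mapLin (T : R →ₗ[ℂ] S) (l : ℕ) (u : Fock R) :
    lower l (mapLin T u) = mapLin T (lower l u) := by
  ext μ
  rw [coeff_mapLin, coeff_lower, coeff_lower, coeff_mapLin]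
  have := map_natCast_mul T ((l + 1) * (μ l.succPNat + 1))
    (MvPowerSeries.coeff (μ + Finsupp.single l.succPNat 1) u)
  push_cast at this
  exact this.symm

/-- Each coefficient of `L_{-2-j} u` is a finite complex combination of coefficients of `u`, so `T`
need not be multiplicative. -/
theorem virasoro_mapLin (T : R →ₗ[ℂ] S) (β α₀ : ℂ) (j : ℕ) (u : Fock R) :
    virasoro β α₀ (-2 - (j : ℤ)) (mapLin T u) = mapLin T (virasoro β α₀ (-2 - (j : ℤ)) u) := by
  ext μ
  rw [coeff_mapLin, coeff_virasoro β α₀ j _ _ le_rfl, coeff_virasoro β α₀ j _ _ le_rfl]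
  simp only [lower_mapLin, X_mul_mapLin, coeff_mapLin, map_add, map_smul, map_sum]

end Natural

/-! ### Linearity and the grading by level -/

section Linear

variable {R : Type*} [CommRing R] [Algebra ℂ R]

lemma lower_add (l : ℕ) (u v : Fock R) : lower l (u + v) = lower l u + lower l v := by
  ext μ; simp only [map_add, coeff_lower]; ring

lemma lower_smul (l : ℕ) (c : R) (u : Fock R) : lower l (c • u) = c • lower l u := by
  ext μ; simp only [coeff_smul_fock, coeff_lower, smul_eq_mul]; ring

/-- The generator `L_{-2-j}` as a linear map. -/
def virasoroL (β α₀ : ℂ) (j : ℕ) : Fock R →ₗ[R] Fock R where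
  toFun := virasoro β α₀ (-2 - (j : ℤ))
  map_add' u v := by
    ext μ
    rw [map_add]
    simp only [coeff_virasoro β α₀ j _ _ (le_refl (level μ)), lower_add, mul_add, map_add,
      Finset.sum_add_distrib, smul_add]
    ring
  map_smul' c u := by
    ext μ
    simp only [RingHom.id_apply, coeff_smul_fock]
    simp only [coeff_virasoro β α₀ j _ _ (le_refl (level μ)), lower_smul, mul_smul_comm,
      coeff_smul_fock, ← Finset.smul_sum, smul_add]
    simp only [smul_comm c]

@[simp] lemma virasoroL_apply (β α₀ : ℂ) (j : ℕ) (u : Fock R) :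
    virasoroL β α₀ j u = virasoro β α₀ (-2 - (j : ℤ)) u := rfl

/-- All components of `u` of level less than `n` vanish. -/
def LevelGE (n : ℕ) (u : Fock R) : Prop := ∀ ν, level ν < n → MvPowerSeries.coeff ν u = 0

lemma levelGE_zero (u : Fock R) : LevelGE 0 u := fun _ h => absurd h (Nat.not_lt_zero _)

lemma LevelGE.X_mul {n : ℕ} {u : Fock R} (h : LevelGE n u) (m : ℕ+) :
    LevelGE (n + m) (MvPowerSeries.X m * u) := by
  intro ν hν
  rw [coeff_X_mul]
  split_ifs with h1
  · apply h
    have := level_sub_single h1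
    omega
  · rfl

/-- The subtraction is truncated; for `n ≤ l + 1` there is nothing to prove. -/
lemma LevelGE.lower {n l : ℕ} {u : Fock R} (h : LevelGE n u) :
    LevelGE (n - (l + 1)) (lower l u) := by
  intro ν hν
  rw [coeff_lower, h, mul_zero]
  rw [level_add, level_single, Nat.succPNat_coe]
  omega

/-- Every term of `L_{-2-j}` raises the level by exactly `j + 2`: two creators of indices summing to
`j + 2`, the creator `X_{j+2}`, or `X_{l+j+3}` after a lowering by `l + 1`. -/
lemma LevelGE.virasoro {n : ℕ} {u : Fock R} (h : LevelGE n u) (β α₀ : ℂ) (j : ℕ) :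
    LevelGE (n + (j + 2)) (virasoro β α₀ (-2 - (j : ℤ)) u) := by
  intro ν hν
  rw [coeff_virasoro β α₀ j _ _ le_rfl, Finset.sum_eq_zero, Finset.sum_eq_zero, (h.X_mul _),
    smul_zero, smul_zero, add_zero, add_zero]
  · simp only [Nat.succPNat_coe]; omega
  · intro l _
    apply h.lower.X_mul
    simp only [Nat.succPNat_coe]; omega
  · rintro ⟨a, b⟩ hp
    rw [Finset.HasAntidiagonal.mem_antidiagonal] at hp
    apply (h.X_mul _).X_mul
    simp only [Nat.succPNat_coe] at *; omega

end Linear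

/-! ### The Virasoro commutation relations -/

section Commutator

/-- The derivation `∑_l l X_{l+j+2} ∂/∂X_l` on polynomials in the creation operators. -/
def wittDerivation (j : ℕ) : Derivation ℂ (MvPolynomial ℕ+ ℂ) (MvPolynomial ℕ+ ℂ) :=
  MvPolynomial.mkDerivation ℂ fun n : ℕ+ =>
    ((n : ℕ) : MvPolynomial ℕ+ ℂ) * MvPolynomial.X ((n : ℕ) + j + 1).succPNat

/-- The part of `L_{-2-j}` which acts as a multiplication operator. -/
def creationPart (β α₀ : ℂ) (j : ℕ) : MvPolynomial ℕ+ ℂ :=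
  (1 / 4 : ℂ) • (∑ p ∈ Finset.HasAntidiagonal.antidiagonal j,
    MvPolynomial.X p.1.succPNat * MvPolynomial.X p.2.succPNat) +
    (β + α₀ * (j + 1)) • MvPolynomial.X (j + 1).succPNat

lemma lower_monomial (l : ℕ) (s : ℕ+ →₀ ℕ) :
    lower l ((MvPolynomial.monomial s (1 : ℂ) : MvPolynomial ℕ+ ℂ) : Fock ℂ) =
      ((MvPolynomial.monomial (s - Finsupp.single l.succPNat 1)
        (((l : ℂ) + 1) * s l.succPNat) : MvPolynomial ℕ+ ℂ) : Fock ℂ) := by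
  classical
  ext ν
  rw [coeff_lower, MvPolynomial.coeff_coe, MvPolynomial.coeff_coe, MvPolynomial.coeff_monomial,
    MvPolynomial.coeff_monomial]
  by_cases h : s = ν + Finsupp.single l.succPNat 1
  · subst h
    simp
  · rw [if_neg h, mul_zero]
    split_ifs with h2
    · by_cases h3 : 1 ≤ s l.succPNat
      · exact absurd (by rw [← h2, tsub_add_cancel_of_le (single_le_of_one_le h3)]) h
      · have : s l.succPNat = 0 := by omega
        simp [this]
    · rfl

lemma virasoro_coe_monomial (β α₀ : ℂ) (j : ℕ) (s : ℕ+ →₀ ℕ) :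
    virasoro β α₀ (-2 - (j : ℤ)) ((MvPolynomial.monomial s (1 : ℂ) : MvPolynomial ℕ+ ℂ) : Fock ℂ) =
      ((creationPart β α₀ j * MvPolynomial.monomial s 1 +
        wittDerivation j (MvPolynomial.monomial s 1) : MvPolynomial ℕ+ ℂ) : Fock ℂ) := by
  classical
  ext μ
  rw [coeff_virasoro β α₀ j (level μ + level s) _ (Nat.le_add_right _ _)]
  rw [wittDerivation, MvPolynomial.mkDerivation_monomial, one_smul, creationPart]
  rw [add_mul, smul_mul_assoc, smul_mul_assoc, Finset.sum_mul, MvPolynomial.coeff_coe,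
    MvPolynomial.coeff_add, MvPolynomial.coeff_add, MvPolynomial.coeff_smul,
    MvPolynomial.coeff_smul, MvPolynomial.coeff_sum, add_right_comm]
  congr 1
  · congr 2
    · apply Finset.sum_congr rfl
      intro p _
      rw [← MvPolynomial.coeff_coe]
      push_cast
      rw [mul_assoc]
    · rw [← MvPolynomial.coeff_coe]
      push_cast
      rfl
  · rw [Finsupp.sum, MvPolynomial.coeff_sum]
    -- The derivation sums over the support of `s`, the explicit formula over `l`; they match under
    -- `n = l + 1`, and outside the support the lowered monomial has coefficient zero.
    symm
    apply Finset.sum_of_injOn (fun n : ℕ+ => n.natPred)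
    · intro a _ b _ h
      exact PNat.natPred_injective h
    · intro n hn
      have h1 : 1 ≤ s n := by
        have := Finsupp.mem_support_iff.1 hn
        omega
      have := level_sub_single h1
      have h3 := PNat.natPred_add_one n
      simp only [Finset.coe_range, Set.mem_Iio]
      omega
    · intro l _ hl
      have : s l.succPNat = 0 := by
        by_contra h
        exact hl ⟨l.succPNat, Finsupp.mem_support_iff.2 h, by simp⟩
      rw [lower_monomial, this]
      simp
    · intro n _
      obtain ⟨l, rfl⟩ : ∃ l : ℕ, n = l.succPNat := ⟨n.natPred, by simp⟩
      rw [Nat.natPred_succPNat, lower_monomial, ← MvPolynomial.coeff_coe]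
      rw [smul_eq_mul]
      have h4 : ((l.succPNat : ℕ) + j + 1) = l + j + 2 := by rw [Nat.succPNat_coe]; omega
      rw [h4, ← MvPolynomial.coe_X, ← MvPolynomial.coe_mul]
      congr 2
      rw [← MvPolynomial.C_mul_monomial, Nat.succPNat_coe, MvPolynomial.C_add,
        map_natCast MvPolynomial.C, MvPolynomial.C_1]
      push_cast
      ring

lemma virasoro_coe (β α₀ : ℂ) (j : ℕ) (p : MvPolynomial ℕ+ ℂ) :
    virasoro β α₀ (-2 - (j : ℤ)) (p : Fock ℂ) =
      ((creationPart β α₀ j * p + wittDerivation j p : MvPolynomial ℕ+ ℂ) : Fock ℂ) := by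
  rw [← virasoroL_apply]
  induction p using MvPolynomial.induction_on' with
  | monomial s a =>
    have : MvPolynomial.monomial s a = a • MvPolynomial.monomial s (1 : ℂ) := by
      rw [MvPolynomial.smul_monomial, smul_eq_mul, mul_one]
    rw [this, MvPolynomial.coe_smul, map_smul, virasoroL_apply, virasoro_coe_monomial,
      Derivation.map_smul, mul_smul_comm, ← smul_add, MvPolynomial.coe_smul]
  | add p q hp hq =>
    rw [MvPolynomial.coe_add, map_add, hp, hq, ← MvPolynomial.coe_add, map_add]
    congr 1
    ring

/-- The two sums on the left together run over all `Y_P Y_Q` with `P + Q = a + b + 2`, with weight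
`P - a - 1`. Averaging with the reflection `P ↔ Q` replaces the weight by half of `b - a`. -/
lemma sum_antidiagonal_witt {K : Type*} [CommRing K] (Y : ℕ → K) (a b : ℕ) :
    2 * (∑ p ∈ Finset.HasAntidiagonal.antidiagonal b, ((p.1 : K) + 1) * (Y (p.1 + a + 2) * Y p.2)) -
      2 * (∑ p ∈ Finset.HasAntidiagonal.antidiagonal a, ((p.1 : K) + 1) *
        (Y (p.1 + b + 2) * Y p.2)) =
    ((b : K) - a) * ∑ p ∈ Finset.HasAntidiagonal.antidiagonal (a + b + 2), Y p.1 * Y p.2 := by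
  set T : ℕ → K := fun P => Y P * Y (a + b + 2 - P) with hT
  have h1 : ∑ P ∈ Finset.range ((a + 2) + (b + 1)), ((P : K) - a - 1) * T P =
      (∑ p ∈ Finset.HasAntidiagonal.antidiagonal b, ((p.1 : K) + 1) * (Y (p.1 + a + 2) * Y p.2)) -
      (∑ p ∈ Finset.HasAntidiagonal.antidiagonal a,
        ((p.1 : K) + 1) * (Y (p.1 + b + 2) * Y p.2)) := by
    rw [Finset.sum_range_add, Finset.Nat.sum_antidiagonal_eq_sum_range_succ_mk,
      Finset.Nat.sum_antidiagonal_eq_sum_range_succ_mk, ← Finset.sum_range_reflect,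
      Finset.sum_range_succ', add_comm, sub_eq_add_neg (∑ _ ∈ _, _) (∑ _ ∈ _, _),
      ← Finset.sum_neg_distrib]
    congr 1
    · apply Finset.sum_congr rfl
      intro p hp
      rw [Finset.mem_range] at hp
      simp only [hT]
      rw [show a + 2 + p = p + a + 2 by omega, show a + b + 2 - (p + a + 2) = b - p by omega]
      push_cast
      ring
    -- The index `P = a + 1` belongs to neither sum; its weight is zero.
    · have h0 : (((a + 2 - 1 - 0 : ℕ) : K) - a - 1) = 0 := by
        rw [show a + 2 - 1 - 0 = a + 1 by omega]
        push_cast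
        ring
      rw [h0, zero_mul, add_zero]
      apply Finset.sum_congr rfl
      intro p hp
      rw [Finset.mem_range] at hp
      simp only [hT]
      rw [show a + 2 - 1 - (p + 1) = a - p by omega,
        show a + b + 2 - (a - p) = p + b + 2 by omega, Nat.cast_sub (by omega)]
      ring
  have h2 : ∑ P ∈ Finset.range ((a + 2) + (b + 1)), ((P : K) - a - 1) * T P =
      ∑ P ∈ Finset.range ((a + 2) + (b + 1)), ((b : K) + 1 - P) * T P := by
    rw [← Finset.sum_range_reflect]
    apply Finset.sum_congr rfl
    intro P hP
    rw [Finset.mem_range] at hP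
    simp only [hT]
    rw [show a + 2 + (b + 1) - 1 - P = a + b + 2 - P by omega,
      show a + b + 2 - (a + b + 2 - P) = P by omega, Nat.cast_sub (by omega)]
    push_cast
    ring
  rw [← mul_sub, ← h1, two_mul]
  conv_lhs => rw [h2]
  rw [← h2]
  -- Only one of the two equal copies is reflected, so that the weights `P - a - 1` and `b + 1 - P`
  -- add up to `b - a`.
  nth_rewrite 1 [h2]
  rw [← Finset.sum_add_distrib, Finset.Nat.sum_antidiagonal_eq_sum_range_succ_mk, Finset.mul_sum]
  rw [show a + 2 + (b + 1) = (a + b + 2).succ by omega]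
  apply Finset.sum_congr rfl
  intro P _
  ring

lemma wittDerivation_X (a n : ℕ) :
    wittDerivation a (MvPolynomial.X n.succPNat) =
      ((n : MvPolynomial ℕ+ ℂ) + 1) * MvPolynomial.X (n + a + 2).succPNat := by
  rw [wittDerivation, MvPolynomial.mkDerivation_X, Nat.succPNat_coe,
    show n.succ + a + 1 = n + a + 2 by omega]
  push_cast
  rfl

lemma wittDerivation_creationPart (β α₀ : ℂ) (a b : ℕ) :
    wittDerivation a (creationPart β α₀ b) = (1 / 2 : ℂ) •
      (∑ p ∈ Finset.HasAntidiagonal.antidiagonal b, ((p.1 : MvPolynomial ℕ+ ℂ) + 1) *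
        (MvPolynomial.X (p.1 + a + 2).succPNat * MvPolynomial.X p.2.succPNat)) +
      ((β + α₀ * (b + 1)) * (b + 2)) • MvPolynomial.X (a + b + 3).succPNat := by
  rw [creationPart, map_add, Derivation.map_smul, Derivation.map_smul, map_sum, wittDerivation_X]
  simp only [Derivation.leibniz, wittDerivation_X, smul_eq_mul]
  rw [Finset.sum_add_distrib, ← Finset.Nat.sum_antidiagonal_swap]
  simp only [Prod.fst_swap, Prod.snd_swap]
  rw [mul_smul, show b + 1 + a + 2 = a + b + 3 by omega]
  congr 1
  · rw [← Finset.sum_add_distrib, Finset.smul_sum, Finset.smul_sum]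
    apply Finset.sum_congr rfl
    intro p _
    rw [show (1 / 2 : ℂ) = (1 / 4) * 2 by norm_num, mul_smul]
    congr 1
    rw [ofNat_smul_eq_nsmul, nsmul_eq_mul]
    push_cast
    ring
  · congr 1
    have : ((b : ℂ) + 2) • (MvPolynomial.X (a + b + 3).succPNat : MvPolynomial ℕ+ ℂ) =
        MvPolynomial.C ((b : ℂ) + 2) * MvPolynomial.X (a + b + 3).succPNat :=
      MvPolynomial.smul_eq_C_mul _ _
    rw [this, map_add, map_natCast, map_ofNat]
    push_cast
    ring

lemma wittDerivation_comm (a b : ℕ) (p : MvPolynomial ℕ+ ℂ) :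
    wittDerivation a (wittDerivation b p) - wittDerivation b (wittDerivation a p) =
      ((b : ℂ) - a) • wittDerivation (a + b + 2) p := by
  rw [← Derivation.commutator_apply, ← Derivation.smul_apply]
  congr 1
  apply MvPolynomial.derivation_ext
  intro n
  obtain ⟨l, rfl⟩ : ∃ l : ℕ, n = l.succPNat := ⟨n.natPred, by simp⟩
  rw [Derivation.commutator_apply, Derivation.smul_apply, wittDerivation_X, wittDerivation_X,
    wittDerivation_X, Derivation.leibniz, Derivation.leibniz, map_add, map_add,
    Derivation.map_natCast, Derivation.map_natCast, Derivation.map_one_eq_zero,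
    Derivation.map_one_eq_zero, wittDerivation_X, wittDerivation_X, MvPolynomial.smul_eq_C_mul,
    map_sub, map_natCast, map_natCast]
  rw [show l + b + 2 + a + 2 = l + (a + b + 2) + 2 by omega,
    show l + a + 2 + b + 2 = l + (a + b + 2) + 2 by omega]
  simp only [smul_eq_mul]
  push_cast
  ring

/-- On polynomials each generator is a multiplication `c_a` plus a derivation `D_a`. The commutator
is therefore multiplication by `D_a c_b - D_b c_a` plus `[D_a, D_b]`, and each of these closes
separately. -/
lemma virasoro_comm_coe (β α₀ : ℂ) (a b : ℕ) (p : MvPolynomial ℕ+ ℂ) :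
    virasoro β α₀ (-2 - (a : ℤ)) (virasoro β α₀ (-2 - (b : ℤ)) (p : Fock ℂ)) -
      virasoro β α₀ (-2 - (b : ℤ)) (virasoro β α₀ (-2 - (a : ℤ)) (p : Fock ℂ)) =
      ((b : ℂ) - a) • virasoro β α₀ (-2 - ((a + b + 2 : ℕ) : ℤ)) (p : Fock ℂ) := by
  rw [virasoro_coe, virasoro_coe, virasoro_coe, virasoro_coe, virasoro_coe, ← MvPolynomial.coe_smul,
    sub_eq_iff_eq_add, ← MvPolynomial.coe_add]
  congr 1
  have h1 : wittDerivation a (creationPart β α₀ b) - wittDerivation b (creationPart β α₀ a) =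
      ((b : ℂ) - a) • creationPart β α₀ (a + b + 2) := by
    have h := sum_antidiagonal_witt
      (fun n => (MvPolynomial.X n.succPNat : MvPolynomial ℕ+ ℂ)) a b
    have h' : (1 / 4 : ℂ) • (2 * (∑ p ∈ Finset.HasAntidiagonal.antidiagonal b,
        ((p.1 : MvPolynomial ℕ+ ℂ) + 1) *
        (MvPolynomial.X (p.1 + a + 2).succPNat * MvPolynomial.X p.2.succPNat)) -
      2 * (∑ p ∈ Finset.HasAntidiagonal.antidiagonal a, ((p.1 : MvPolynomial ℕ+ ℂ) + 1) *
        (MvPolynomial.X (p.1 + b + 2).succPNat * MvPolynomial.X p.2.succPNat))) =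
      (1 / 4 : ℂ) • (((b : ℂ) - a) • ∑ p ∈ Finset.HasAntidiagonal.antidiagonal (a + b + 2),
        MvPolynomial.X p.1.succPNat * MvPolynomial.X p.2.succPNat) := by
      rw [h, MvPolynomial.smul_eq_C_mul _ ((b : ℂ) - a), map_sub, map_natCast, map_natCast]
    rw [wittDerivation_creationPart, wittDerivation_creationPart, creationPart,
      show b + a + 3 = a + b + 2 + 1 by omega, show a + b + 3 = a + b + 2 + 1 by omega, smul_add,
      smul_comm _ (1 / 4 : ℂ), ← h', two_mul, two_mul]
    push_cast
    module
  have h2 := wittDerivation_comm a b p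
  have h3 : ((b : ℂ) - a) • (creationPart β α₀ (a + b + 2) * p) =
      (wittDerivation a (creationPart β α₀ b) - wittDerivation b (creationPart β α₀ a)) * p := by
    rw [h1, smul_mul_assoc]
  rw [smul_add, h3, ← h2]
  simp only [map_add, Derivation.leibniz, smul_eq_mul]
  ring

/-- The commutation relations of the negative half of the Virasoro algebra. -/
theorem virasoro_comm {R : Type*} [CommRing R] [Algebra ℂ R] (β α₀ : ℂ) (a b : ℕ) (u : Fock R) :
    virasoro β α₀ (-2 - (a : ℤ)) (virasoro β α₀ (-2 - (b : ℤ)) u) -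
      virasoro β α₀ (-2 - (b : ℤ)) (virasoro β α₀ (-2 - (a : ℤ)) u) =
      ((b : ℂ) - a) • virasoro β α₀ (-2 - ((a + b + 2 : ℕ) : ℤ)) u := by
  classical
  -- The generic vector, whose coefficients form a basis of the polynomial ring: every `u` is its
  -- image under a linear map of the coefficients.
  set u0 : Fock (MvPolynomial ℕ+ ℂ) := fun ν => MvPolynomial.monomial ν 1 with hu0
  set T : MvPolynomial ℕ+ ℂ →ₗ[ℂ] R := (MvPolynomial.basisMonomials ℕ+ ℂ).constr ℂ
    (fun ν => MvPowerSeries.coeff ν u) with hT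
  have hTu : u = mapLin T u0 := by
    ext ν
    rw [coeff_mapLin]
    have := (MvPolynomial.basisMonomials ℕ+ ℂ).constr_basis ℂ (fun ν => MvPowerSeries.coeff ν u) ν
    rw [MvPolynomial.coe_basisMonomials] at this
    exact this.symm
  have key : virasoro β α₀ (-2 - (a : ℤ)) (virasoro β α₀ (-2 - (b : ℤ)) u0) -
      virasoro β α₀ (-2 - (b : ℤ)) (virasoro β α₀ (-2 - (a : ℤ)) u0) =
      ((b : ℂ) - a) • virasoro β α₀ (-2 - ((a + b + 2 : ℕ) : ℤ)) u0 := by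
    -- Extracting the `ν`-th coefficient is linear and sends the generic vector to a single
    -- monomial, where the relation is already known.
    ext μ ν
    have h0 : mapLin (MvPolynomial.lcoeff ℂ ν) u0 =
        ((MvPolynomial.monomial ν (1 : ℂ) : MvPolynomial ℕ+ ℂ) : Fock ℂ) := by
      ext ξ
      rw [coeff_mapLin, MvPolynomial.coeff_coe]
      change MvPolynomial.coeff ν (MvPolynomial.monomial ξ 1) = _
      rw [MvPolynomial.coeff_monomial, MvPolynomial.coeff_monomial]
      simp only [eq_comm]
    have h := congrArg (MvPowerSeries.coeff μ)
      (virasoro_comm_coe β α₀ a b (MvPolynomial.monomial ν 1))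
    simp only [← h0, virasoro_mapLin, map_sub, coeff_mapLin, coeff_smul_fock] at h
    simpa [coeff_smul_fock] using h
  rw [hTu]
  simp only [virasoro_mapLin]
  ext μ
  have h := congrArg (fun v => T (MvPowerSeries.coeff μ v)) key
  simpa only [map_sub, coeff_mapLin, coeff_smul_fock, map_smul] using h

end Commutator

/-! ### Residue calculus for the formal conformal map -/

section PowerSeriesCalculus

open PowerSeries

variable {K : Type*} [CommRing K]

lemma coeff_X_mul_derivative (n : ℕ) (G : K⟦X⟧) :
    coeff n (X * d⁄dX K G) = n * coeff n G := by
  cases n with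
  | zero => simp
  | succ n => rw [coeff_succ_X_mul, coeff_derivative]; push_cast; ring

variable [Algebra ℂ K]

lemma eq_zero_of_succ_mul {n : ℕ} {x : K} (h : ((n : K) + 1) * x = 0) : x = 0 := by
  have h2 : ((n : ℂ) + 1) • x = 0 := by
    rw [Algebra.smul_def, map_add, map_natCast, map_one, h]
  have h3 : ((n : ℂ) + 1) ≠ 0 := by exact_mod_cast Nat.succ_ne_zero n
  exact (smul_eq_zero_iff_right h3).1 h2

variable {F F1 H : K⟦X⟧}

/-- Integration by parts: `Res d(w^p f^q) = 0`. -/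
lemma coeff_deriv_mul_pow (hF1 : F1 = F - X * d⁄dX K F) (a n : ℕ) :
    ((a : K) + 1) * coeff n (F1 * F ^ a) = ((a : K) + 1 - n) * coeff n (F ^ (a + 1)) := by
  have h : ((a : K⟦X⟧) + 1) * (F1 * F ^ a) =
      ((a : K⟦X⟧) + 1) * F ^ (a + 1) - X * d⁄dX K (F ^ (a + 1)) := by
    rw [Derivation.leibniz_pow, hF1, nsmul_eq_mul, Nat.add_sub_cancel, smul_eq_mul]
    push_cast
    ring
  have hc : ∀ G : K⟦X⟧, coeff n (((a : K⟦X⟧) + 1) * G) = ((a : K) + 1) * coeff n G := by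
    intro G
    have : ((a : K⟦X⟧) + 1) = C ((a : K) + 1) := by simp
    rw [this, coeff_C_mul]
  rw [← hc, h, map_sub, hc, coeff_X_mul_derivative]
  ring

/-- In this section `X = 1/w`, `f(w) = w F`, `F1 = f'` and `X * H = 1/f`. The claim is `Res f' f^a =
0` for `a ≥ 0`, because `f' f^a` is the derivative of `f^{a+1} / (a+1)`. -/
lemma coeff_succ_deriv_mul_pow (hF1 : F1 = F - X * d⁄dX K F) (a : ℕ) :
    coeff (a + 1) (F1 * F ^ a) = 0 := by
  apply eq_zero_of_succ_mul (n := a)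
  rw [coeff_deriv_mul_pow hF1]
  push_cast
  ring

/-- The residue `Res f' f^k` in the variable `q = 1/f`. -/
lemma coeff_residue (hF1 : F1 = F - X * d⁄dX K F) (hF0 : constantCoeff F = 1)
    (hH : F * H = 1) (j d : ℕ) :
    coeff j ((X * H) ^ d * (F1 * H * F ^ j)) = if j = d then 1 else 0 := by
  rw [mul_pow, mul_assoc, coeff_X_pow_mul']
  have hH0 : constantCoeff H = 1 := by
    have := congrArg constantCoeff hH
    rwa [map_mul, hF0, one_mul, map_one] at this
  have hF10 : constantCoeff F1 = 1 := by simp [hF1, hF0]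
  split_ifs with h1 h2 h2
  · subst h2
    rw [Nat.sub_self, coeff_zero_eq_constantCoeff_apply]
    simp [hF0, hH0, hF10]
  -- For `j > d` the integrand is `f' f^m` with `m ≥ 0`, an exact differential.
  · obtain ⟨m, rfl⟩ : ∃ m, j = d + (m + 1) := ⟨j - d - 1, by omega⟩
    have : H ^ d * (F1 * H * F ^ (d + (m + 1))) = F1 * F ^ m := by
      calc H ^ d * (F1 * H * F ^ (d + (m + 1))) = (F * H) ^ (d + 1) * (F1 * F ^ m) := by ring
        _ = _ := by rw [hH, one_pow, one_mul]
    rw [this, show d + (m + 1) - d = m + 1 by omega, coeff_succ_deriv_mul_pow hF1]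
  · omega
  · rfl

/-- Lagrange inversion, to finite order: expansion of `ψ` in powers of `q = 1/f`. -/
lemma X_pow_dvd_sub_expansion (hF1 : F1 = F - X * d⁄dX K F) (hF0 : constantCoeff F = 1)
    (hH : F * H = 1) {ψ : K⟦X⟧} (hψ : X ∣ ψ) (n : ℕ) :
    X ^ (n + 1) ∣ ψ - ∑ a ∈ Finset.range n,
      C (coeff (a + 1) (ψ * (F1 * F ^ a))) * (X * H) ^ (a + 1) := by
  have hH0 : constantCoeff H = 1 := by
    have := congrArg constantCoeff hH
    rwa [map_mul, hF0, one_mul, map_one] at this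
  have hF10 : constantCoeff F1 = 1 := by simp [hF1, hF0]
  induction n with
  | zero => simpa using hψ
  | succ n ih =>
    obtain ⟨χ, hχ⟩ := ih
    -- Pairing with `f' f^n` isolates the leading coefficient of the remainder: the terms already
    -- subtracted, in `q^{a+1}` with `a < n`, pair to zero by `coeff_residue`.
    have hc : coeff (n + 1) (ψ * (F1 * F ^ n)) = constantCoeff χ := by
      have h1 : coeff (n + 1) ((∑ a ∈ Finset.range n,
          C (coeff (a + 1) (ψ * (F1 * F ^ a))) * (X * H) ^ (a + 1)) * (F1 * F ^ n)) = 0 := by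
        rw [Finset.sum_mul, map_sum, Finset.sum_eq_zero]
        intro a ha
        rw [Finset.mem_range] at ha
        have : (X * H) ^ (a + 1) * (F1 * F ^ n) =
            (X * H) ^ (a + 1) * (F1 * H * F ^ (n + 1)) := by
          rw [show F1 * H * F ^ (n + 1) = (F * H) * (F1 * F ^ n) by ring, hH, one_mul]
        rw [mul_assoc, coeff_C_mul, this, coeff_residue hF1 hF0 hH, if_neg (by omega), mul_zero]
      have h2 : coeff (n + 1) ((ψ - ∑ a ∈ Finset.range n,
          C (coeff (a + 1) (ψ * (F1 * F ^ a))) * (X * H) ^ (a + 1)) * (F1 * F ^ n)) =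
          constantCoeff χ := by
        rw [hχ, mul_assoc, coeff_X_pow_mul', if_pos le_rfl, Nat.sub_self,
          coeff_zero_eq_constantCoeff_apply]
        simp [hF0, hF10]
      rw [sub_mul, map_sub, h1, sub_zero] at h2
      exact h2
    rw [Finset.sum_range_succ, ← sub_sub, hχ, hc]
    have : X ^ (n + 1) * χ - C (constantCoeff χ) * (X * H) ^ (n + 1) =
        X ^ (n + 1) * (χ - C (constantCoeff χ) * H ^ (n + 1)) := by ring
    rw [this, pow_succ _ (n + 1)]
    apply mul_dvd_mul_left
    rw [X_dvd_iff]
    simp [hH0]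

/-- The logarithmic derivative of `q = X / F` under `X d/dX` is `1 - X F' / F = F1 * H`. -/
lemma X_mul_derivative_pow_inv (hF1 : F1 = F - X * d⁄dX K F) (hH : F * H = 1) (a : ℕ) :
    X * d⁄dX K ((X * H) ^ (a + 1)) = ((a : K⟦X⟧) + 1) * ((X * H) ^ (a + 1) * (F1 * H)) := by
  have h1 : F * d⁄dX K H + H * d⁄dX K F = 0 := by
    have := congrArg (d⁄dX K) hH
    rwa [Derivation.leibniz, smul_eq_mul, smul_eq_mul, Derivation.map_one_eq_zero] at this
  have h2 : d⁄dX K H = - (H * H * d⁄dX K F) := by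
    linear_combination H * h1 - d⁄dX K H * hH
  have hX : d⁄dX K (X : K⟦X⟧) = 1 := derivative_X
  rw [Derivation.leibniz_pow, Derivation.leibniz, h2, hX, hF1, nsmul_eq_mul,
    Nat.add_sub_cancel]
  simp only [smul_eq_mul]
  push_cast
  linear_combination (-(a + 1 : K⟦X⟧) * (X * H) ^ a * X * H) * hH

/-- The residues of `w^{-1-i} f' f^j`. -/
def residueSeries (F F1 : K⟦X⟧) (i j : ℕ) : K := coeff (j + 1) (X ^ (i + 1) * (F1 * F ^ j))

/-- The Maurer--Cartan (flatness) equation in terms of residues. -/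
lemma sum_residue_mul_residue (hF1 : F1 = F - X * d⁄dX K F) (hF0 : constantCoeff F = 1)
    (hH : F * H = 1) (i i' : ℕ) {n j : ℕ} (hj : j ≤ n) :
    ∑ a ∈ Finset.range n, ∑ b ∈ Finset.range n, (if a + b + 2 = j then
      ((b : K) - a) * (residueSeries F F1 i a * residueSeries F F1 i' b) else 0) =
      ((i' : K) - i) * coeff j (X ^ (i + i' + 2) * F ^ j) := by
  set r := residueSeries F F1 i with hr
  set r' := residueSeries F F1 i' with hr'
  set P := ∑ a ∈ Finset.range n, C (r a) * (X * H) ^ (a + 1) with hP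
  set P' := ∑ a ∈ Finset.range n, C (r' a) * (X * H) ^ (a + 1) with hP'
  obtain ⟨E, hE⟩ : X ^ (n + 1) ∣ X ^ (i + 1) - P :=
    X_pow_dvd_sub_expansion hF1 hF0 hH (dvd_pow_self X (Nat.succ_ne_zero i)) n
  obtain ⟨E', hE'⟩ : X ^ (n + 1) ∣ X ^ (i' + 1) - P' :=
    X_pow_dvd_sub_expansion hF1 hF0 hH (dvd_pow_self X (Nat.succ_ne_zero i')) n
  have hθX : ∀ m : ℕ, X * d⁄dX K ((X : K⟦X⟧) ^ (m + 1)) = ((m : K⟦X⟧) + 1) * X ^ (m + 1) := by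
    intro m
    have hX : d⁄dX K (X : K⟦X⟧) = 1 := derivative_X
    rw [Derivation.leibniz_pow, hX, nsmul_eq_mul, Nat.add_sub_cancel]
    simp only [smul_eq_mul]
    push_cast
    ring
  have hθ : ∀ (m : ℕ) (Q E : K⟦X⟧), X ^ (m + 1) - Q = X ^ (n + 1) * E →
      X * d⁄dX K Q = ((m : K⟦X⟧) + 1) * X ^ (m + 1) -
        X ^ (n + 1) * (((n : K⟦X⟧) + 1) * E + X * d⁄dX K E) := by
    intro m Q E h
    have hQ : Q = X ^ (m + 1) - X ^ (n + 1) * E := by rw [← h]; ring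
    rw [hQ, map_sub, mul_sub, hθX, Derivation.leibniz]
    simp only [smul_eq_mul]
    linear_combination (-E) * hθX n
  have h1 := hθ i P E hE
  have h2 := hθ i' P' E' hE'
  -- The Wronskian is computed twice: from the expansions of `w^{-1-i}` and `w^{-1-i'}` in powers of
  -- `q = 1/f` here, and from the powers themselves in `hW2`.
  have hW : P * (X * d⁄dX K P') - P' * (X * d⁄dX K P) =
      ∑ a ∈ Finset.range n, ∑ b ∈ Finset.range n,
        C (((b : K) - a) * (r a * r' b)) * ((X * H) ^ (a + b + 2) * (F1 * H)) := by
    have hder : ∀ s : ℕ → K, X * d⁄dX K (∑ a ∈ Finset.range n, C (s a) * (X * H) ^ (a + 1)) =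
        ∑ a ∈ Finset.range n, C (s a) * (((a : K⟦X⟧) + 1) * ((X * H) ^ (a + 1) * (F1 * H))) := by
      intro s
      rw [map_sum, Finset.mul_sum]
      apply Finset.sum_congr rfl
      intro a _
      rw [Derivation.leibniz, derivative_C, ← X_mul_derivative_pow_inv hF1 hH]
      simp only [smul_eq_mul]
      ring
    rw [hP, hP', hder, hder, Finset.sum_mul_sum, Finset.sum_mul_sum]
    rw [Finset.sum_comm (s := Finset.range n) (t := Finset.range n)
      (f := fun b a => C (r' b) * (X * H) ^ (b + 1) *
        (C (r a) * (((a : K⟦X⟧) + 1) * ((X * H) ^ (a + 1) * (F1 * H)))))]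
    rw [← Finset.sum_sub_distrib]
    apply Finset.sum_congr rfl
    intro a _
    rw [← Finset.sum_sub_distrib]
    apply Finset.sum_congr rfl
    intro b _
    simp only [map_mul, map_sub, map_natCast]
    ring
  have hW2 : X ^ (n + 1) ∣ (P * (X * d⁄dX K P') - P' * (X * d⁄dX K P)) * F ^ j -
      ((i' : K⟦X⟧) - (i : K⟦X⟧)) * (X ^ (i + i' + 2) * F ^ j) := by
    have hQ : P = X ^ (i + 1) - X ^ (n + 1) * E := by rw [← hE]; ring
    have hQ' : P' = X ^ (i' + 1) - X ^ (n + 1) * E' := by rw [← hE']; ring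
    rw [h1, h2, hQ, hQ']
    refine ⟨(- X ^ (i + 1) * (((n : K⟦X⟧) + 1) * E' + X * d⁄dX K E')
      - E * (((i' : K⟦X⟧) + 1) * X ^ (i' + 1) -
        X ^ (n + 1) * (((n : K⟦X⟧) + 1) * E' + X * d⁄dX K E'))
      + X ^ (i' + 1) * (((n : K⟦X⟧) + 1) * E + X * d⁄dX K E)
      + E' * (((i : K⟦X⟧) + 1) * X ^ (i + 1) -
        X ^ (n + 1) * (((n : K⟦X⟧) + 1) * E + X * d⁄dX K E))) * F ^ j, ?_⟩
    ring
  -- As `j ≤ n`, the truncation errors, divisible by `X ^ (n + 1)`, do not reach the coefficient at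
  -- `j`.
  have hW3 := X_pow_dvd_iff.1 hW2 j (by omega)
  have hC : ((i' : K⟦X⟧) - (i : K⟦X⟧)) = C ((i' : K) - i) := by simp
  rw [map_sub, sub_eq_zero, hC, coeff_C_mul] at hW3
  rw [← hW3, hW, Finset.sum_mul, map_sum]
  apply Finset.sum_congr rfl
  intro a _
  rw [Finset.sum_mul, map_sum]
  apply Finset.sum_congr rfl
  intro b _
  rw [mul_assoc, mul_assoc, coeff_C_mul, coeff_residue hF1 hF0 hH]
  simp only [eq_comm (a := j), mul_ite, mul_one, mul_zero]

/-- A derivation applied to all coefficients of a power series. -/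
def coeffDerivation {k : Type*} [CommRing k] [Algebra k K] (D : Derivation k K K) :
    Derivation k K⟦X⟧ K⟦X⟧ :=
  Derivation.mk'
    { toFun := fun f => PowerSeries.mk fun n => D (coeff n f)
      map_add' := fun f g => by ext n; simp
      map_smul' := fun c f => by
        ext n
        simp only [coeff_mk, RingHom.id_apply]
        have h1 : ∀ g : K⟦X⟧, coeff n (c • g) = c • coeff n g := fun _ => rfl
        rw [h1, h1, D.map_smul, coeff_mk] }
    (fun f g => by
      ext n
      change coeff n (PowerSeries.mk fun n => D (coeff n (f * g))) =
        coeff n (f • (PowerSeries.mk fun n => D (coeff n g)) +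
          g • (PowerSeries.mk fun n => D (coeff n f)))
      simp only [coeff_mk, smul_eq_mul, map_add, coeff_mul, map_sum, Derivation.leibniz,
        Finset.sum_add_distrib]
      congr 1
      rw [← Finset.Nat.sum_antidiagonal_swap]
      rfl)

lemma coeff_coeffDerivation {k : Type*} [CommRing k] [Algebra k K] (D : Derivation k K K)
    (f : K⟦X⟧) (n : ℕ) : coeff n (coeffDerivation D f) = D (coeff n f) := by
  change coeff n (PowerSeries.mk fun n => D (coeff n f)) = _
  rw [coeff_mk]

/-- The derivative of a residue in a coefficient of `f`. -/
lemma derivation_residueSeries {k : Type*} [CommRing k] [Algebra k K] (D : Derivation k K K)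
    (hF1 : F1 = F - X * d⁄dX K F) {i : ℕ} (hDF : coeffDerivation D F = X ^ (i + 2))
    (hDF1 : coeffDerivation D F1 = -((i : K⟦X⟧) + 1) * X ^ (i + 2)) (i' j : ℕ) :
    D (residueSeries F F1 i' j) = ((i' : K) + 1) * coeff j (X ^ (i + i' + 2) * F ^ j) := by
  have hX : coeffDerivation D (X : K⟦X⟧) = 0 := by
    ext n
    rw [coeff_coeffDerivation, coeff_X]
    split_ifs <;> simp
  rw [residueSeries, ← coeff_coeffDerivation, Derivation.leibniz, Derivation.leibniz_pow, hX,
    Derivation.leibniz, Derivation.leibniz_pow, hDF, hDF1]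
  simp only [smul_eq_mul, nsmul_eq_mul, mul_zero, add_zero]
  -- For `j = 0` both sides vanish by order in `X`. For `j = a + 1` the derivative is `X^{i+i'+3}`
  -- times `(a+1) F1 F^a - (i+1) F^{a+1}`, and integration by parts expresses its coefficient
  -- through `F^{a+1}` alone.
  cases j with
  | zero =>
    have : X ^ (i' + 1) * (F1 * (((0 : ℕ) : K⟦X⟧) * (F ^ (0 - 1) * X ^ (i + 2))) +
        F ^ 0 * (-((i : K⟦X⟧) + 1) * X ^ (i + 2))) =
        X ^ (i + i' + 3) * (-((i : K⟦X⟧) + 1)) := by push_cast; ring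
    rw [this, coeff_X_pow_mul', coeff_X_pow_mul', if_neg (by omega), if_neg (by omega), mul_zero]
  | succ a =>
    have hC : ((a : K⟦X⟧) + 1) = C ((a : K) + 1) := by simp
    have hC' : ((i : K⟦X⟧) + 1) = C ((i : K) + 1) := by simp
    have : X ^ (i' + 1) * (F1 * (((a + 1 : ℕ) : K⟦X⟧) * (F ^ (a + 1 - 1) * X ^ (i + 2))) +
        F ^ (a + 1) * (-((i : K⟦X⟧) + 1) * X ^ (i + 2))) =
        X ^ (i + i' + 3) * (((a : K⟦X⟧) + 1) * (F1 * F ^ a) -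
          ((i : K⟦X⟧) + 1) * F ^ (a + 1)) := by
      rw [Nat.add_sub_cancel]
      push_cast
      ring
    rw [this, coeff_X_pow_mul', coeff_X_pow_mul']
    by_cases h : i + i' + 2 ≤ a + 1
    · rw [if_pos (by omega), if_pos h, map_sub, hC, hC', coeff_C_mul, coeff_C_mul,
        coeff_deriv_mul_pow hF1]
      obtain ⟨m, hm⟩ : ∃ m, a + 1 = m + (i + i' + 2) := ⟨a + 1 - (i + i' + 2), by omega⟩
      rw [show a + 1 + 1 - (i + i' + 3) = m by omega, show a + 1 - (i + i' + 2) = m by omega]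
      have hcast : (a : K) + 1 = m + (i + i' + 2) := by
        exact_mod_cast congrArg (Nat.cast (R := K)) hm
      rw [hcast]
      ring
    · rw [if_neg (by omega), if_neg h, mul_zero]

/-- As `X * P = 1 / (f - x)`, the sum is `Res f' f^j / (f - x)`. Dividing `f^j - x^j` by `f - x`
leaves a polynomial in `f`, whose product with `f'` has no residue; what remains is `x^j Res f' / (f
- x) = x^j`. -/
lemma sum_inverse_mul_residue (hF1 : F1 = F - X * d⁄dX K F) (hF0 : constantCoeff F = 1)
    {x : K} {P : K⟦X⟧} (hP : (F - C x * X) * P = 1) {j n : ℕ} (hn : j < n) :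
    ∑ i ∈ Finset.range n, coeff i P * residueSeries F F1 i j = x ^ j := by
  have h1 : ∑ i ∈ Finset.range n, coeff i P * residueSeries F F1 i j =
      coeff j (P * (F1 * F ^ j)) := by
    rw [coeff_mul, Finset.Nat.sum_antidiagonal_eq_sum_range_succ_mk]
    rw [← Finset.sum_subset (Finset.range_subset_range.2 (Nat.succ_le_of_lt hn))]
    · apply Finset.sum_congr rfl
      intro i hi
      rw [Finset.mem_range] at hi
      rw [residueSeries, coeff_X_pow_mul', if_pos (by omega),
        show j + 1 - (i + 1) = j - i by omega]
    · intro i _ hi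
      rw [Finset.mem_range] at hi
      rw [residueSeries, coeff_X_pow_mul', if_neg (by omega), mul_zero]
  have hP0 : constantCoeff P = 1 := by
    have := congrArg constantCoeff hP
    simpa [hF0] using this
  have hF10 : constantCoeff F1 = 1 := by simp [hF1, hF0]
  have h2 : P * (F1 * F ^ j) = F1 * (∑ a ∈ Finset.range j, F ^ a * (C x * X) ^ (j - 1 - a)) +
      X ^ j * (C (x ^ j) * (P * F1)) := by
    have h3 := Commute.geom_sum₂_mul (Commute.all F (C x * X)) j
    have h4 : F ^ j = (∑ a ∈ Finset.range j, F ^ a * (C x * X) ^ (j - 1 - a)) * (F - C x * X) +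
        (C x * X) ^ j := by rw [h3]; ring
    rw [h4, map_pow]
    linear_combination (F1 * ∑ a ∈ Finset.range j, F ^ a * (C x * X) ^ (j - 1 - a)) * hP
  have hPF : constantCoeff (P * F1) = 1 := by simp [hP0, hF10]
  rw [h1, h2, map_add, coeff_X_pow_mul', if_pos le_rfl, Nat.sub_self, coeff_C_mul,
    coeff_zero_eq_constantCoeff_apply, hPF, Finset.mul_sum, map_sum, Finset.sum_eq_zero]
  · ring
  · intro a ha
    rw [Finset.mem_range] at ha
    have : F1 * (F ^ a * (C x * X) ^ (j - 1 - a)) =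
        X ^ (j - 1 - a) * (C (x ^ (j - 1 - a)) * (F1 * F ^ a)) := by rw [map_pow]; ring
    rw [this, coeff_X_pow_mul', if_pos (by omega), coeff_C_mul,
      show j - (j - 1 - a) = a + 1 by omega, coeff_succ_deriv_mul_pow hF1, mul_zero]

/-- Euler's identity for the residues. -/
lemma residueSeries_euler (hF1 : F1 = F - X * d⁄dX K F) (f : ℕ → K)
    (hFm : coeff 1 F = 0) (hF : ∀ n, coeff (n + 2) F = f n) (i : ℕ) {j n : ℕ} (hn : j ≤ n) :
    ∑ m ∈ Finset.range n, ((m : K) + 2) * f m *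
      (((i : K) + 1) * coeff j (X ^ (m + i + 2) * F ^ j)) =
      ((j : K) - i) * residueSeries F F1 i j := by
  -- `F - F1 = X F'`, and the Euler operator multiplies the coefficient `f_m` of `X^{m+2}` by `m +
  -- 2`.
  have h1 : X ^ (n + 2) ∣ (F - F1) -
      ∑ m ∈ Finset.range n, C (((m : K) + 2) * f m) * X ^ (m + 2) := by
    rw [X_pow_dvd_iff]
    intro k hk
    rw [map_sub, hF1, sub_sub_cancel, coeff_X_mul_derivative, map_sum, sub_eq_zero]
    simp only [coeff_C_mul, coeff_X_pow]
    rcases k with _ | _ | k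
    · rw [Finset.sum_eq_zero]
      · simp
      · intro m _; rw [if_neg (by omega), mul_zero]
    · rw [zero_add, hFm, mul_zero, Finset.sum_eq_zero]
      intro m _; rw [if_neg (by omega), mul_zero]
    · rw [Finset.sum_eq_single k]
      · rw [if_pos rfl, hF]; push_cast; ring
      · intro m _ hm; rw [if_neg (by omega), mul_zero]
      · intro h; rw [Finset.mem_range] at h; omega
  have h2 : coeff j (X ^ i * ((F - F1) * F ^ j)) = ∑ m ∈ Finset.range n,
      ((m : K) + 2) * f m * coeff j (X ^ (m + i + 2) * F ^ j) := by
    have h3 : X ^ (n + 2) ∣ X ^ i * ((F - F1) * F ^ j) - X ^ i *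
        ((∑ m ∈ Finset.range n, C (((m : K) + 2) * f m) * X ^ (m + 2)) * F ^ j) := by
      rw [← mul_sub, ← sub_mul]
      exact Dvd.dvd.mul_left (Dvd.dvd.mul_right h1 _) _
    have h4 := X_pow_dvd_iff.1 h3 j (by omega)
    rw [map_sub, sub_eq_zero] at h4
    rw [h4, Finset.sum_mul, Finset.mul_sum, map_sum]
    apply Finset.sum_congr rfl
    intro m _
    rw [← coeff_C_mul]
    congr 1
    ring
  have h5 : ∑ m ∈ Finset.range n, ((m : K) + 2) * f m *
      (((i : K) + 1) * coeff j (X ^ (m + i + 2) * F ^ j)) =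
      ((i : K) + 1) * coeff j (X ^ i * ((F - F1) * F ^ j)) := by
    rw [h2, Finset.mul_sum]
    apply Finset.sum_congr rfl
    intro m _
    ring
  rw [h5, residueSeries, coeff_X_pow_mul', coeff_X_pow_mul']
  by_cases h : i ≤ j
  · rw [if_pos h, if_pos (by omega), show j + 1 - (i + 1) = j - i by omega, sub_mul, map_sub,
      ← pow_succ']
    have := coeff_deriv_mul_pow hF1 j (j - i)
    rw [Nat.cast_sub h] at this
    linear_combination -this
  · rw [if_neg h, if_neg (by omega), mul_zero, mul_zero]

end PowerSeriesCalculus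

/-! ### The operator `G_f` -/

section FormalMap

variable (A : Type*) [CommRing A]

lemma constantCoeff_fSeries : PowerSeries.constantCoeff (fSeries A) = 1 := by
  rw [← PowerSeries.coeff_zero_eq_constantCoeff_apply, fSeries, PowerSeries.coeff_mk, if_pos rfl]

lemma coeff_one_fSeries : PowerSeries.coeff 1 (fSeries A) = 0 := by
  simp [fSeries]

lemma coeff_add_two_fSeries (n : ℕ) :
    PowerSeries.coeff (n + 2) (fSeries A) = MvPolynomial.X n := by
  simp [fSeries]

lemma fDerivSeries_eq : fDerivSeries A = fSeries A - PowerSeries.X *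
    PowerSeries.derivative (MvPolynomial ℕ A) (fSeries A) := by
  ext1 n
  rw [map_sub, coeff_X_mul_derivative, fDerivSeries, fSeries, PowerSeries.coeff_mk,
    PowerSeries.coeff_mk]
  rcases n with _ | _ | n
  · simp
  · simp
  · simp; ring

/-- The residue `Res_w w^{1+m} f'(w) / f(w)^{2+k}` for `m = -2-i` and `k = -2-j`, zero if
`m < k`. -/
def residue (i j : ℕ) : MvPolynomial ℕ A := residueSeries (fSeries A) (fDerivSeries A) i j

lemma residue_of_le {i j : ℕ} (h : i ≤ j) : residue A i j = residueG A i j := by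
  rw [residue, residueSeries, residueG, PowerSeries.coeff_X_pow_mul', if_pos (by omega),
    show j + 1 - (i + 1) = j - i by omega]

lemma residue_of_lt {i j : ℕ} (h : j < i) : residue A i j = 0 := by
  rw [residue, residueSeries, PowerSeries.coeff_X_pow_mul', if_neg (by omega)]

/-- The coefficient `∑_m (-m) f_m Res_w w^{1+m} f'(w) / f(w)^{2+k}` for `k = -2-j`. -/
def eulerCoeff (j : ℕ) : MvPolynomial ℕ A :=
  ∑ i ∈ Finset.range (j + 1), ((i : MvPolynomial ℕ A) + 2) * MvPolynomial.X i * residueG A i j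

lemma eulerCoeff_eq {j D : ℕ} (h : j < D) : eulerCoeff A j =
    ∑ i ∈ Finset.range D, ((i : MvPolynomial ℕ A) + 2) * MvPolynomial.X i * residue A i j := by
  rw [eulerCoeff, ← Finset.sum_subset (Finset.range_subset_range.2 (Nat.succ_le_of_lt h))]
  · apply Finset.sum_congr rfl
    intro i hi
    rw [Finset.mem_range] at hi
    rw [residue_of_le A (by omega)]
  · intro i _ hi
    rw [Finset.mem_range] at hi
    rw [residue_of_lt A (by omega), mul_zero]

lemma fSeries_mul_inv :
    fSeries A * PowerSeries.invOfUnit (fSeries A) 1 = 1 :=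
  PowerSeries.mul_invOfUnit _ _ (by rw [constantCoeff_fSeries]; rfl)

variable [Algebra ℂ A]

lemma coeffDerivation_fSeries (i : ℕ) :
    coeffDerivation (MvPolynomial.pderiv (R := A) i) (fSeries A) = PowerSeries.X ^ (i + 2) := by
  ext1 n
  rw [coeff_coeffDerivation, PowerSeries.coeff_X_pow]
  rcases n with _ | _ | n
  · rw [PowerSeries.coeff_zero_eq_constantCoeff_apply, constantCoeff_fSeries, if_neg (by omega),
      Derivation.map_one_eq_zero]
  · rw [zero_add, coeff_one_fSeries, if_neg (by omega), map_zero]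
  · rw [coeff_add_two_fSeries, MvPolynomial.pderiv_X]
    by_cases h : n = i
    · subst h; simp
    · rw [if_neg (by omega), Pi.single_eq_of_ne h]

lemma coeffDerivation_fDerivSeries (i : ℕ) :
    coeffDerivation (MvPolynomial.pderiv (R := A) i) (fDerivSeries A) =
      -((i : PowerSeries (MvPolynomial ℕ A)) + 1) * PowerSeries.X ^ (i + 2) := by
  have hC : -((i : PowerSeries (MvPolynomial ℕ A)) + 1) =
      PowerSeries.C (-((i : MvPolynomial ℕ A) + 1)) := by simp
  ext1 n
  rw [coeff_coeffDerivation, hC, PowerSeries.coeff_C_mul, PowerSeries.coeff_X_pow, fDerivSeries,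
    PowerSeries.coeff_mk]
  rcases n with _ | _ | n
  · simp
  · simp
  · rw [if_neg (by omega), if_neg (by omega), show n + 1 + 1 - 2 = n by omega, Derivation.leibniz,
      map_sub, Derivation.map_one_eq_zero, Derivation.map_natCast, MvPolynomial.pderiv_X]
    by_cases h : n = i
    · subst h; simp
    · rw [if_neg (by omega), Pi.single_eq_of_ne h]; simp

lemma pderiv_residue (i i' j : ℕ) : MvPolynomial.pderiv i (residue A i' j) =
    ((i' : MvPolynomial ℕ A) + 1) *
      PowerSeries.coeff j (PowerSeries.X ^ (i + i' + 2) * fSeries A ^ j) :=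
  derivation_residueSeries _ (fDerivSeries_eq A) (coeffDerivation_fSeries A i)
    (coeffDerivation_fDerivSeries A i) i' j

/-- Flatness exchanges `∂_i r_{mj}` for `∂_m r_{ij}` up to a quadratic term. Contracting with the
Euler field then uses that `r_{ij}` is homogeneous of degree `j - i`; together with the `i + 2` from
differentiating `f_i` itself this yields `j + 2`. -/
lemma pderiv_eulerCoeff (i : ℕ) {j D : ℕ} (hj : j < D) :
    MvPolynomial.pderiv i (eulerCoeff A j) = ((j : MvPolynomial ℕ A) + 2) * residue A i j +
      ∑ a ∈ Finset.range D, ∑ b ∈ Finset.range D, (if a + b + 2 = j then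
        ((b : MvPolynomial ℕ A) - a) * (residue A i a * eulerCoeff A b) else 0) := by
  have h1 : MvPolynomial.pderiv i (eulerCoeff A j) = ((i : MvPolynomial ℕ A) + 2) * residue A i j +
      ∑ m ∈ Finset.range D, ((m : MvPolynomial ℕ A) + 2) * MvPolynomial.X m *
        MvPolynomial.pderiv i (residue A m j) := by
    rw [eulerCoeff_eq A hj, map_sum]
    have : ∀ m : ℕ, MvPolynomial.pderiv i
        (((m : MvPolynomial ℕ A) + 2) * MvPolynomial.X m * residue A m j) =
        (if m = i then ((i : MvPolynomial ℕ A) + 2) * residue A i j else 0) +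
        ((m : MvPolynomial ℕ A) + 2) * MvPolynomial.X m *
          MvPolynomial.pderiv i (residue A m j) := by
      intro m
      have h2 : MvPolynomial.pderiv i ((m : MvPolynomial ℕ A) + 2) = 0 := by
        rw [map_add, Derivation.map_natCast, zero_add]
        exact Derivation.map_natCast _ 2
      rw [Derivation.leibniz, Derivation.leibniz, h2, MvPolynomial.pderiv_X]
      by_cases h : m = i
      · subst h; simp; ring
      · rw [if_neg h, Pi.single_eq_of_ne h]; simp
    simp only [this, Finset.sum_add_distrib]
    congr 1
    rw [Finset.sum_ite_eq']
    split_ifs with h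
    · rfl
    · rw [Finset.mem_range] at h
      rw [residue_of_lt A (by omega), mul_zero]
  have h2 := residueSeries_euler (fDerivSeries_eq A) (fun n => MvPolynomial.X n)
    (coeff_one_fSeries A) (coeff_add_two_fSeries A) i hj.le
  -- The first term is `∂_m r_{ij}` in the form given by `pderiv_residue`; the factors `m + 1` and
  -- `i + 1` differ by the `m - i` of the Maurer-Cartan equation.
  have h3 : ∀ m, MvPolynomial.pderiv i (residue A m j) = ((i : MvPolynomial ℕ A) + 1) *
      PowerSeries.coeff j (PowerSeries.X ^ (m + i + 2) * fSeries A ^ j) +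
      ∑ a ∈ Finset.range D, ∑ b ∈ Finset.range D, (if a + b + 2 = j then
      ((b : MvPolynomial ℕ A) - a) * (residue A i a * residue A m b) else 0) := by
    intro m
    have := sum_residue_mul_residue (fDerivSeries_eq A) (constantCoeff_fSeries A)
      (fSeries_mul_inv A) i m hj.le
    simp only [residue]
    rw [this, ← residue, pderiv_residue, show m + i + 2 = i + m + 2 by omega]
    ring
  rw [h1]
  simp only [h3, mul_add, Finset.sum_add_distrib]
  rw [h2, ← residue, ← add_assoc]
  refine congrArg₂ (· + ·) (by ring) ?_
  · simp only [Finset.mul_sum]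
    rw [Finset.sum_comm]
    apply Finset.sum_congr rfl
    intro a _
    rw [Finset.sum_comm]
    apply Finset.sum_congr rfl
    intro b hb
    rw [Finset.mem_range] at hb
    split_ifs with h
    · rw [eulerCoeff_eq A hb, Finset.mul_sum, Finset.mul_sum]
      apply Finset.sum_congr rfl
      intro m _
      ring
    · simp

/-- This is what converts the Loewner vector field into the operator `∑_j x^j L_{-2-j}`. -/
lemma sum_pPoly_mul_residue (x : A) {j n : ℕ} (hn : j < n) :
    ∑ i ∈ Finset.range n, pPoly x i * residue A i j = MvPolynomial.C (x ^ j) := by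
  rw [map_pow]
  apply sum_inverse_mul_residue (fDerivSeries_eq A) (constantCoeff_fSeries A) _ hn
  exact PowerSeries.mul_invOfUnit _ _ (by simp [constantCoeff_fSeries])

end FormalMap

/-! ### The differential equations for the homogeneous parts of `G_f` -/

section ConformalOperator

variable {A : Type*} [CommRing A] [Algebra ℂ A]

lemma Gpart_zero (β α₀ : ℂ) (u : Fock A) :
    Gpart β α₀ 0 u = MvPowerSeries.map MvPolynomial.C u := by
  rw [Gpart]

lemma Gpart_succ (β α₀ : ℂ) (d : ℕ) (u : Fock A) :
    Gpart β α₀ (d + 1) u = (-1 / ((d : ℂ) + 1)) • ∑ j ∈ Finset.range d,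
      eulerCoeff A j • Gpart β α₀ (d - 1 - j) (virasoro β α₀ (-2 - (j : ℤ)) u) := by
  rw [Gpart, Finset.sum_range]
  rfl

/-- A component of the part of `G_f` of degree `z`, where `z` may be negative. -/
def gCoeff (β α₀ : ℂ) (μ : ℕ+ →₀ ℕ) (z : ℤ) (u : Fock A) : MvPolynomial ℕ A :=
  if 0 ≤ z then MvPowerSeries.coeff μ (Gpart β α₀ z.toNat u) else 0

lemma gCoeff_neg (β α₀ : ℂ) (μ : ℕ+ →₀ ℕ) {z : ℤ} (hz : z < 0) (u : Fock A) :
    gCoeff β α₀ μ z u = 0 := if_neg (not_le.2 hz)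

lemma gCoeff_natCast (β α₀ : ℂ) (μ : ℕ+ →₀ ℕ) (d : ℕ) (u : Fock A) :
    gCoeff β α₀ μ d u = MvPowerSeries.coeff μ (Gpart β α₀ d u) := by
  rw [gCoeff, if_pos (by omega), Int.toNat_natCast]

lemma gCoeff_zero (β α₀ : ℂ) (μ : ℕ+ →₀ ℕ) (u : Fock A) :
    gCoeff β α₀ μ 0 u = MvPolynomial.C (MvPowerSeries.coeff μ u) := by
  have := gCoeff_natCast β α₀ μ 0 u
  rw [Nat.cast_zero] at this
  rw [this, Gpart_zero, MvPowerSeries.coeff_map]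

lemma gCoeff_succ (β α₀ : ℂ) (μ : ℕ+ →₀ ℕ) (d D : ℕ) (hD : d ≤ D) (u : Fock A) :
    gCoeff β α₀ μ ((d : ℤ) + 1) u = (-1 / ((d : ℂ) + 1)) • ∑ j ∈ Finset.range D,
      eulerCoeff A j * gCoeff β α₀ μ ((d : ℤ) + 1 - 2 - j) (virasoro β α₀ (-2 - (j : ℤ)) u) := by
  have h := gCoeff_natCast β α₀ μ (d + 1) u
  rw [Nat.cast_succ] at h
  rw [h, Gpart_succ, coeff_smul_fock, map_sum]
  congr 1
  rw [← Finset.sum_subset (Finset.range_subset_range.2 hD)]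
  · apply Finset.sum_congr rfl
    intro j hj
    rw [Finset.mem_range] at hj
    rw [coeff_smul_fock, smul_eq_mul, ← gCoeff_natCast]
    congr 2
    omega
  · intro j _ hj
    rw [Finset.mem_range] at hj
    rw [gCoeff_neg _ _ _ (by omega), mul_zero]

/-- Induction over the degree for the parts of `G_f`. -/
lemma gCoeff_induction {P : ℤ → Prop} (hneg : ∀ z < 0, P z) (h0 : P 0)
    (hsucc : ∀ d : ℕ, (∀ j : ℕ, P ((d : ℤ) + 1 - 2 - j)) → P ((d : ℤ) + 1)) (z : ℤ) : P z := by
  have key : ∀ n : ℕ, ∀ z : ℤ, z < n → P z := by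
    intro n
    induction n with
    | zero => exact fun z hz => hneg z (by simpa using hz)
    | succ n ih =>
      intro z hz
      rcases lt_trichotomy z 0 with h | h | h
      · exact hneg z h
      · exact h ▸ h0
      · obtain ⟨d, rfl⟩ : ∃ d : ℕ, z = (d : ℤ) + 1 := ⟨(z - 1).toNat, by omega⟩
        exact hsucc d fun j => ih _ (by push_cast at hz; omega)
  exact key (z.toNat + 1) z (by omega)

lemma gCoeff_add (β α₀ : ℂ) (μ : ℕ+ →₀ ℕ) (z : ℤ) (u v : Fock A) :
    gCoeff β α₀ μ z (u + v) = gCoeff β α₀ μ z u + gCoeff β α₀ μ z v := by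
  induction z using gCoeff_induction generalizing u v with
  | hneg z hz => simp only [gCoeff_neg _ _ _ hz, add_zero]
  | h0 => simp only [gCoeff_zero, map_add]
  | hsucc d ih =>
    simp only [gCoeff_succ _ _ _ d d le_rfl]
    rw [← smul_add, ← Finset.sum_add_distrib]
    congr 1
    apply Finset.sum_congr rfl
    intro j _
    rw [← mul_add, ← ih, ← virasoroL_apply, map_add]
    rfl

lemma gCoeff_smul (β α₀ : ℂ) (μ : ℕ+ →₀ ℕ) (z : ℤ) (c : A) (u : Fock A) :
    gCoeff β α₀ μ z (c • u) = MvPolynomial.C c * gCoeff β α₀ μ z u := by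
  induction z using gCoeff_induction generalizing u with
  | hneg z hz => simp only [gCoeff_neg _ _ _ hz, mul_zero]
  | h0 => simp only [gCoeff_zero, coeff_smul_fock, smul_eq_mul, map_mul]
  | hsucc d ih =>
    simp only [gCoeff_succ _ _ _ d d le_rfl]
    rw [mul_smul_comm, Finset.mul_sum]
    congr 1
    apply Finset.sum_congr rfl
    intro j _
    rw [← virasoroL_apply, map_smul, ih, virasoroL_apply]
    ring

lemma gCoeff_sum (β α₀ : ℂ) (μ : ℕ+ →₀ ℕ) (z : ℤ) {ι : Type*} (s : Finset ι) (u : ι → Fock A) :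
    gCoeff β α₀ μ z (∑ i ∈ s, u i) = ∑ i ∈ s, gCoeff β α₀ μ z (u i) :=
  map_sum (AddMonoidHom.mk' (gCoeff β α₀ μ z) (gCoeff_add β α₀ μ z)) u s

lemma gCoeff_csmul (β α₀ : ℂ) (μ : ℕ+ →₀ ℕ) (z : ℤ) (c : ℂ) (u : Fock A) :
    gCoeff β α₀ μ z (c • u) = c • gCoeff β α₀ μ z u := by
  have : c • u = (algebraMap ℂ A c) • u := by
    ext ν
    rw [coeff_smul_fock, coeff_smul_fock, algebraMap_smul]
  rw [this, gCoeff_smul, ← MvPolynomial.smul_eq_C_mul, algebraMap_smul]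

/-- The part of degree `z` raises the level by `z`: each `L_{-2-j}` in the recursion costs `2 + j`
in degree and gains the same in level. -/
lemma gCoeff_eq_zero (β α₀ : ℂ) {μ : ℕ+ →₀ ℕ} {n : ℕ} {u : Fock A} (hu : LevelGE n u) (z : ℤ)
    (h : (level μ : ℤ) < n + z) : gCoeff β α₀ μ z u = 0 := by
  induction z using gCoeff_induction generalizing u n with
  | hneg z hz => exact gCoeff_neg _ _ _ hz _
  | h0 => rw [gCoeff_zero, hu _ (by omega), map_zero]
  | hsucc d ih =>
    rw [gCoeff_succ _ _ _ d d le_rfl, Finset.sum_eq_zero, smul_zero]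
    intro j _
    rw [ih j (hu.virasoro β α₀ j) (by push_cast; omega), mul_zero]

/-- Euler's identity for the parts of `G_f`. -/
lemma mul_gCoeff (β α₀ : ℂ) (μ : ℕ+ →₀ ℕ) (z : ℤ) (D : ℕ) (hD : z ≤ D) (u : Fock A) :
    (z : MvPolynomial ℕ A) * gCoeff β α₀ μ z u = -∑ j ∈ Finset.range D,
      eulerCoeff A j * gCoeff β α₀ μ (z - 2 - j) (virasoro β α₀ (-2 - (j : ℤ)) u) := by
  rcases lt_or_ge 0 z with h | h
  · obtain ⟨d, rfl⟩ : ∃ d : ℕ, z = (d : ℤ) + 1 := ⟨(z - 1).toNat, by omega⟩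
    have hd : ((d : ℂ) + 1) ≠ 0 := by exact_mod_cast Nat.succ_ne_zero d
    rw [gCoeff_succ β α₀ μ d D (by omega)]
    have : (((d : ℤ) + 1 : ℤ) : MvPolynomial ℕ A) =
        algebraMap ℂ (MvPolynomial ℕ A) ((d : ℂ) + 1) := by
      rw [map_add, map_natCast, map_one]; push_cast; rfl
    rw [this, ← Algebra.smul_def, smul_smul, mul_div_cancel₀ _ hd, neg_one_smul]
  · rw [Finset.sum_eq_zero, neg_zero]
    · rcases h.lt_or_eq with h | h
      · rw [gCoeff_neg _ _ _ h, mul_zero]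
      · rw [h, Int.cast_zero, zero_mul]
    · intro j _
      rw [gCoeff_neg _ _ _ (by omega), mul_zero]

/-- Integrability of the defining system. The Euler recursion for `z G_z` is differentiated and the
induction hypothesis inserted; the commutators of the generators cancel the quadratic terms in `∂_i`
of the Euler coefficients. -/
theorem pderiv_gCoeff (β α₀ : ℂ) (μ : ℕ+ →₀ ℕ) (i D : ℕ) (z : ℤ) (hD : z ≤ D) (u : Fock A) :
    MvPolynomial.pderiv i (gCoeff β α₀ μ z u) = -∑ j ∈ Finset.range D,
      residue A i j * gCoeff β α₀ μ (z - 2 - j) (virasoro β α₀ (-2 - (j : ℤ)) u) := by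
  induction z using gCoeff_induction generalizing u with
  | hneg z hz =>
    rw [gCoeff_neg _ _ _ hz, map_zero, Finset.sum_eq_zero, neg_zero]
    intro j _
    rw [gCoeff_neg _ _ _ (by omega), mul_zero]
  | h0 =>
    rw [gCoeff_zero, MvPolynomial.pderiv_C, Finset.sum_eq_zero, neg_zero]
    intro j _
    rw [gCoeff_neg _ _ _ (by omega), mul_zero]
  | hsucc d ih =>
    set z : ℤ := (d : ℤ) + 1 with hz
    set L : ℕ → Fock A → Fock A := fun j u => virasoro β α₀ (-2 - (j : ℤ)) u with hL
    have ih' : ∀ b : ℕ, MvPolynomial.pderiv i (gCoeff β α₀ μ (z - 2 - b) (L b u)) =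
        -∑ a ∈ Finset.range D, residue A i a * gCoeff β α₀ μ (z - 4 - a - b) (L a (L b u)) := by
      intro b
      rw [ih b (by omega)]
      congr 1
      apply Finset.sum_congr rfl
      intro a _
      rw [show z - 2 - b - 2 - a = z - 4 - a - b by ring]
    -- The order is reversed so that the sum over `b`, weighted by `eulerCoeff A b`, becomes the
    -- Euler recursion applied to `L a u`.
    have hcomm : ∀ a b : ℕ, gCoeff β α₀ μ (z - 4 - a - b) (L a (L b u)) =
        gCoeff β α₀ μ (z - 4 - a - b) (L b (L a u)) + ((b : MvPolynomial ℕ A) - a) *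
          gCoeff β α₀ μ (z - 4 - a - b) (L (a + b + 2) u) := by
      intro a b
      have h := virasoro_comm β α₀ a b u
      rw [sub_eq_iff_eq_add] at h
      simp only [hL]
      rw [h, gCoeff_add, gCoeff_csmul, add_comm, Algebra.smul_def, map_sub, map_natCast,
        map_natCast]
    have heuler : ∀ a : ℕ, ∑ b ∈ Finset.range D, eulerCoeff A b *
        gCoeff β α₀ μ (z - 4 - a - b) (L b (L a u)) =
        -((z : MvPolynomial ℕ A) - 2 - a) * gCoeff β α₀ μ (z - 2 - a) (L a u) := by
      intro a
      have h := mul_gCoeff β α₀ μ (z - 2 - a) D (by omega) (L a u)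
      rw [neg_mul]
      push_cast at h
      rw [h, neg_neg]
      apply Finset.sum_congr rfl
      intro b _
      rw [show z - 2 - a - 2 - b = z - 4 - a - b by ring]
    have hE : ∑ j ∈ Finset.range D, (∑ a ∈ Finset.range D, ∑ b ∈ Finset.range D,
        (if a + b + 2 = j then ((b : MvPolynomial ℕ A) - a) * (residue A i a * eulerCoeff A b)
          else 0)) * gCoeff β α₀ μ (z - 2 - j) (L j u) =
        ∑ a ∈ Finset.range D, ∑ b ∈ Finset.range D, ((b : MvPolynomial ℕ A) - a) *
          (residue A i a * eulerCoeff A b) * gCoeff β α₀ μ (z - 4 - a - b) (L (a + b + 2) u) := by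
      simp only [Finset.sum_mul]
      rw [Finset.sum_comm]
      apply Finset.sum_congr rfl
      intro a _
      rw [Finset.sum_comm]
      apply Finset.sum_congr rfl
      intro b _
      simp only [ite_mul, zero_mul]
      rw [Finset.sum_ite_eq]
      have hz2 : z - 2 - ((a + b + 2 : ℕ) : ℤ) = z - 4 - a - b := by push_cast; ring
      split_ifs with h
      · rw [hz2]
      · rw [Finset.mem_range] at h
        rw [gCoeff_neg _ _ _ (by omega), mul_zero]
    have hmain : (z : MvPolynomial ℕ A) * MvPolynomial.pderiv i (gCoeff β α₀ μ z u) =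
        (z : MvPolynomial ℕ A) * -∑ j ∈ Finset.range D,
          residue A i j * gCoeff β α₀ μ (z - 2 - j) (L j u) := by
      have h1 : (z : MvPolynomial ℕ A) * MvPolynomial.pderiv i (gCoeff β α₀ μ z u) =
          MvPolynomial.pderiv i ((z : MvPolynomial ℕ A) * gCoeff β α₀ μ z u) := by
        rw [Derivation.leibniz, Derivation.map_intCast]
        simp
      rw [h1, mul_gCoeff β α₀ μ z D hD, map_neg, map_sum]
      have h2 : ∀ j ∈ Finset.range D, MvPolynomial.pderiv i
          (eulerCoeff A j * gCoeff β α₀ μ (z - 2 - j) (L j u)) =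
          ((j : MvPolynomial ℕ A) + 2) * residue A i j * gCoeff β α₀ μ (z - 2 - j) (L j u) +
          (∑ a ∈ Finset.range D, ∑ b ∈ Finset.range D,
            (if a + b + 2 = j then ((b : MvPolynomial ℕ A) - a) *
              (residue A i a * eulerCoeff A b) else 0)) * gCoeff β α₀ μ (z - 2 - j) (L j u) -
          ∑ a ∈ Finset.range D, eulerCoeff A j * (residue A i a *
            gCoeff β α₀ μ (z - 4 - a - j) (L a (L j u))) := by
        intro j hj
        rw [Derivation.leibniz, pderiv_eulerCoeff A i (Finset.mem_range.1 hj), ih',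
          ← Finset.mul_sum]
        simp only [smul_eq_mul]
        ring
      rw [Finset.sum_congr rfl h2, Finset.sum_sub_distrib, Finset.sum_add_distrib, hE,
        Finset.sum_comm (f := fun j a => eulerCoeff A j * (residue A i a *
            gCoeff β α₀ μ (z - 4 - a - j) (L a (L j u)))), ← Finset.sum_add_distrib,
        ← Finset.sum_sub_distrib, mul_neg, Finset.mul_sum]
      congr 1
      apply Finset.sum_congr rfl
      intro a _
      have h3 : ∑ b ∈ Finset.range D, eulerCoeff A b * (residue A i a *
          gCoeff β α₀ μ (z - 4 - a - b) (L a (L b u))) = residue A i a *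
          (∑ b ∈ Finset.range D, eulerCoeff A b * gCoeff β α₀ μ (z - 4 - a - b) (L b (L a u))) +
          ∑ b ∈ Finset.range D, ((b : MvPolynomial ℕ A) - a) *
          (residue A i a * eulerCoeff A b) *
            gCoeff β α₀ μ (z - 4 - a - b) (L (a + b + 2) u) := by
        rw [Finset.mul_sum, ← Finset.sum_add_distrib]
        apply Finset.sum_congr rfl
        intro b _
        rw [hcomm]
        ring
      -- The commutator terms drop out, and `(a + 2) + (z - 2 - a) = z`.
      rw [h3, heuler]
      ring
    have hzc : (z : MvPolynomial ℕ A) = (d : MvPolynomial ℕ A) + 1 := by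
      rw [hz]; push_cast; rfl
    rw [hzc, ← sub_eq_zero, ← mul_sub] at hmain
    -- The positive integer `z = d + 1` is cancelled, the coefficients being a ℂ-algebra.
    exact sub_eq_zero.1 (eq_zero_of_succ_mul hmain)

end ConformalOperator

/-! ### The full operator `G_f`: derivatives, locality in the level, naturality -/

section OperatorG

variable {A : Type*} [CommRing A] [Algebra ℂ A]

lemma coeff_opG (β α₀ : ℂ) (u : Fock A) (μ : ℕ+ →₀ ℕ) :
    MvPowerSeries.coeff μ (opG β α₀ u) =
      ∑ d ∈ Finset.range (level μ + 1), gCoeff β α₀ μ (d : ℤ) u :=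
  (Finset.sum_congr rfl fun d _ => (gCoeff_natCast β α₀ μ d u).symm :
    ∑ d ∈ Finset.range (level μ + 1), MvPowerSeries.coeff μ (Gpart β α₀ d u) = _)

lemma constantCoeff_eulerCoeff (j : ℕ) : MvPolynomial.constantCoeff (eulerCoeff A j) = 0 := by
  rw [eulerCoeff, map_sum, Finset.sum_eq_zero]
  intro i _
  simp

lemma constantCoeff_gCoeff_succ (β α₀ : ℂ) (μ : ℕ+ →₀ ℕ) (d : ℕ) (u : Fock A) :
    MvPolynomial.constantCoeff (gCoeff β α₀ μ ((d : ℤ) + 1) u) = 0 := by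
  rw [gCoeff_succ _ _ _ d d le_rfl, MvPolynomial.constantCoeff_smul, map_sum, Finset.sum_eq_zero,
    smul_zero]
  intro j _
  rw [map_mul, constantCoeff_eulerCoeff, zero_mul]

/-- Shifting the degree by `j + 2` only adds parts of negative degree and drops parts of the highest
degrees. The latter vanish because `L_{-2-j} u` starts at level `j + 2`. -/
lemma sum_gCoeff_shift (β α₀ : ℂ) (u : Fock A) (μ : ℕ+ →₀ ℕ) (j : ℕ) :
    ∑ d ∈ Finset.range (level μ + 1),
      gCoeff β α₀ μ ((d : ℤ) - 2 - j) (virasoro β α₀ (-2 - (j : ℤ)) u) =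
    ∑ d ∈ Finset.range (level μ + 1), gCoeff β α₀ μ (d : ℤ) (virasoro β α₀ (-2 - (j : ℤ)) u) := by
  have hlev : LevelGE (j + 2) (virasoro β α₀ (-2 - (j : ℤ)) u) := by
    have := (levelGE_zero u).virasoro β α₀ j
    rwa [zero_add] at this
  rcases Nat.lt_or_ge (level μ + 1) (j + 2) with h | h
  · rw [Finset.sum_eq_zero, Finset.sum_eq_zero]
    · intro d _
      exact gCoeff_eq_zero _ _ hlev _ (by push_cast; omega)
    · intro d hd
      rw [Finset.mem_range] at hd
      exact gCoeff_neg _ _ _ (by omega) _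
  · obtain ⟨k, hk⟩ : ∃ k, level μ + 1 = (j + 2) + k := ⟨level μ + 1 - (j + 2), by omega⟩
    rw [hk, Finset.sum_range_add _ (j + 2) k, add_comm (j + 2) k, Finset.sum_range_add _ k (j + 2),
      Finset.sum_eq_zero,
      Finset.sum_eq_zero (s := Finset.range (j + 2)), zero_add, add_zero]
    · apply Finset.sum_congr rfl
      intro d _
      congr 1
      push_cast
      ring
    · intro d _
      exact gCoeff_eq_zero _ _ hlev _ (by push_cast; omega)
    · intro d hd
      rw [Finset.mem_range] at hd
      exact gCoeff_neg _ _ _ (by omega) _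

lemma pderiv_opG (β α₀ : ℂ) (u : Fock A) (μ : ℕ+ →₀ ℕ) (i : ℕ) :
    MvPolynomial.pderiv i (MvPowerSeries.coeff μ (opG β α₀ u)) =
      -∑ j ∈ Finset.range (level μ + 1), residue A i j *
        MvPowerSeries.coeff μ (opG β α₀ (virasoro β α₀ (-2 - (j : ℤ)) u)) := by
  rw [coeff_opG, map_sum]
  have h : ∀ d ∈ Finset.range (level μ + 1), MvPolynomial.pderiv i (gCoeff β α₀ μ (d : ℤ) u) =
      -∑ j ∈ Finset.range (level μ + 1), residue A i j *
        gCoeff β α₀ μ ((d : ℤ) - 2 - j) (virasoro β α₀ (-2 - (j : ℤ)) u) := by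
    intro d hd
    rw [Finset.mem_range] at hd
    exact pderiv_gCoeff β α₀ μ i (level μ + 1) d (by omega) u
  rw [Finset.sum_congr rfl h, Finset.sum_neg_distrib, Finset.sum_comm]
  congr 1
  apply Finset.sum_congr rfl
  intro j _
  rw [← Finset.mul_sum, sum_gCoeff_shift, ← coeff_opG]

/-- The operator `G_f` has its defining properties. -/
theorem isConformalOperator_opG (β α₀ : ℂ) : IsConformalOperator (A := A) β α₀ (opG β α₀) := by
  intro u μ
  constructor
  · rw [coeff_opG, Finset.sum_range_succ', map_add, map_sum, Finset.sum_eq_zero, zero_add,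
      Nat.cast_zero, gCoeff_zero, MvPolynomial.constantCoeff_C]
    intro d _
    rw [Nat.cast_succ, constantCoeff_gCoeff_succ]
  · intro i
    rw [pderiv_opG]
    refine congrArg Neg.neg (Eq.symm ?_)
    apply Finset.sum_subset_zero_on_sdiff
    · intro j hj
      rw [Finset.mem_Icc] at hj
      rw [Finset.mem_range]
      omega
    · intro j hj
      rw [Finset.mem_sdiff, Finset.mem_range, Finset.mem_Icc] at hj
      rw [residue_of_lt A (by omega), zero_mul]
    · intro j hj
      rw [Finset.mem_Icc] at hj
      rw [residue_of_le A hj.1]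

lemma opG_eq_zero_of_levelGE (β α₀ : ℂ) {u : Fock A} {μ : ℕ+ →₀ ℕ}
    (hu : LevelGE (level μ + 1) u) : MvPowerSeries.coeff μ (opG β α₀ u) = 0 := by
  rw [coeff_opG, Finset.sum_eq_zero]
  intro d _
  exact gCoeff_eq_zero _ _ hu _ (by push_cast; omega)

lemma coeff_opG_add (β α₀ : ℂ) (u v : Fock A) (μ : ℕ+ →₀ ℕ) :
    MvPowerSeries.coeff μ (opG β α₀ (u + v)) =
      MvPowerSeries.coeff μ (opG β α₀ u) + MvPowerSeries.coeff μ (opG β α₀ v) := by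
  simp only [coeff_opG, gCoeff_add, Finset.sum_add_distrib]

lemma coeff_opG_smul (β α₀ : ℂ) (c : A) (u : Fock A) (μ : ℕ+ →₀ ℕ) :
    MvPowerSeries.coeff μ (opG β α₀ (c • u)) =
      MvPolynomial.C c * MvPowerSeries.coeff μ (opG β α₀ u) := by
  simp only [coeff_opG, gCoeff_smul, Finset.mul_sum]

lemma coeff_opG_sum (β α₀ : ℂ) {ι : Type*} (s : Finset ι) (u : ι → Fock A) (μ : ℕ+ →₀ ℕ) :
    MvPowerSeries.coeff μ (opG β α₀ (∑ i ∈ s, u i)) =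
      ∑ i ∈ s, MvPowerSeries.coeff μ (opG β α₀ (u i)) := by
  simp only [coeff_opG, gCoeff_sum]
  exact Finset.sum_comm

/-- `G_f` never lowers the level. This permits truncated null field equations, valid only up to a
given level, to be inserted under `G_f`. -/
lemma coeff_opG_congr (β α₀ : ℂ) {u v : Fock A} {μ : ℕ+ →₀ ℕ}
    (h : ∀ ν, level ν ≤ level μ → MvPowerSeries.coeff ν u = MvPowerSeries.coeff ν v) :
    MvPowerSeries.coeff μ (opG β α₀ u) = MvPowerSeries.coeff μ (opG β α₀ v) := by
  have h1 : LevelGE (level μ + 1) (u + (-1 : A) • v) := by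
    intro ν hν
    rw [map_add, coeff_smul_fock, h ν (by omega)]
    simp
  have h2 := opG_eq_zero_of_levelGE β α₀ h1
  rw [coeff_opG_add, coeff_opG_smul, map_neg, map_one] at h2
  linear_combination h2

lemma map_fSeries : PowerSeries.map (MvPolynomial.map (algebraMap ℂ A)) (fSeries ℂ) =
    fSeries A := by
  ext1 n
  rw [PowerSeries.coeff_map, fSeries, fSeries, PowerSeries.coeff_mk, PowerSeries.coeff_mk]
  split_ifs <;> simp

lemma map_fDerivSeries : PowerSeries.map (MvPolynomial.map (algebraMap ℂ A)) (fDerivSeries ℂ) =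
    fDerivSeries A := by
  ext1 n
  rw [PowerSeries.coeff_map, fDerivSeries, fDerivSeries, PowerSeries.coeff_mk, PowerSeries.coeff_mk]
  split_ifs <;> simp

/-- The structure constants of `G_f` come from ℂ, so that a map of coefficients which is linear but
not multiplicative can pass through them. -/
lemma map_eulerCoeff (j : ℕ) :
    MvPolynomial.map (algebraMap ℂ A) (eulerCoeff ℂ j) = eulerCoeff A j := by
  rw [eulerCoeff, eulerCoeff, map_sum]
  apply Finset.sum_congr rfl
  intro i _
  rw [residueG, residueG, ← map_fSeries (A := A), ← map_fDerivSeries (A := A), ← map_pow,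
    ← map_mul, PowerSeries.coeff_map]
  simp

variable {B : Type*} [CommRing B] [Algebra ℂ B]

lemma coeff_gCoeff_mapLin (T : A →ₗ[ℂ] B) (β α₀ : ℂ) (u : Fock A) (μ : ℕ+ →₀ ℕ) (z : ℤ)
    (s : ℕ →₀ ℕ) : MvPolynomial.coeff s (gCoeff β α₀ μ z (mapLin T u)) =
      T (MvPolynomial.coeff s (gCoeff β α₀ μ z u)) := by
  classical
  induction z using gCoeff_induction generalizing u s with
  | hneg z hz => simp only [gCoeff_neg _ _ _ hz, MvPolynomial.coeff_zero, map_zero]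
  | h0 =>
    rw [gCoeff_zero, gCoeff_zero, MvPolynomial.coeff_C, MvPolynomial.coeff_C, coeff_mapLin]
    split_ifs <;> simp
  | hsucc d ih =>
    rw [gCoeff_succ _ _ _ d d le_rfl, gCoeff_succ _ _ _ d d le_rfl, MvPolynomial.coeff_smul,
      MvPolynomial.coeff_smul, map_smul, MvPolynomial.coeff_sum, MvPolynomial.coeff_sum, map_sum]
    congr 1
    apply Finset.sum_congr rfl
    intro j _
    rw [MvPolynomial.coeff_mul, MvPolynomial.coeff_mul, map_sum]
    apply Finset.sum_congr rfl
    intro p _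
    rw [virasoro_mapLin, ih, ← map_eulerCoeff, ← map_eulerCoeff (A := A), MvPolynomial.coeff_map,
      MvPolynomial.coeff_map, ← Algebra.smul_def, ← Algebra.smul_def, map_smul]

/-- The operator `G_f` commutes with linear maps of the coefficients. -/
lemma coeff_opG_mapLin (T : A →ₗ[ℂ] B) (β α₀ : ℂ) (u : Fock A) (μ : ℕ+ →₀ ℕ) (s : ℕ →₀ ℕ) :
    MvPolynomial.coeff s (MvPowerSeries.coeff μ (opG β α₀ (mapLin T u))) =
      T (MvPolynomial.coeff s (MvPowerSeries.coeff μ (opG β α₀ u))) := by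
  rw [coeff_opG, coeff_opG, MvPolynomial.coeff_sum, MvPolynomial.coeff_sum, map_sum]
  exact Finset.sum_congr rfl fun d _ => coeff_gCoeff_mapLin T β α₀ u μ d s

lemma coeff_opG_mem (W : Submodule ℂ A) (β α₀ : ℂ) {u : Fock A}
    (hu : ∀ ν, MvPowerSeries.coeff ν u ∈ W) (μ : ℕ+ →₀ ℕ) (s : ℕ →₀ ℕ) :
    MvPolynomial.coeff s (MvPowerSeries.coeff μ (opG β α₀ u)) ∈ W := by
  by_contra h
  -- By duality: a functional killing `W` kills all coefficients of `u`, hence by naturality those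
  -- of `G_f u`.
  obtain ⟨T, hT, hW⟩ := Submodule.exists_le_ker_of_notMem h
  apply hT
  have h0 : mapLin T u = (0 : ℂ) • mapLin T u := by
    ext ν
    rw [zero_smul, coeff_mapLin]
    exact hW (hu ν)
  rw [← coeff_opG_mapLin, h0, coeff_opG_smul, map_zero, zero_mul, MvPolynomial.coeff_zero]

lemma coeff_virasoro_mem (W : Submodule ℂ A) (β α₀ : ℂ) {u : Fock A}
    (hu : ∀ ν, MvPowerSeries.coeff ν u ∈ W) (j : ℕ) (μ : ℕ+ →₀ ℕ) :
    MvPowerSeries.coeff μ (virasoro β α₀ (-2 - (j : ℤ)) u) ∈ W := by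
  by_contra h
  obtain ⟨T, hT, hW⟩ := Submodule.exists_le_ker_of_notMem h
  apply hT
  have h0 : mapLin T u = 0 := by
    ext ν
    rw [coeff_mapLin]
    exact hW (hu ν)
  rw [← coeff_mapLin, ← virasoro_mapLin, h0, ← virasoroL_apply, map_zero, map_zero]

end OperatorG

/-! ### The Coulomb gas correlation vector and its null field equation -/

section Vertex

variable {ι : Type*} [Fintype ι]

/-- `U⁻` is the exponential of a linear form in the creators, hence a common eigenvector of the
annihilators. -/
lemma lower_Uminus (a z : ι → ℂ) (l : ℕ) :
    lower l (Uminus a z) = (∑ i, a i * z i ^ (l + 1)) • Uminus a z := by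
  classical
  ext μ
  rw [coeff_lower, coeff_smul_fock, smul_eq_mul]
  set n := l.succPNat with hn
  set g : ℕ+ → ℕ → ℂ := fun n k => ((∑ i, a i * z i ^ (n : ℕ)) / ((n : ℕ) : ℂ)) ^ k /
    (k.factorial : ℂ) with hg
  have hg0 : ∀ m, g m 0 = 1 := by simp [hg]
  have h1 : MvPowerSeries.coeff (μ + Finsupp.single n 1) (Uminus a z) =
      g n (μ n + 1) * (μ.erase n).prod g := by
    have := Finsupp.mul_prod_erase' (μ + Finsupp.single n 1) n g (fun m => hg0 m)
    rw [Finsupp.erase_add, Finsupp.erase_single, add_zero] at this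
    simp only [Finsupp.add_apply, Finsupp.single_eq_same] at this
    exact this.symm
  have h2 : MvPowerSeries.coeff μ (Uminus a z) = g n (μ n) * (μ.erase n).prod g :=
    (Finsupp.mul_prod_erase' μ n g (fun m => hg0 m)).symm
  have hl : ((l : ℂ) + 1) ≠ 0 := by exact_mod_cast Nat.succ_ne_zero l
  have hm : ((μ n : ℂ) + 1) ≠ 0 := by exact_mod_cast Nat.succ_ne_zero (μ n)
  have hf : ((μ n).factorial : ℂ) ≠ 0 := by exact_mod_cast Nat.factorial_ne_zero _
  have h3 : ((l : ℂ) + 1) * ((μ n : ℂ) + 1) * g n (μ n + 1) =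
      (∑ i, a i * z i ^ (l + 1)) * g n (μ n) := by
    simp only [hg, Nat.factorial_succ, hn, Nat.succPNat_coe]
    push_cast
    rw [pow_succ]
    field_simp
  rw [h1, h2, ← mul_assoc, h3, mul_assoc]

/-- The differential of `(∑ i, a i * z i ^ (n + 1)) / (n + 1)`. -/
def powerSumDeriv (a z : ι → ℂ) (n : ℕ) : (ι → ℂ) →L[ℂ] ℂ :=
  ∑ i, (a i * z i ^ n) • ContinuousLinearMap.proj (R := ℂ) (φ := fun _ : ι => ℂ) i

lemma powerSumDeriv_single [DecidableEq ι] (a z : ι → ℂ) (n : ℕ) (i : ι) :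
    powerSumDeriv a z n (Pi.single i 1) = a i * z i ^ n := by
  rw [powerSumDeriv, sum_apply, Finset.sum_eq_single i]
  · simp
  · intro j _ hj
    simp [Pi.single_eq_of_ne hj]
  · simp

lemma hasFDerivAt_powerSum (a z : ι → ℂ) (n : ℕ) :
    HasFDerivAt (fun z : ι → ℂ => (∑ i, a i * z i ^ (n + 1)) / (((n + 1 : ℕ) : ℕ) : ℂ))
      (powerSumDeriv a z n) z := by
  have hn : (((n + 1 : ℕ) : ℕ) : ℂ) ≠ 0 := by exact_mod_cast Nat.succ_ne_zero n
  have h1 : ∀ i ∈ (Finset.univ : Finset ι), HasFDerivAt (fun z : ι → ℂ => a i * z i ^ (n + 1))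
      ((a i * (((n + 1 : ℕ) : ℂ) * z i ^ n)) •
        ContinuousLinearMap.proj (R := ℂ) (φ := fun _ : ι => ℂ) i) z := by
    intro i _
    have h2 : HasFDerivAt (fun z : ι → ℂ => z i)
        (ContinuousLinearMap.proj (R := ℂ) (φ := fun _ : ι => ℂ) i) z :=
      (ContinuousLinearMap.proj (R := ℂ) (φ := fun _ : ι => ℂ) i).hasFDerivAt
    have h3 := (h2.pow (n + 1)).const_mul (a i)
    convert! h3 using 1
    ext v
    simp
    ring
  have h4 := (HasFDerivAt.fun_sum h1).mul_const ((((n + 1 : ℕ) : ℕ) : ℂ)⁻¹)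
  simp only [div_eq_mul_inv]
  convert! h4 using 1
  rw [powerSumDeriv, Finset.smul_sum]
  apply Finset.sum_congr rfl
  intro i _
  rw [smul_smul]
  congr 1
  field_simp

/-- Differentiating the exponent gives `∂_i U⁻ = a_i ∑_n z_i^n X_{n+1} U⁻`; only `n < level μ`
contributes at `μ`. -/
lemma hasFDerivAt_Uminus (a z : ι → ℂ) {μ : ℕ+ →₀ ℕ} {M : ℕ} (hM : level μ ≤ M) :
    HasFDerivAt (fun z => MvPowerSeries.coeff μ (Uminus a z))
      (∑ n ∈ Finset.range M, MvPowerSeries.coeff μ (MvPowerSeries.X n.succPNat * Uminus a z) •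
        powerSumDeriv a z n) z := by
  classical
  set g : (ι → ℂ) → ℕ+ → ℕ → ℂ := fun z n k =>
    ((∑ i, a i * z i ^ (n : ℕ)) / ((n : ℕ) : ℂ)) ^ k / (k.factorial : ℂ) with hg
  have hg1 : ∀ n ∈ μ.support, HasFDerivAt (fun z => g z n (μ n))
      (g z n (μ n - 1) • powerSumDeriv a z n.natPred) z := by
    intro n hn
    obtain ⟨l, rfl⟩ : ∃ l : ℕ, n = l.succPNat := ⟨n.natPred, by simp⟩
    obtain ⟨k, hk⟩ : ∃ k, μ l.succPNat = k + 1 :=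
      ⟨μ l.succPNat - 1, by have := Finsupp.mem_support_iff.1 hn; omega⟩
    have hf : ((k.factorial : ℕ) : ℂ) ≠ 0 := by exact_mod_cast Nat.factorial_ne_zero _
    have hk0 : ((k : ℂ) + 1) ≠ 0 := by exact_mod_cast Nat.succ_ne_zero k
    have h3 := ((hasFDerivAt_powerSum a z l).pow (k + 1)).mul_const
      (((k + 1).factorial : ℂ)⁻¹)
    rw [hk]
    simp only [hg, Nat.succPNat_coe, Nat.natPred_succPNat,
      div_eq_mul_inv _ (((k + 1).factorial : ℂ))]
    convert! h3 using 1
    rw [smul_smul]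
    congr 1
    rw [Nat.factorial_succ]
    simp only [nsmul_eq_mul, Nat.add_sub_cancel]
    push_cast
    field_simp
  have h1 := HasFDerivAt.finsetProd hg1
  have hU : (fun z => MvPowerSeries.coeff μ (Uminus a z)) = fun z => ∏ n ∈ μ.support, g z n (μ n) :=
    rfl
  rw [hU]
  refine h1.congr_fderiv ?_
  apply Finset.sum_of_injOn (fun n : ℕ+ => n.natPred)
  · intro a _ b _ h
    exact PNat.natPred_injective h
  · intro n hn
    have h1 : 1 ≤ μ n := by
      have := Finsupp.mem_support_iff.1 hn
      omega
    have := level_sub_single h1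
    have h3 := PNat.natPred_add_one n
    simp only [Finset.coe_range, Set.mem_Iio]
    omega
  · intro l _ hl
    have : μ l.succPNat = 0 := by
      by_contra h
      exact hl ⟨l.succPNat, Finsupp.mem_support_iff.2 h, by simp⟩
    rw [coeff_X_mul, this, if_neg (by norm_num)]
    exact zero_smul ℂ (powerSumDeriv a z l)
  · intro n hn
    have h1 : 1 ≤ μ n := by
      have := Finsupp.mem_support_iff.1 hn
      omega
    rw [smul_smul]
    have hs : n.natPred.succPNat = n := by simp
    rw [hs, coeff_X_mul, if_pos h1]
    congr 1
    have h2 : MvPowerSeries.coeff (μ - Finsupp.single n 1) (Uminus a z) =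
        g z n ((μ - Finsupp.single n 1 : ℕ+ →₀ ℕ) n) *
          ((μ - Finsupp.single n 1).erase n).prod (g z) :=
      (Finsupp.mul_prod_erase' (μ - Finsupp.single n 1) n (g z) (by simp [hg])).symm
    have h3 : (μ - Finsupp.single n 1).erase n = μ.erase n := by
      ext m
      by_cases hm : m = n
      · subst hm; simp
      · simp [Finsupp.erase_ne hm, Finsupp.single_eq_of_ne hm]
    have h4 : (μ.erase n).prod (g z) = ∏ m ∈ μ.support.erase n, g z m (μ m) := by
      rw [Finsupp.prod, Finsupp.support_erase]
      apply Finset.prod_congr rfl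
      intro m hm
      rw [Finsupp.erase_ne (Finset.ne_of_mem_erase hm)]
    rw [h2, h3, h4]
    simp [mul_comm]

lemma hasFDerivAt_X_mul_Uminus (a z : ι → ℂ) {μ : ℕ+ →₀ ℕ} {M : ℕ} (hM : level μ ≤ M) (m : ℕ+) :
    HasFDerivAt (fun z => MvPowerSeries.coeff μ (MvPowerSeries.X m * Uminus a z))
      (∑ n ∈ Finset.range M, MvPowerSeries.coeff μ
        (MvPowerSeries.X m * (MvPowerSeries.X n.succPNat * Uminus a z)) •
          powerSumDeriv a z n) z := by
  simp only [coeff_X_mul m]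
  by_cases h : 1 ≤ μ m
  · simp only [if_pos h]
    apply hasFDerivAt_Uminus
    have := level_sub_single h
    omega
  · simp only [if_neg h]
    refine (hasFDerivAt_const (0 : ℂ) z).congr_fderiv (Finset.sum_eq_zero fun n _ => ?_).symm
    exact zero_smul ℂ (powerSumDeriv a z n)

lemma sum_range_mul_sum_antidiagonal (y : ℂ) (c : ℕ → ℕ → ℂ) (M : ℕ)
    (hc : ∀ p q, M ≤ p + q → c p q = 0) :
    ∑ j ∈ Finset.range M, y ^ j * ∑ p ∈ Finset.HasAntidiagonal.antidiagonal j, c p.1 p.2 =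
      ∑ p ∈ Finset.range M, ∑ q ∈ Finset.range M, y ^ p * y ^ q * c p q := by
  have h := Finset.sum_range_diag_flip M (fun p q => y ^ p * y ^ q * c p q)
  have h1 : ∀ j ∈ Finset.range M,
      y ^ j * ∑ p ∈ Finset.HasAntidiagonal.antidiagonal j, c p.1 p.2 =
      ∑ k ∈ Finset.range (j + 1), y ^ k * y ^ (j - k) * c k (j - k) := by
    intro j _
    rw [Finset.Nat.sum_antidiagonal_eq_sum_range_succ_mk, Finset.mul_sum]
    apply Finset.sum_congr rfl
    intro k hk
    rw [Finset.mem_range] at hk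
    rw [← pow_add, show k + (j - k) = j by omega]
  rw [Finset.sum_congr rfl h1, h]
  apply Finset.sum_congr rfl
  intro p _
  apply Finset.sum_subset (Finset.range_subset_range.2 (Nat.sub_le _ _))
  intro q _ hq
  rw [Finset.mem_range] at hq
  rw [hc p q (by omega), mul_zero]

/-- Collecting by `n = l + j + 1` produces the divided difference of `t ↦ t^n` at `y` and `w`, which
stays meaningful when `y = w`. -/
lemma sum_range_mul_sum_shift (y w : ℂ) (c : ℕ → ℂ) (M : ℕ) (hc : ∀ n, M ≤ n → c n = 0) :
    ∑ j ∈ Finset.range M, y ^ j * ∑ l ∈ Finset.range (M + 1), w ^ l * c (l + j + 1) =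
      ∑ n ∈ Finset.range M, (∑ k ∈ Finset.range n, y ^ k * w ^ (n - 1 - k)) * c n := by
  have h := Finset.sum_range_diag_flip M (fun j l => y ^ j * w ^ l * c (l + j + 1))
  have h1 : ∑ n ∈ Finset.range M, (∑ k ∈ Finset.range n, y ^ k * w ^ (n - 1 - k)) * c n =
      ∑ m ∈ Finset.range M, ∑ k ∈ Finset.range (m + 1),
        y ^ k * w ^ (m - k) * c (m - k + k + 1) := by
    have h2 := Finset.sum_range_succ'
      (fun n => (∑ k ∈ Finset.range n, y ^ k * w ^ (n - 1 - k)) * c n) M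
    rw [Finset.sum_range_succ, hc M le_rfl, mul_zero, add_zero, Finset.sum_range_zero, zero_mul,
      add_zero] at h2
    rw [h2]
    apply Finset.sum_congr rfl
    intro m _
    rw [Finset.sum_mul]
    apply Finset.sum_congr rfl
    intro k hk
    rw [Finset.mem_range] at hk
    rw [show m - k + k + 1 = m + 1 by omega, show m + 1 - 1 - k = m - k by omega]
  rw [h1, h]
  apply Finset.sum_congr rfl
  intro j _
  rw [Finset.mul_sum]
  symm
  rw [← Finset.sum_subset (Finset.range_subset_range.2 (show M - j ≤ M + 1 by omega))]
  · apply Finset.sum_congr rfl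
    intro l _
    ring
  · intro l _ hl
    rw [Finset.mem_range] at hl
    rw [hc _ (by omega)]
    ring

variable [DecidableEq ι]

/-- The generating function of the generators `L_{-2-j}` on the Coulomb gas vector, i.e. the
regular part of the stress tensor at the point `z i`. -/
lemma sum_virasoro_Uminus (a z : ι → ℂ) (hz : Function.Injective z) (α₀ : ℂ) (i : ι)
    {μ : ℕ+ →₀ ℕ} {M : ℕ} (hM : level μ ≤ M) :
    ∑ j ∈ Finset.range M, z i ^ j *
      MvPowerSeries.coeff μ (virasoro (∑ k, a k) α₀ (-2 - (j : ℤ)) (Uminus a z)) =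
    1 / 4 * (∑ p ∈ Finset.range M, ∑ q ∈ Finset.range M, z i ^ p * z i ^ q *
      MvPowerSeries.coeff μ (MvPowerSeries.X p.succPNat *
        (MvPowerSeries.X q.succPNat * Uminus a z))) +
    (a i + α₀) * (∑ n ∈ Finset.range M, (n : ℂ) * z i ^ (n - 1) *
      MvPowerSeries.coeff μ (MvPowerSeries.X n.succPNat * Uminus a z)) +
    ∑ k ∈ Finset.univ.erase i, a k / (z i - z k) *
      (∑ n ∈ Finset.range M, z i ^ n *
        MvPowerSeries.coeff μ (MvPowerSeries.X n.succPNat * Uminus a z) -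
      ∑ n ∈ Finset.range M, z k ^ n *
        MvPowerSeries.coeff μ (MvPowerSeries.X n.succPNat * Uminus a z)) := by
  set c : ℕ → ℂ := fun n => MvPowerSeries.coeff μ (MvPowerSeries.X n.succPNat * Uminus a z) with hc
  set c2 : ℕ → ℕ → ℂ := fun p q => MvPowerSeries.coeff μ (MvPowerSeries.X p.succPNat *
        (MvPowerSeries.X q.succPNat * Uminus a z)) with hc2
  have hc0 : ∀ n, M ≤ n → c n = 0 := by
    intro n hn
    apply coeff_X_mul_of_level_lt
    rw [Nat.succPNat_coe]
    omega
  have hc20 : ∀ p q, M ≤ p + q → c2 p q = 0 := by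
    intro p q hpq
    apply ((levelGE_zero (Uminus a z)).X_mul _).X_mul
    simp only [Nat.succPNat_coe]
    omega
  have hvir : ∀ j : ℕ, MvPowerSeries.coeff μ (virasoro (∑ k, a k) α₀ (-2 - (j : ℤ)) (Uminus a z)) =
      1 / 4 * (∑ p ∈ Finset.HasAntidiagonal.antidiagonal j, c2 p.1 p.2) +
      ∑ k, a k * (∑ l ∈ Finset.range (M + 1), z k ^ l * c (l + j + 1)) +
      α₀ * ((j + 1) * c (j + 1)) := by
    intro j
    rw [coeff_virasoro _ α₀ j M _ hM]
    -- The zero mode is the `l = 0` term of the annihilator sum, since the charge of the module is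
    -- `∑ k, a k`.
    have h1 : ∑ k, a k * (∑ l ∈ Finset.range (M + 1), z k ^ l * c (l + j + 1)) =
        (∑ l ∈ Finset.range M, (∑ k, a k * z k ^ (l + 1)) * c (l + j + 2)) +
          (∑ k, a k) * c (j + 1) := by
      simp only [Finset.sum_range_succ' _ M, mul_add, Finset.sum_add_distrib, Finset.mul_sum,
        Finset.sum_mul]
      rw [Finset.sum_comm]
      congr 1
      · apply Finset.sum_congr rfl
        intro l _
        apply Finset.sum_congr rfl
        intro k _
        rw [show l + 1 + j + 1 = l + j + 2 by omega]
        ring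
      · apply Finset.sum_congr rfl
        intro k _
        rw [pow_zero, one_mul, zero_add]
    rw [h1]
    simp only [lower_Uminus, mul_smul_comm, coeff_smul_fock, smul_eq_mul]
    simp only [hc, hc2]
    ring
  have hS1 := sum_range_mul_sum_antidiagonal (z i) c2 M hc20
  have hS2 : ∀ k, ∑ j ∈ Finset.range M, z i ^ j *
      ∑ l ∈ Finset.range (M + 1), z k ^ l * c (l + j + 1) =
      ∑ n ∈ Finset.range M, (∑ m ∈ Finset.range n, z i ^ m * z k ^ (n - 1 - m)) * c n :=
    fun k => sum_range_mul_sum_shift (z i) (z k) c M hc0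
  have hS3 : ∑ j ∈ Finset.range M, z i ^ j * ((j + 1) * c (j + 1)) =
      ∑ n ∈ Finset.range M, (n : ℂ) * z i ^ (n - 1) * c n := by
    have h2 := Finset.sum_range_succ' (fun n : ℕ => (n : ℂ) * z i ^ (n - 1) * c n) M
    rw [Finset.sum_range_succ, hc0 M le_rfl, mul_zero, add_zero, Nat.cast_zero, zero_mul,
      zero_mul, add_zero] at h2
    rw [h2]
    apply Finset.sum_congr rfl
    intro j _
    rw [Nat.add_sub_cancel]
    push_cast
    ring
  -- At the coincident point the divided difference becomes the derivative `n z^{n-1}`, of the same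
  -- form as the background charge term.
  have hdiag : ∑ n ∈ Finset.range M, (∑ m ∈ Finset.range n, z i ^ m * z i ^ (n - 1 - m)) * c n =
      ∑ n ∈ Finset.range M, (n : ℂ) * z i ^ (n - 1) * c n := by
    apply Finset.sum_congr rfl
    intro n _
    congr 1
    have : ∀ m ∈ Finset.range n, z i ^ m * z i ^ (n - 1 - m) = z i ^ (n - 1) := by
      intro m hm
      rw [Finset.mem_range] at hm
      rw [← pow_add, show m + (n - 1 - m) = n - 1 by omega]
    rw [Finset.sum_congr rfl this, Finset.sum_const, Finset.card_range, nsmul_eq_mul]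
  have hoff : ∀ k ∈ Finset.univ.erase i,
      a k * ∑ n ∈ Finset.range M, (∑ m ∈ Finset.range n, z i ^ m * z k ^ (n - 1 - m)) * c n =
      a k / (z i - z k) * (∑ n ∈ Finset.range M, z i ^ n * c n -
        ∑ n ∈ Finset.range M, z k ^ n * c n) := by
    intro k hk
    have hne : z i - z k ≠ 0 := sub_ne_zero.2 fun h => Finset.ne_of_mem_erase hk (hz h).symm
    rw [← Finset.sum_sub_distrib, div_mul_eq_mul_div, eq_div_iff hne, mul_assoc, Finset.sum_mul]
    congr 1
    apply Finset.sum_congr rfl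
    intro n _
    have := Commute.geom_sum₂_mul (Commute.all (z i) (z k)) n
    linear_combination c n * this
  have hfinal : ∑ j ∈ Finset.range M, z i ^ j *
      MvPowerSeries.coeff μ (virasoro (∑ k, a k) α₀ (-2 - (j : ℤ)) (Uminus a z)) =
      1 / 4 * (∑ j ∈ Finset.range M,
        z i ^ j * ∑ p ∈ Finset.HasAntidiagonal.antidiagonal j, c2 p.1 p.2) +
      ∑ k, a k * (∑ j ∈ Finset.range M, z i ^ j *
        ∑ l ∈ Finset.range (M + 1), z k ^ l * c (l + j + 1)) +
      α₀ * (∑ j ∈ Finset.range M, z i ^ j * ((j + 1) * c (j + 1))) := by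
    simp only [hvir, mul_add, Finset.sum_add_distrib]
    congr 1
    · congr 1
      · rw [Finset.mul_sum]
        apply Finset.sum_congr rfl
        intro j _
        ring
      · simp only [Finset.mul_sum]
        rw [Finset.sum_comm]
        apply Finset.sum_congr rfl
        intro k _
        apply Finset.sum_congr rfl
        intro j _
        apply Finset.sum_congr rfl
        intro l _
        ring
    · rw [Finset.mul_sum]
      apply Finset.sum_congr rfl
      intro j _
      ring
  rw [hfinal, hS1, hS3]
  simp only [hS2]
  rw [← Finset.add_sum_erase _ _ (Finset.mem_univ i), hdiag, Finset.sum_congr rfl hoff]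
  ring

/-- The connection coefficient `∂_i log h` of the Coulomb gas integrand
`h = ∏ (z_j - z_i) ^ (2 a_i a_j)`. -/
def connection (a : ι → ℂ) (i : ι) (z : ι → ℂ) : ℂ :=
  ∑ j ∈ Finset.univ.erase i, 2 * a i * a j / (z i - z j)

/-- The rational identity behind the null field equation. -/
lemma connection_null (a z : ι → ℂ) (hz : Function.Injective z) (κ α₀ : ℂ) (i : ι)
    (hκ : κ * a i ^ 2 = 1) (hα₀ : 4 * α₀ = κ * a i - 4 * a i) :
    κ / 2 * (connection a i z ^ 2 +
        ∑ j ∈ Finset.univ.erase i, -(2 * a i * a j) / (z i - z j) ^ 2) +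
      ∑ j ∈ Finset.univ.erase i, (2 / (z j - z i) * connection a j z -
        2 * (a j ^ 2 - 2 * α₀ * a j) / (z j - z i) ^ 2) = 0 := by
  set S := Finset.univ.erase i with hS
  have hne : ∀ j k : ι, j ≠ k → z j - z k ≠ 0 := fun j k h => sub_ne_zero.2 fun e => h (hz e)
  have hsq : connection a i z ^ 2 = ∑ j ∈ S, (2 * a i * a j / (z i - z j)) ^ 2 +
      ∑ j ∈ S, ∑ k ∈ S, (if j = k then 0 else
        4 * a i ^ 2 * (a j * a k) / ((z i - z j) * (z i - z k))) := by
    rw [connection, sq, Finset.sum_mul_sum, ← Finset.sum_add_distrib]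
    apply Finset.sum_congr rfl
    intro j hj
    have : ∀ k ∈ S, 2 * a i * a j / (z i - z j) * (2 * a i * a k / (z i - z k)) =
        (if j = k then (2 * a i * a j / (z i - z j)) ^ 2 else 0) +
        (if j = k then 0 else 4 * a i ^ 2 * (a j * a k) / ((z i - z j) * (z i - z k))) := by
      intro k hk
      split_ifs with h
      · subst h; ring
      · rw [div_mul_div_comm]; ring
    rw [Finset.sum_congr rfl this, Finset.sum_add_distrib, Finset.sum_ite_eq, if_pos hj]
  have hA : ∑ j ∈ S, 2 / (z j - z i) * connection a j z =
      ∑ j ∈ S, 4 * a i * a j / (z j - z i) ^ 2 +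
      ∑ j ∈ S, ∑ k ∈ S, (if j = k then 0 else
        4 * (a j * a k) / ((z j - z i) * (z j - z k))) := by
    rw [← Finset.sum_add_distrib]
    apply Finset.sum_congr rfl
    intro j hj
    have hij : i ≠ j := (Finset.ne_of_mem_erase hj).symm
    have h1 : Finset.univ.erase j = insert i (S.erase j) := by
      ext k
      simp only [Finset.mem_erase, Finset.mem_univ, Finset.mem_insert, hS, and_true]
      by_cases h : k = i
      · subst h; simp [hij]
      · simp [h]
    have h3 : ∀ k ∈ S.erase j, 2 / (z j - z i) * (2 * a j * a k / (z j - z k)) =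
        (if j = k then 0 else 4 * (a j * a k) / ((z j - z i) * (z j - z k))) := by
      intro k hk
      rw [if_neg (Finset.ne_of_mem_erase hk).symm, div_mul_div_comm]
      ring
    rw [connection, h1, Finset.sum_insert (by simp [hS]), mul_add, Finset.mul_sum,
      Finset.sum_congr rfl h3]
    congr 1
    · rw [div_mul_div_comm]
      ring
    · apply Finset.sum_subset (Finset.erase_subset _ _)
      intro k _ hk'
      have : k = j := by
        by_contra h
        exact hk' (Finset.mem_erase.2 ⟨h, by assumption⟩)
      rw [if_pos this.symm]
  -- Symmetrization in `j, k` and the three-point identity `1/((z_j-z_i)(z_j-z_k)) +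
  -- 1/((z_k-z_i)(z_k-z_j)) = -1/((z_i-z_j)(z_i-z_k))`.
  have hsym : ∑ j ∈ S, ∑ k ∈ S, (if j = k then 0 else
        4 * (a j * a k) / ((z j - z i) * (z j - z k))) =
      - ∑ j ∈ S, ∑ k ∈ S, (if j = k then 0 else
        2 * (a j * a k) / ((z i - z j) * (z i - z k))) := by
    have h1 : ∑ j ∈ S, ∑ k ∈ S, (if j = k then 0 else
        4 * (a j * a k) / ((z j - z i) * (z j - z k))) =
        ∑ j ∈ S, ∑ k ∈ S, (if j = k then 0 else
        4 * (a j * a k) / ((z k - z i) * (z k - z j))) := by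
      rw [Finset.sum_comm]
      apply Finset.sum_congr rfl
      intro j _
      apply Finset.sum_congr rfl
      intro k _
      simp only [eq_comm (a := k)]
      rw [mul_comm (a k)]
    have h2 : ∑ j ∈ S, ∑ k ∈ S, (if j = k then 0 else
        4 * (a j * a k) / ((z j - z i) * (z j - z k))) +
        ∑ j ∈ S, ∑ k ∈ S, (if j = k then 0 else
        4 * (a j * a k) / ((z k - z i) * (z k - z j))) =
        - (2 * ∑ j ∈ S, ∑ k ∈ S, (if j = k then 0 else
        2 * (a j * a k) / ((z i - z j) * (z i - z k)))) := by
      rw [Finset.mul_sum, ← Finset.sum_neg_distrib, ← Finset.sum_add_distrib]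
      apply Finset.sum_congr rfl
      intro j hj
      rw [Finset.mul_sum, ← Finset.sum_neg_distrib, ← Finset.sum_add_distrib]
      apply Finset.sum_congr rfl
      intro k hk
      split_ifs with h
      · ring
      · have e1 := hne j i (Finset.ne_of_mem_erase hj)
        have e2 := hne k i (Finset.ne_of_mem_erase hk)
        have e3 := hne j k h
        have e4 : z k - z j = -(z j - z k) := by ring
        have e5 : z i - z j = -(z j - z i) := by ring
        have e6 : z i - z k = -(z k - z i) := by ring
        rw [e4, e5, e6]
        field_simp
        ring
    rw [← h1] at h2
    linear_combination h2 / 2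
  have hoff : κ / 2 * ∑ j ∈ S, ∑ k ∈ S, (if j = k then 0 else
        4 * a i ^ 2 * (a j * a k) / ((z i - z j) * (z i - z k))) =
      ∑ j ∈ S, ∑ k ∈ S, (if j = k then 0 else
        2 * (a j * a k) / ((z i - z j) * (z i - z k))) := by
    rw [Finset.mul_sum]
    apply Finset.sum_congr rfl
    intro j _
    rw [Finset.mul_sum]
    apply Finset.sum_congr rfl
    intro k _
    split_ifs
    · ring
    · linear_combination (2 * (a j * a k) / ((z i - z j) * (z i - z k))) * hκ
  -- The double poles cancel for every charge `a j` exactly because its weight is `a j ^ 2 - 2 * α₀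
  -- * a j`.
  have hdiag : κ / 2 * (∑ j ∈ S, (2 * a i * a j / (z i - z j)) ^ 2 +
      ∑ j ∈ S, -(2 * a i * a j) / (z i - z j) ^ 2) + ∑ j ∈ S, 4 * a i * a j / (z j - z i) ^ 2 -
      ∑ j ∈ S, 2 * (a j ^ 2 - 2 * α₀ * a j) / (z j - z i) ^ 2 = 0 := by
    rw [← Finset.sum_add_distrib, Finset.mul_sum, ← Finset.sum_add_distrib,
      ← Finset.sum_sub_distrib]
    apply Finset.sum_eq_zero
    intro j hj
    have e5 : z i - z j = -(z j - z i) := by ring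
    rw [e5, div_pow, neg_sq]
    linear_combination (2 * a j ^ 2 / (z j - z i) ^ 2) * hκ + (a j / (z j - z i) ^ 2) * hα₀
  rw [Finset.sum_sub_distrib, hA, hsq, hsym]
  linear_combination hdiag + hoff

end Vertex

/-! ### The covariant derivative and the null field equation before integration -/

section Nabla

variable {ι : Type*} [Fintype ι] [DecidableEq ι]

/-- The covariant derivative `h⁻¹ ∂_i h` with respect to the Coulomb gas integrand `h`. -/
def nabla (a : ι → ℂ) (i : ι) (P : (ι → ℂ) → ℂ) : (ι → ℂ) → ℂ := fun z =>
  fderiv ℂ P z (Pi.single i 1) + connection a i z * P z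

variable (ι) in
/-- The configurations of distinct points. -/
def configurations : Set (ι → ℂ) := {z | Function.Injective z}

lemma analyticAt_proj (i : ι) (z : ι → ℂ) : AnalyticAt ℂ (fun z : ι → ℂ => z i) z :=
  (ContinuousLinearMap.proj (R := ℂ) (φ := fun _ : ι => ℂ) i).analyticAt z

lemma analyticOnNhd_const_div_sub (c : ℂ) {i j : ι} (h : i ≠ j) :
    AnalyticOnNhd ℂ (fun z : ι → ℂ => c / (z i - z j)) (configurations ι) := fun z hz =>
  analyticAt_const.div ((analyticAt_proj i z).sub (analyticAt_proj j z))
    (sub_ne_zero.2 fun e => h (hz e))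

lemma analyticOnNhd_connection (a : ι → ℂ) (i : ι) :
    AnalyticOnNhd ℂ (connection a i) (configurations ι) := fun z hz => by
  unfold connection
  exact Finset.analyticAt_fun_sum _ fun j hj =>
    analyticOnNhd_const_div_sub _ (Finset.ne_of_mem_erase hj).symm z hz

lemma analyticOnNhd_nabla {P : (ι → ℂ) → ℂ} (h : AnalyticOnNhd ℂ P (configurations ι))
    (a : ι → ℂ) (i : ι) : AnalyticOnNhd ℂ (nabla a i P) (configurations ι) := fun z hz => by
  refine AnalyticAt.add ?_ ((analyticOnNhd_connection a i z hz).mul (h z hz))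
  exact ((ContinuousLinearMap.apply ℂ ℂ (Pi.single i 1 : ι → ℂ)).analyticAt _).comp (h.fderiv z hz)

lemma analyticOnNhd_Uminus (a : ι → ℂ) (μ : ℕ+ →₀ ℕ) :
    AnalyticOnNhd ℂ (fun z => MvPowerSeries.coeff μ (Uminus a z)) (configurations ι) := by
  intro z _
  change AnalyticAt ℂ (fun z : ι → ℂ => ∏ n ∈ μ.support,
    ((∑ i, a i * z i ^ (n : ℕ)) / ((n : ℕ) : ℂ)) ^ (μ n) / ((μ n).factorial : ℂ)) z
  refine Finset.analyticAt_fun_prod _ fun n _ => ?_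
  refine AnalyticAt.div ?_ analyticAt_const (by exact_mod_cast Nat.factorial_ne_zero _)
  refine AnalyticAt.pow ?_ _
  refine AnalyticAt.div ?_ analyticAt_const (by exact_mod_cast n.ne_zero)
  exact Finset.analyticAt_fun_sum _ fun i _ => analyticAt_const.mul ((analyticAt_proj i z).pow _)

lemma hasFDerivAt_proj (i : ι) (z : ι → ℂ) : HasFDerivAt (fun z : ι → ℂ => z i)
    (ContinuousLinearMap.proj (R := ℂ) (φ := fun _ : ι => ℂ) i) z :=
  (ContinuousLinearMap.proj (R := ℂ) (φ := fun _ : ι => ℂ) i).hasFDerivAt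

lemma fderiv_connection_self (a z : ι → ℂ) (hz : Function.Injective z) (i : ι) :
    fderiv ℂ (connection a i) z (Pi.single i 1) =
      ∑ j ∈ Finset.univ.erase i, -(2 * a i * a j) / (z i - z j) ^ 2 := by
  have h1 : ∀ j ∈ Finset.univ.erase i, HasFDerivAt
      (fun z : ι → ℂ => 2 * a i * a j / (z i - z j))
      ((-(2 * a i * a j) / (z i - z j) ^ 2) •
        (ContinuousLinearMap.proj (R := ℂ) (φ := fun _ : ι => ℂ) i -
          ContinuousLinearMap.proj (R := ℂ) (φ := fun _ : ι => ℂ) j)) z := by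
    intro j hj
    have hne : z i - z j ≠ 0 := sub_ne_zero.2 fun e => Finset.ne_of_mem_erase hj (hz e).symm
    have h2 := (hasDerivAt_inv hne).comp_hasFDerivAt z
      ((hasFDerivAt_proj i z).sub (hasFDerivAt_proj j z))
    have h3 := h2.const_mul (2 * a i * a j)
    refine (h3.congr_fderiv ?_).congr_of_eventuallyEq (Filter.Eventually.of_forall fun w => ?_)
    · rw [smul_smul]
      congr 1
      ring
    · simp [div_eq_mul_inv]
  have h2 := HasFDerivAt.fun_sum h1
  have h3 : fderiv ℂ (connection a i) z = _ := h2.fderiv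
  rw [h3, sum_apply]
  apply Finset.sum_congr rfl
  intro j hj
  simp [Pi.single_eq_of_ne (Finset.ne_of_mem_erase hj)]

lemma fderiv_Uminus (a z : ι → ℂ) {μ : ℕ+ →₀ ℕ} {M : ℕ} (hM : level μ ≤ M) (i : ι) :
    fderiv ℂ (fun z => MvPowerSeries.coeff μ (Uminus a z)) z (Pi.single i 1) =
      a i * ∑ n ∈ Finset.range M, z i ^ n *
        MvPowerSeries.coeff μ (MvPowerSeries.X n.succPNat * Uminus a z) := by
  rw [(hasFDerivAt_Uminus a z hM).fderiv, sum_apply, Finset.mul_sum]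
  apply Finset.sum_congr rfl
  intro n _
  rw [smul_apply, powerSumDeriv_single, smul_eq_mul]
  ring

lemma fderiv_fderiv_Uminus (a z : ι → ℂ) {μ : ℕ+ →₀ ℕ} {M : ℕ} (hM : level μ ≤ M) (i : ι) :
    fderiv ℂ (fun z => a i * ∑ n ∈ Finset.range M, z i ^ n *
        MvPowerSeries.coeff μ (MvPowerSeries.X n.succPNat * Uminus a z)) z (Pi.single i 1) =
      a i * (∑ n ∈ Finset.range M, (n : ℂ) * z i ^ (n - 1) *
        MvPowerSeries.coeff μ (MvPowerSeries.X n.succPNat * Uminus a z)) +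
      a i ^ 2 * ∑ p ∈ Finset.range M, ∑ q ∈ Finset.range M, z i ^ p * z i ^ q *
        MvPowerSeries.coeff μ (MvPowerSeries.X p.succPNat *
          (MvPowerSeries.X q.succPNat * Uminus a z)) := by
  have h1 := (HasFDerivAt.fun_sum fun n (_ : n ∈ Finset.range M) =>
    ((hasFDerivAt_proj i z).pow n).mul
      (hasFDerivAt_X_mul_Uminus a z hM n.succPNat)).const_mul (a i)
  have h2 : fderiv ℂ (fun z => a i * ∑ n ∈ Finset.range M, z i ^ n *
      MvPowerSeries.coeff μ (MvPowerSeries.X n.succPNat * Uminus a z)) z = _ := h1.fderiv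
  rw [h2, smul_apply, sum_apply, smul_eq_mul, sq, mul_assoc, ← mul_add]
  congr 1
  rw [Finset.mul_sum, ← Finset.sum_add_distrib]
  apply Finset.sum_congr rfl
  intro n _
  rw [add_apply, smul_apply, smul_apply, sum_apply, smul_apply]
  simp only [smul_apply, powerSumDeriv_single, smul_eq_mul, Finset.mul_sum]
  rw [add_comm]
  congr 1
  · simp
    ring
  · apply Finset.sum_congr rfl
    intro m _
    ring

/-- The null field equation for the Coulomb gas vector: at a point of charge `α` with
`κ α² = 1`, the second order differential operator acts as `2 ∑_k z^{-2-k} L_k`. -/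
theorem nabla_nabla_Uminus (a z : ι → ℂ) (hz : Function.Injective z) (κ α₀ : ℂ) (i : ι)
    (hκ : κ * a i ^ 2 = 1) (hα₀ : 4 * α₀ = κ * a i - 4 * a i)
    {μ : ℕ+ →₀ ℕ} {M : ℕ} (hM : level μ ≤ M) :
    κ / 2 * nabla a i (nabla a i fun z => MvPowerSeries.coeff μ (Uminus a z)) z +
      ∑ j ∈ Finset.univ.erase i,
        (2 / (z j - z i) * nabla a j (fun z => MvPowerSeries.coeff μ (Uminus a z)) z -
          2 * (a j ^ 2 - 2 * α₀ * a j) / (z j - z i) ^ 2 *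
            MvPowerSeries.coeff μ (Uminus a z)) =
    2 * ∑ j ∈ Finset.range M, z i ^ j *
      MvPowerSeries.coeff μ (virasoro (∑ k, a k) α₀ (-2 - (j : ℤ)) (Uminus a z)) := by
  have hn : ∀ j, nabla a j (fun z => MvPowerSeries.coeff μ (Uminus a z)) = fun z =>
      a j * (∑ n ∈ Finset.range M, z j ^ n *
        MvPowerSeries.coeff μ (MvPowerSeries.X n.succPNat * Uminus a z)) +
      connection a j z * MvPowerSeries.coeff μ (Uminus a z) := by
    intro j
    funext z
    rw [nabla, fderiv_Uminus a z hM]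
  have hd1 : DifferentiableAt ℂ (fun z => a i * ∑ n ∈ Finset.range M, z i ^ n *
        MvPowerSeries.coeff μ (MvPowerSeries.X n.succPNat * Uminus a z)) z :=
    ((HasFDerivAt.fun_sum fun n (_ : n ∈ Finset.range M) =>
      ((hasFDerivAt_proj i z).pow n).mul
      (hasFDerivAt_X_mul_Uminus a z hM n.succPNat)).const_mul (a i)).differentiableAt
  have hd2 : DifferentiableAt ℂ (connection a i) z :=
    (analyticOnNhd_connection a i z hz).differentiableAt
  have hd3 : DifferentiableAt ℂ (fun z => MvPowerSeries.coeff μ (Uminus a z)) z :=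
    (analyticOnNhd_Uminus a μ z hz).differentiableAt
  have hnn : nabla a i (nabla a i fun z => MvPowerSeries.coeff μ (Uminus a z)) z =
      a i * (∑ n ∈ Finset.range M, (n : ℂ) * z i ^ (n - 1) *
        MvPowerSeries.coeff μ (MvPowerSeries.X n.succPNat * Uminus a z)) +
      a i ^ 2 * (∑ p ∈ Finset.range M, ∑ q ∈ Finset.range M, z i ^ p * z i ^ q *
        MvPowerSeries.coeff μ (MvPowerSeries.X p.succPNat *
          (MvPowerSeries.X q.succPNat * Uminus a z))) +
      (connection a i z * (a i * ∑ n ∈ Finset.range M, z i ^ n *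
        MvPowerSeries.coeff μ (MvPowerSeries.X n.succPNat * Uminus a z)) +
      MvPowerSeries.coeff μ (Uminus a z) *
        ∑ j ∈ Finset.univ.erase i, -(2 * a i * a j) / (z i - z j) ^ 2) +
      connection a i z * (a i * (∑ n ∈ Finset.range M, z i ^ n *
        MvPowerSeries.coeff μ (MvPowerSeries.X n.succPNat * Uminus a z)) +
      connection a i z * MvPowerSeries.coeff μ (Uminus a z)) := by
    rw [nabla, hn, fderiv_fun_add hd1 (hd2.fun_mul hd3), fderiv_fun_mul hd2 hd3, add_apply,
      add_apply, smul_apply, smul_apply, fderiv_fderiv_Uminus a z hM, fderiv_Uminus a z hM,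
      fderiv_connection_self a z hz, smul_eq_mul, smul_eq_mul]
  have hnull := connection_null a z hz κ α₀ i hκ hα₀
  have hvir := sum_virasoro_Uminus a z hz α₀ i hM
  set c : ℕ → ℂ := fun n => MvPowerSeries.coeff μ (MvPowerSeries.X n.succPNat * Uminus a z)
  set S : ι → ℂ := fun k => ∑ n ∈ Finset.range M, z k ^ n *
    MvPowerSeries.coeff μ (MvPowerSeries.X n.succPNat * Uminus a z) with hS
  have hconn : connection a i z = 2 * a i * ∑ j ∈ Finset.univ.erase i, a j / (z i - z j) := by
    rw [connection, Finset.mul_sum]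
    apply Finset.sum_congr rfl
    intro j _
    ring
  have hlin : ∑ j ∈ Finset.univ.erase i,
        (2 / (z j - z i) * nabla a j (fun z => MvPowerSeries.coeff μ (Uminus a z)) z -
          2 * (a j ^ 2 - 2 * α₀ * a j) / (z j - z i) ^ 2 *
            MvPowerSeries.coeff μ (Uminus a z)) =
      -2 * (∑ j ∈ Finset.univ.erase i, a j / (z i - z j) * S j) +
      (∑ j ∈ Finset.univ.erase i, (2 / (z j - z i) * connection a j z -
        2 * (a j ^ 2 - 2 * α₀ * a j) / (z j - z i) ^ 2)) *
          MvPowerSeries.coeff μ (Uminus a z) := by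
    rw [Finset.sum_mul, Finset.mul_sum, ← Finset.sum_add_distrib]
    apply Finset.sum_congr rfl
    intro j _
    rw [hn j]
    have : z i - z j = -(z j - z i) := by ring
    rw [this, div_neg]
    ring
  have hvirS : ∑ k ∈ Finset.univ.erase i, a k / (z i - z k) * (S i - S k) =
      (∑ j ∈ Finset.univ.erase i, a j / (z i - z j)) * S i -
        ∑ j ∈ Finset.univ.erase i, a j / (z i - z j) * S j := by
    rw [Finset.sum_mul, ← Finset.sum_sub_distrib]
    apply Finset.sum_congr rfl
    intro j _
    ring
  rw [hnn, hlin, hvir, hvirS]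
  -- Terms with two creators match by `κ a_i² = 1`; those with `n z_i^{n-1}` by `κ a_i / 2 = 2 (a_i
  -- + α₀)`, which is `hα₀`; those without creators form the rational identity `hnull`.
  linear_combination MvPowerSeries.coeff μ (Uminus a z) * hnull +
    (∑ p ∈ Finset.range M, ∑ q ∈ Finset.range M, z i ^ p * z i ^ q *
        MvPowerSeries.coeff μ (MvPowerSeries.X p.succPNat *
          (MvPowerSeries.X q.succPNat * Uminus a z))) / 2 * hκ -
    (1 / 2 * ∑ n ∈ Finset.range M, (n : ℂ) * z i ^ (n - 1) *
        MvPowerSeries.coeff μ (MvPowerSeries.X n.succPNat * Uminus a z)) * hα₀ +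
    (κ * a i * S i) * hconn + 2 * (∑ j ∈ Finset.univ.erase i, a j / (z i - z j)) * S i * hκ

end Nabla

/-! ### Calculus along the screening contours -/

section Calculus

/-- By continuity the imaginary part of `l x - l e` stays below `π` near `e`, so there `l = l e +
Log (g / g e)` with the principal branch. -/
lemma hasFDerivAt_of_exp {E : Type*} [NormedAddCommGroup E] [NormedSpace ℝ E] {l g : E → ℂ}
    {g' : E →L[ℝ] ℂ} {e : E} (hl : ContinuousAt l e)
    (hexp : ∀ᶠ x in nhds e, Complex.exp (l x) = g x)
    (hg : HasFDerivAt g g' e) : HasFDerivAt l ((g e)⁻¹ • g') e := by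
  have he : Complex.exp (l e) = g e := hexp.self_of_nhds
  have hge : g e ≠ 0 := he ▸ Complex.exp_ne_zero _
  have h1 : HasFDerivAt (fun x => g x * (g e)⁻¹) ((g e)⁻¹ • g') e := hg.mul_const _
  have h2 : g e * (g e)⁻¹ ∈ Complex.slitPlane := by
    rw [mul_inv_cancel₀ hge]; exact Complex.one_mem_slitPlane
  have h3 := (Complex.hasDerivAt_log h2).comp_hasFDerivAt e h1
  have h4 := h3.const_add (l e)
  rw [mul_inv_cancel₀ hge, inv_one, one_smul] at h4
  refine h4.congr_of_eventuallyEq ?_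
  have h5 : ∀ᶠ x in nhds e, ‖l x - l e‖ < Real.pi := by
    have : Filter.Tendsto (fun x => ‖l x - l e‖) (nhds e) (nhds 0) := by
      have := (hl.sub continuousAt_const).norm (f := fun x => l x - l e)
      simpa [ContinuousAt] using this
    exact this.eventually (gt_mem_nhds Real.pi_pos)
  filter_upwards [h5, hexp] with x hx hx2
  have h6 : |(l x - l e).im| < Real.pi := (Complex.abs_im_le_norm _).trans_lt hx
  rw [abs_lt] at h6
  have h7 : g x * (g e)⁻¹ = Complex.exp (l x - l e) := by
    rw [Complex.exp_sub, hx2, he, div_eq_mul_inv]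
  simp only [Function.comp]
  rw [h7, Complex.log_exp h6.1 h6.2.le]
  ring

/-- Each unordered pair is split into its two ordered ones; the diagonal terms on the right are
quotients by zero and hence vanish. -/
lemma sum_sum_Ioi_sub_div {n : ℕ} (y v : Fin n → ℂ) :
    ∑ i, ∑ j ∈ Finset.Ioi i, (y j - y i)⁻¹ * (v j - v i) = ∑ i, ∑ j, v i / (y i - y j) := by
  have h := Finset.sum_sum_Ioi_add_eq_sum_sum_off_diag (fun j i : Fin n => v i / (y i - y j))
  have h2 : ∀ i, ∑ j, v i / (y i - y j) = ∑ j ∈ {i}ᶜ, v i / (y i - y j) := by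
    intro i
    symm
    apply Finset.sum_subset (Finset.subset_univ _)
    intro j _ hj
    have : j = i := by simpa using hj
    rw [this, sub_self, div_zero]
  simp only [h2]
  rw [← h]
  apply Finset.sum_congr rfl
  intro i _
  apply Finset.sum_congr rfl
  intro j _
  rw [← neg_sub (y j) (y i), div_neg, ← div_eq_inv_mul]
  ring

lemma connection_eq_sum {ι : Type*} [Fintype ι] [DecidableEq ι] (a z : ι → ℂ) (i : ι) :
    connection a i z = ∑ j, 2 * a i * a j / (z i - z j) := by
  rw [connection]
  apply Finset.sum_subset (Finset.subset_univ _)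
  intro j _ hj
  have : j = i := by simpa using hj
  rw [this, sub_self, div_zero]

open Filter in
/-- The divergence theorem on the unit box, for functions which agree on opposite faces. -/
lemma integral_divergence_eq_zero {L : ℕ} (f g : Fin L → (Fin L → ℝ) → ℂ)
    (f' : Fin L → (Fin L → ℝ) → (Fin L → ℝ) →L[ℝ] ℂ)
    (hf : ∀ R, ContinuousOn (f R) (Icc 0 1))
    (hd : ∀ t, (∀ R, t R ∈ Ioo (0 : ℝ) 1) → ∀ R, HasFDerivAt (f R) (f' R t) t)
    (hg : ∀ t, (∀ R, t R ∈ Ioo (0 : ℝ) 1) → ∀ R, f' R t (Pi.single R 1) = g R t)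
    (hgc : ∀ R, ContinuousOn (g R) (Icc 0 1))
    (hper : ∀ t ∈ Icc (0 : Fin L → ℝ) 1, ∀ R,
      f R (Function.update t R 0) = f R (Function.update t R 1)) :
    ∫ t in Icc (0 : Fin L → ℝ) 1, ∑ R, g R t = 0 := by
  classical
  cases L with
  | zero => simp
  | succ n =>
    -- The derivative is known only in the open box. Elsewhere it is replaced by a functional with
    -- the value `g R t` in direction `R`, so that the divergence equals `∑ R, g R t` everywhere and
    -- is integrable by continuity.
    set F' : Fin (n + 1) → (Fin (n + 1) → ℝ) → (Fin (n + 1) → ℝ) →L[ℝ] ℂ := fun R t =>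
      if ∀ R, t R ∈ Ioo (0 : ℝ) 1 then f' R t else
        g R t • (Complex.ofRealCLM.comp (ContinuousLinearMap.proj (R := ℝ) (φ := fun _ => ℝ) R))
      with hF'
    have hF'g : ∀ R t, F' R t (Pi.single R 1) = g R t := by
      intro R t
      simp only [hF']
      split_ifs with h
      · exact hg t h R
      · simp
    have hint : IntegrableOn (fun t => ∑ R, F' R t (Pi.single R 1)) (Icc 0 1) := by
      simp only [hF'g]
      exact (continuousOn_finsetSum _ fun R _ => hgc R).integrableOn_compact isCompact_Icc
    have := integral_divergence_of_hasFDerivAt_off_countable' (0 : Fin (n + 1) → ℝ) 1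
      zero_le_one f F' ∅ countable_empty hf (by
        intro t ht R
        have ht' : ∀ R, t R ∈ Ioo (0 : ℝ) 1 := fun R => ht.1 R (mem_univ R)
        simp only [hF', if_pos ht']
        exact hd t ht' R) hint
    simp only [hF'g] at this
    rw [this]
    apply Finset.sum_eq_zero
    intro R _
    rw [sub_eq_zero]
    apply setIntegral_congr_fun measurableSet_Icc
    intro x hx
    have h0 : R.insertNth (0 : ℝ) x ∈ Icc (0 : Fin (n + 1) → ℝ) 1 := by
      constructor
      · intro S
        refine Fin.succAboveCases R ?_ (fun i => ?_) S
        · simp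
        · simpa using hx.1 i
      · intro S
        refine Fin.succAboveCases R ?_ (fun i => ?_) S
        · simp
        · simpa using hx.2 i
    have := hper _ h0 R
    rw [Fin.update_insertNth, Fin.update_insertNth] at this
    exact this.symm

end Calculus

/-! ### The logarithmic derivative of the integrand -/

section MasterDerivative

variable {N L : ℕ}

/-- The charges: `α = 1/√κ` at the `x_I` and `α_- = -2/√κ` at the screening charges. -/
def charges (N L : ℕ) (κ : ℝ) : Fin N ⊕ Fin L → ℂ :=
  Sum.elim (fun _ : Fin N => 1 / ((√κ : ℝ) : ℂ)) (fun _ : Fin L => -2 / ((√κ : ℝ) : ℂ))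

lemma ofReal_sqrt_mul_self {κ : ℝ} (hκ : 0 < κ) : ((√κ : ℝ) : ℂ) * ((√κ : ℝ) : ℂ) = κ := by
  rw [← Complex.ofReal_mul, Real.mul_self_sqrt hκ.le]

/-- The logarithmic derivative of the Coulomb gas integrand. -/
lemma hasFDerivAt_integrand {κ : ℝ} (hκ : 0 < κ) {E : Type*} [NormedAddCommGroup E]
    [NormedSpace ℝ E] (Y : Fin N ⊕ Fin L → E → ℂ) (Y' : Fin N ⊕ Fin L → E →L[ℝ] ℂ) (e : E)
    (hY : ∀ i, HasFDerivAt (Y i) (Y' i) e)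
    (lXX : Fin N → Fin N → E → ℂ) (lWW : Fin L → Fin L → E → ℂ) (lXW : Fin N → Fin L → E → ℂ)
    (hXX : ∀ I J, I < J → ContinuousAt (lXX I J) e)
    (hWW : ∀ I J, I < J → ContinuousAt (lWW I J) e)
    (hXW : ∀ I J, ContinuousAt (lXW I J) e)
    (eXX : ∀ I J, I < J → ∀ᶠ x in nhds e,
      Complex.exp (lXX I J x) = Y (Sum.inl J) x - Y (Sum.inl I) x)
    (eWW : ∀ I J, I < J → ∀ᶠ x in nhds e,
      Complex.exp (lWW I J x) = Y (Sum.inr J) x - Y (Sum.inr I) x)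
    (eXW : ∀ I J, ∀ᶠ x in nhds e,
      Complex.exp (lXW I J x) = Y (Sum.inl I) x - Y (Sum.inr J) x) :
    HasFDerivAt (fun x => Complex.exp
      ((2 / κ : ℂ) * (∑ I, ∑ J ∈ Finset.Ioi I, lXX I J x) +
      (8 / κ : ℂ) * (∑ R, ∑ S ∈ Finset.Ioi R, lWW R S x) -
      (4 / κ : ℂ) * (∑ I, ∑ R, lXW I R x)))
      (Complex.exp
      ((2 / κ : ℂ) * (∑ I, ∑ J ∈ Finset.Ioi I, lXX I J e) +
      (8 / κ : ℂ) * (∑ R, ∑ S ∈ Finset.Ioi R, lWW R S e) -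
      (4 / κ : ℂ) * (∑ I, ∑ R, lXW I R e)) •
        ∑ i, connection (charges N L κ) i (fun i => Y i e) • Y' i) e := by
  have h1 := HasFDerivAt.fun_sum fun I (_ : I ∈ (Finset.univ : Finset (Fin N))) =>
    HasFDerivAt.fun_sum fun J (hJ : J ∈ Finset.Ioi I) =>
      hasFDerivAt_of_exp (hXX I J (Finset.mem_Ioi.1 hJ)) (eXX I J (Finset.mem_Ioi.1 hJ))
        ((hY (Sum.inl J)).sub (hY (Sum.inl I)))
  have h2 := HasFDerivAt.fun_sum fun I (_ : I ∈ (Finset.univ : Finset (Fin L))) =>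
    HasFDerivAt.fun_sum fun J (hJ : J ∈ Finset.Ioi I) =>
      hasFDerivAt_of_exp (hWW I J (Finset.mem_Ioi.1 hJ)) (eWW I J (Finset.mem_Ioi.1 hJ))
        ((hY (Sum.inr J)).sub (hY (Sum.inr I)))
  have h3 := HasFDerivAt.fun_sum fun I (_ : I ∈ (Finset.univ : Finset (Fin N))) =>
    HasFDerivAt.fun_sum fun J (_ : J ∈ (Finset.univ : Finset (Fin L))) =>
      hasFDerivAt_of_exp (hXW I J) (eXW I J) ((hY (Sum.inl I)).sub (hY (Sum.inr J)))
  have h4 := ((h1.const_mul (2 / κ : ℂ)).add (h2.const_mul (8 / κ : ℂ))).sub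
    (h3.const_mul (4 / κ : ℂ))
  have h5 := (Complex.hasDerivAt_exp _).comp_hasFDerivAt e h4
  refine h5.congr_fderiv ?_
  refine congrArg _ ?_
  ext v
  have e1 := sum_sum_Ioi_sub_div (fun I => Y (Sum.inl I) e) (fun I => Y' (Sum.inl I) v)
  have e2 := sum_sum_Ioi_sub_div (fun I => Y (Sum.inr I) e) (fun I => Y' (Sum.inr I) v)
  simp only [add_apply, sub_apply, smul_apply, sum_apply, smul_eq_mul]
  rw [e1, e2, Fintype.sum_sum_type]
  simp only [connection_eq_sum, Fintype.sum_sum_type, charges, Sum.elim_inl, Sum.elim_inr]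
  have hs := ofReal_sqrt_mul_self hκ
  have hs0 : ((√κ : ℝ) : ℂ) ≠ 0 := by
    rw [Complex.ofReal_ne_zero]; exact (Real.sqrt_pos.2 hκ).ne'
  have hk0 : (κ : ℂ) ≠ 0 := by rw [Complex.ofReal_ne_zero]; exact hκ.ne'
  have c1 : 2 * (1 / ((√κ : ℝ) : ℂ)) * (1 / ((√κ : ℝ) : ℂ)) = 2 / κ := by
    rw [← hs]; field_simp
  have c2 : 2 * (1 / ((√κ : ℝ) : ℂ)) * (-2 / ((√κ : ℝ) : ℂ)) = -(4 / κ) := by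
    rw [← hs]; field_simp; ring
  have c3 : 2 * (-2 / ((√κ : ℝ) : ℂ)) * (1 / ((√κ : ℝ) : ℂ)) = -(4 / κ) := by
    rw [← hs]; field_simp; ring
  have c4 : 2 * (-2 / ((√κ : ℝ) : ℂ)) * (-2 / ((√κ : ℝ) : ℂ)) = 8 / κ := by
    rw [← hs]; field_simp; ring
  simp only [c1, c2, c3, c4, add_mul, Finset.sum_add_distrib, Finset.sum_mul, Finset.mul_sum]
  -- A mixed factor contributes to the connection at both of its points; the reversed difference
  -- accounts for the sign.
  have e3 : ∑ I, ∑ R, (4 / κ : ℂ) * ((Y (Sum.inl I) e - Y (Sum.inr R) e)⁻¹ *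
      (Y' (Sum.inl I) v - Y' (Sum.inr R) v)) =
      -(∑ I, ∑ R, -(4 / κ : ℂ) / (Y (Sum.inl I) e - Y (Sum.inr R) e) * Y' (Sum.inl I) v) -
      ∑ R, ∑ I, -(4 / κ : ℂ) / (Y (Sum.inr R) e - Y (Sum.inl I) e) * Y' (Sum.inr R) v := by
    rw [Finset.sum_comm (s := (Finset.univ : Finset (Fin L))), ← Finset.sum_neg_distrib,
      ← Finset.sum_sub_distrib]
    apply Finset.sum_congr rfl
    intro I _
    rw [← Finset.sum_neg_distrib, ← Finset.sum_sub_distrib]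
    apply Finset.sum_congr rfl
    intro R _
    rw [← neg_sub (Y (Sum.inl I) e) (Y (Sum.inr R) e), div_neg]
    ring
  rw [e3]
  have e4 : ∀ (c : ℂ) {n : ℕ} (y w : Fin n → ℂ), ∑ i, ∑ j, c * (w i / (y i - y j)) =
      ∑ i, ∑ j, c / (y i - y j) * w i := by
    intro c n y w
    apply Finset.sum_congr rfl
    intro i _
    apply Finset.sum_congr rfl
    intro j _
    ring
  rw [e4 (2 / κ) (fun I => Y (Sum.inl I) e), e4 (8 / κ) (fun I => Y (Sum.inr I) e)]
  ring

/-- The covariant derivative computes derivatives of `h P` along any family of points. -/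
lemma hasFDerivAt_mul_comp {ι E : Type*} [Fintype ι] [DecidableEq ι] [NormedAddCommGroup E]
    [NormedSpace ℝ E] (a : ι → ℂ) {H : E → ℂ} {Y : ι → E → ℂ} {Y' : ι → E →L[ℝ] ℂ} {e : E}
    (hY : ∀ i, HasFDerivAt (Y i) (Y' i) e)
    (hH : HasFDerivAt H (H e • ∑ i, connection a i (fun i => Y i e) • Y' i) e)
    {P : (ι → ℂ) → ℂ} (hP : DifferentiableAt ℂ P (fun i => Y i e)) :
    HasFDerivAt (fun x => H x * P (fun i => Y i x))
      (∑ i, (H e * nabla a i P (fun i => Y i e)) • Y' i) e := by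
  have h1 : HasFDerivAt (fun x => fun i => Y i x) (ContinuousLinearMap.pi Y') e :=
    hasFDerivAt_pi.2 hY
  have h2 : HasFDerivAt P (fderiv ℂ P (fun i => Y i e)) (fun i => Y i e) := hP.hasFDerivAt
  have h3 := (h2.restrictScalars ℝ).comp e h1
  refine (hH.mul h3).congr_fderiv ?_
  ext v
  have h4 : fderiv ℂ P (fun i => Y i e) (fun i => Y' i v) =
      ∑ i, Y' i v * fderiv ℂ P (fun i => Y i e) (Pi.single i 1) := by
    conv_lhs => rw [pi_eq_sum_univ' (fun i => Y' i v)]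
    rw [map_sum]
    apply Finset.sum_congr rfl
    intro i _
    rw [map_smul, smul_eq_mul]
  simp only [add_apply, smul_apply, sum_apply, smul_eq_mul, Function.comp,
    ContinuousLinearMap.comp_apply, ContinuousLinearMap.coe_restrictScalars']
  have h5 : (ContinuousLinearMap.pi Y') v = fun i => Y' i v := rfl
  rw [h5, h4, Finset.mul_sum, Finset.mul_sum, Finset.mul_sum, ← Finset.sum_add_distrib]
  apply Finset.sum_congr rfl
  intro i _
  rw [nabla]
  ring

end MasterDerivative

/-! ### Regularity of the points and of the integrand along the contours -/

namespace Contours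

variable {N L : ℕ} {U : Set (Fin N → ℝ)}

/-- The points `x_I` and `w_R` on the contours. -/
def points (Γ : Contours N L U) (i : Fin N ⊕ Fin L) (x : Fin N → ℝ) (t : Fin L → ℝ) : ℂ :=
  Sum.elim (fun I => (x I : ℂ)) (fun R => Γ.curve x R (t R)) i

/-- The contour of `w_R` as a function of the parameters `x` and of the time. -/
def family (Γ : Contours N L U) (R : Fin L) (p : (Fin N → ℝ) × ℝ) : ℂ := Γ.curve p.1 R p.2

lemma isOpen_domain (hU : IsOpen U) : IsOpen (U ×ˢ (univ : Set ℝ)) := hU.prod isOpen_univ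

variable (Γ : Contours N L U)

lemma contDiffAt_family (hU : IsOpen U) (R : Fin L) {x : Fin N → ℝ} (hx : x ∈ U) (s : ℝ) :
    ContDiffAt ℝ (⊤ : ℕ∞) (Γ.family R) (x, s) :=
  (Γ.smooth R).contDiffAt ((isOpen_domain hU).mem_nhds ⟨hx, mem_univ _⟩)

lemma hasFDerivAt_family (hU : IsOpen U) (R : Fin L) {x : Fin N → ℝ} (hx : x ∈ U) (s : ℝ) :
    HasFDerivAt (Γ.family R) (fderiv ℝ (Γ.family R) (x, s)) (x, s) :=
  ((Γ.contDiffAt_family hU R hx s).differentiableAt (by simp)).hasFDerivAt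

lemma hasDerivAt_curve (hU : IsOpen U) (R : Fin L) {x : Fin N → ℝ} (hx : x ∈ U) (s : ℝ) :
    HasDerivAt (Γ.curve x R) (fderiv ℝ (Γ.family R) (x, s) (0, 1)) s :=
  (Γ.hasFDerivAt_family hU R hx s).comp_hasDerivAt s
    ((hasDerivAt_const s x).prodMk (hasDerivAt_id s))

lemma hasFDerivAt_curve (hU : IsOpen U) (R : Fin L) {x : Fin N → ℝ} (hx : x ∈ U) (s : ℝ) :
    HasFDerivAt (fun x => Γ.curve x R s)
      ((fderiv ℝ (Γ.family R) (x, s)).comp (ContinuousLinearMap.inl ℝ (Fin N → ℝ) ℝ)) x :=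
  HasFDerivAt.comp (g := Γ.family R) (f := fun y : Fin N → ℝ => (y, s)) x
    (Γ.hasFDerivAt_family hU R hx s) (hasFDerivAt_prodMk_left x s)

lemma contDiffOn_fderiv_family (hU : IsOpen U) (R : Fin L) :
    ContDiffOn ℝ (⊤ : ℕ∞) (fderiv ℝ (Γ.family R)) (U ×ˢ univ) :=
  (Γ.smooth R).fderiv_of_isOpen (isOpen_domain hU) (by simp)

lemma hasFDerivAt_fderiv_family (hU : IsOpen U) (R : Fin L) {x : Fin N → ℝ} (hx : x ∈ U) (s : ℝ) :
    HasFDerivAt (fderiv ℝ (Γ.family R)) (fderiv ℝ (fderiv ℝ (Γ.family R)) (x, s)) (x, s) :=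
  (((Γ.contDiffOn_fderiv_family hU R).contDiffAt ((isOpen_domain hU).mem_nhds
    ⟨hx, mem_univ _⟩)).differentiableAt (by simp)).hasFDerivAt

lemma deriv_curve (hU : IsOpen U) (R : Fin L) {x : Fin N → ℝ} (hx : x ∈ U) (s : ℝ) :
    deriv (Γ.curve x R) s = fderiv ℝ (Γ.family R) (x, s) (0, 1) :=
  (Γ.hasDerivAt_curve hU R hx s).deriv

lemma fderiv_fderiv_family_symm (hU : IsOpen U) (R : Fin L) {x : Fin N → ℝ} (hx : x ∈ U) (s : ℝ)
    (v w : (Fin N → ℝ) × ℝ) : fderiv ℝ (fderiv ℝ (Γ.family R)) (x, s) v w =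
      fderiv ℝ (fderiv ℝ (Γ.family R)) (x, s) w v :=
  ((Γ.contDiffAt_family hU R hx s).isSymmSndFDerivAt (by
    simpa using (WithTop.coe_le_coe.2 (le_top : (2 : ℕ∞) ≤ ⊤)))).eq v w

/-- The derivatives of the points along `x`. -/
def pointsDerivX (i : Fin N ⊕ Fin L) (p : (Fin N → ℝ) × (Fin L → ℝ)) : (Fin N → ℝ) →L[ℝ] ℂ :=
  Sum.elim (fun I => Complex.ofRealCLM.comp (ContinuousLinearMap.proj (R := ℝ) (φ := fun _ => ℝ) I))
    (fun R => (fderiv ℝ (Γ.family R) (p.1, p.2 R)).comp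
      (ContinuousLinearMap.inl ℝ (Fin N → ℝ) ℝ)) i

/-- The derivatives of the points along the times. -/
def pointsDerivT (i : Fin N ⊕ Fin L) (p : (Fin N → ℝ) × (Fin L → ℝ)) : (Fin L → ℝ) →L[ℝ] ℂ :=
  Sum.elim (fun _ => 0)
    (fun R => fderiv ℝ (Γ.family R) (p.1, p.2 R) (0, 1) •
      Complex.ofRealCLM.comp (ContinuousLinearMap.proj (R := ℝ) (φ := fun _ => ℝ) R)) i

lemma hasFDerivAt_points_x (hU : IsOpen U) (i : Fin N ⊕ Fin L) {x : Fin N → ℝ} (hx : x ∈ U)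
    (t : Fin L → ℝ) : HasFDerivAt (fun x => Γ.points i x t) (Γ.pointsDerivX i (x, t)) x := by
  rcases i with I | R
  · exact Complex.ofRealCLM.hasFDerivAt.comp x
      (ContinuousLinearMap.proj (R := ℝ) (φ := fun _ => ℝ) I).hasFDerivAt
  · exact Γ.hasFDerivAt_curve hU R hx (t R)

lemma hasFDerivAt_points_t (hU : IsOpen U) (i : Fin N ⊕ Fin L) {x : Fin N → ℝ} (hx : x ∈ U)
    (t : Fin L → ℝ) : HasFDerivAt (fun t => Γ.points i x t) (Γ.pointsDerivT i (x, t)) t := by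
  rcases i with I | R
  · exact hasFDerivAt_const _ _
  · have h1 : HasFDerivAt (fun t : Fin L → ℝ => t R)
        (ContinuousLinearMap.proj (R := ℝ) (φ := fun _ => ℝ) R) t :=
      (ContinuousLinearMap.proj (R := ℝ) (φ := fun _ => ℝ) R).hasFDerivAt
    refine (HasFDerivAt.comp (g := Γ.curve x R) t
      (Γ.hasDerivAt_curve hU R hx (t R)).hasFDerivAt h1).congr_fderiv ?_
    ext v
    simp [pointsDerivT, mul_comm]

lemma mem_Icc_apply {t : Fin L → ℝ} (ht : t ∈ Icc (0 : Fin L → ℝ) 1) (R : Fin L) :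
    t R ∈ Icc (0 : ℝ) 1 := ⟨ht.1 R, ht.2 R⟩

/-- The differences involving a contour are exponentials of the chosen logarithms, hence nonzero. -/
lemma points_mem (hUinj : ∀ x ∈ U, Function.Injective x) {x : Fin N → ℝ} (hx : x ∈ U)
    {t : Fin L → ℝ} (ht : t ∈ Icc (0 : Fin L → ℝ) 1) :
    (fun i => Γ.points i x t) ∈ configurations (Fin N ⊕ Fin L) := by
  have hWX : ∀ I R, Γ.points (Sum.inl I) x t ≠ Γ.points (Sum.inr R) x t := by
    intro I R h
    have := Γ.exp_logXW I R x hx (t R) (mem_Icc_apply ht R)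
    exact Complex.exp_ne_zero _ (this.trans (sub_eq_zero.2 h))
  have hWW : ∀ R S, R < S → Γ.points (Sum.inr S) x t ≠ Γ.points (Sum.inr R) x t := by
    intro R S hRS h
    have := Γ.exp_logWW R S hRS x hx (t R) (mem_Icc_apply ht R) (t S) (mem_Icc_apply ht S)
    exact Complex.exp_ne_zero _ (this.trans (sub_eq_zero.2 h))
  rintro (I | R) (J | S) h
  · have : x I = x J := by exact_mod_cast (show ((x I : ℝ) : ℂ) = x J from h)
    rw [hUinj x hx this]
  · exact absurd h (hWX I S)
  · exact absurd h.symm (hWX J R)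
  · rcases lt_trichotomy R S with hRS | hRS | hRS
    · exact absurd h.symm (hWW R S hRS)
    · rw [hRS]
    · exact absurd h (hWW S R hRS)

lemma hasFDerivAt_h_x (hU : IsOpen U) {κ : ℝ} (hκ : 0 < κ) {x : Fin N → ℝ} (hx : x ∈ U)
    {t : Fin L → ℝ} (ht : t ∈ Icc (0 : Fin L → ℝ) 1) :
    HasFDerivAt (fun x => Γ.h κ x t) (Γ.h κ x t • ∑ i,
      connection (charges N L κ) i (fun i => Γ.points i x t) • Γ.pointsDerivX i (x, t)) x := by
  have hnhds : ∀ᶠ y in nhds x, y ∈ U := hU.mem_nhds hx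
  apply hasFDerivAt_integrand hκ (fun i x => Γ.points i x t) _ x
    (fun i => Γ.hasFDerivAt_points_x hU i hx t) Γ.logXX (fun R S x => Γ.logWW R S x (t R) (t S))
    (fun I R x => Γ.logXW I R x (t R))
  · exact fun I J hIJ => (Γ.logXX_continuous I J hIJ).continuousAt (hU.mem_nhds hx)
  · intro R S hRS
    have : ContinuousOn (fun x => Γ.logWW R S x (t R) (t S)) U :=
      (Γ.logWW_continuous R S hRS).comp (f := fun x => (x, t R, t S)) (by fun_prop)
        fun y hy => ⟨hy, mem_Icc_apply ht R, mem_Icc_apply ht S⟩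
    exact this.continuousAt (hU.mem_nhds hx)
  · intro I R
    have : ContinuousOn (fun x => Γ.logXW I R x (t R)) U :=
      (Γ.logXW_continuous I R).comp (f := fun x => (x, t R)) (by fun_prop)
        fun y hy => ⟨hy, mem_Icc_apply ht R⟩
    exact this.continuousAt (hU.mem_nhds hx)
  · exact fun I J hIJ => hnhds.mono fun y hy => Γ.exp_logXX I J hIJ y hy
  · exact fun R S hRS => hnhds.mono fun y hy =>
      Γ.exp_logWW R S hRS y hy _ (mem_Icc_apply ht R) _ (mem_Icc_apply ht S)
  · exact fun I R => hnhds.mono fun y hy => Γ.exp_logXW I R y hy _ (mem_Icc_apply ht R)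

/-- The logarithms are controlled on the closed box only, so the derivative in `t` is taken in its
interior, which suffices for the divergence theorem. -/
lemma hasFDerivAt_h_t (hU : IsOpen U) {κ : ℝ} (hκ : 0 < κ) {x : Fin N → ℝ} (hx : x ∈ U)
    {t : Fin L → ℝ} (ht : ∀ R, t R ∈ Ioo (0 : ℝ) 1) :
    HasFDerivAt (fun t => Γ.h κ x t) (Γ.h κ x t • ∑ i,
      connection (charges N L κ) i (fun i => Γ.points i x t) • Γ.pointsDerivT i (x, t)) t := by
  have hnhds : ∀ R, ∀ᶠ s : Fin L → ℝ in nhds t, s R ∈ Icc (0 : ℝ) 1 := fun R =>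
    (continuous_apply R).continuousAt.eventually_mem (Icc_mem_nhds (ht R).1 (ht R).2)
  apply hasFDerivAt_integrand hκ (fun i t => Γ.points i x t) _ t
    (fun i => Γ.hasFDerivAt_points_t hU i hx t) (fun I J _ => Γ.logXX I J x)
    (fun R S t => Γ.logWW R S x (t R) (t S)) (fun I R t => Γ.logXW I R x (t R))
  · exact fun I J _ => continuousAt_const
  · intro R S hRS
    have : ContinuousOn (fun s : ℝ × ℝ => Γ.logWW R S x s.1 s.2) (Icc 0 1 ×ˢ Icc 0 1) :=
      (Γ.logWW_continuous R S hRS).comp (f := fun s : ℝ × ℝ => (x, s.1, s.2)) (by fun_prop)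
        fun y hy => ⟨hx, hy.1, hy.2⟩
    have h2 : ContinuousAt (fun s : ℝ × ℝ => Γ.logWW R S x s.1 s.2) (t R, t S) :=
      this.continuousAt (prod_mem_nhds (Icc_mem_nhds (ht R).1 (ht R).2)
        (Icc_mem_nhds (ht S).1 (ht S).2))
    exact h2.comp (f := fun t : Fin L → ℝ => (t R, t S)) (by fun_prop)
  · intro I R
    have : ContinuousOn (fun s : ℝ => Γ.logXW I R x s) (Icc 0 1) :=
      (Γ.logXW_continuous I R).comp (f := fun s : ℝ => (x, s)) (by fun_prop)
        fun y hy => ⟨hx, hy⟩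
    have h2 : ContinuousAt (fun s : ℝ => Γ.logXW I R x s) (t R) :=
      this.continuousAt (Icc_mem_nhds (ht R).1 (ht R).2)
    exact h2.comp (f := fun t : Fin L → ℝ => t R) (continuous_apply R).continuousAt
  · exact fun I J hIJ => Filter.Eventually.of_forall fun _ => Γ.exp_logXX I J hIJ x hx
  · exact fun R S hRS => ((hnhds R).and (hnhds S)).mono fun s hs =>
      Γ.exp_logWW R S hRS x hx _ hs.1 _ hs.2
  · exact fun I R => (hnhds R).mono fun s hs => Γ.exp_logXW I R x hx _ hs

lemma continuousOn_h (κ : ℝ) : ContinuousOn (fun p : (Fin N → ℝ) × (Fin L → ℝ) => Γ.h κ p.1 p.2)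
    (U ×ˢ Icc 0 1) := by
  unfold h
  refine Continuous.comp_continuousOn Complex.continuous_exp ?_
  refine ContinuousOn.sub (ContinuousOn.add ?_ ?_) ?_
  · refine continuousOn_const.mul (continuousOn_finsetSum _ fun I _ => continuousOn_finsetSum _
      fun J hJ => ?_)
    exact (Γ.logXX_continuous I J (Finset.mem_Ioi.1 hJ)).comp continuousOn_fst fun p hp => hp.1
  · refine continuousOn_const.mul (continuousOn_finsetSum _ fun R _ => continuousOn_finsetSum _
      fun S hS => ?_)
    exact (Γ.logWW_continuous R S (Finset.mem_Ioi.1 hS)).comp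
      (f := fun p : (Fin N → ℝ) × (Fin L → ℝ) => (p.1, p.2 R, p.2 S)) (by fun_prop)
      fun p hp => ⟨hp.1, mem_Icc_apply hp.2 R, mem_Icc_apply hp.2 S⟩
  · refine continuousOn_const.mul (continuousOn_finsetSum _ fun I _ => continuousOn_finsetSum _
      fun R _ => ?_)
    exact (Γ.logXW_continuous I R).comp
      (f := fun p : (Fin N → ℝ) × (Fin L → ℝ) => (p.1, p.2 R)) (by fun_prop)
      fun p hp => ⟨hp.1, mem_Icc_apply hp.2 R⟩

lemma continuousOn_points : ContinuousOn
    (fun p : (Fin N → ℝ) × (Fin L → ℝ) => fun i => Γ.points i p.1 p.2) (U ×ˢ univ) := by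
  refine continuousOn_pi.2 fun i => ?_
  rcases i with I | R
  · have : Continuous fun p : (Fin N → ℝ) × (Fin L → ℝ) => ((p.1 I : ℝ) : ℂ) := by fun_prop
    exact this.continuousOn
  · exact (Γ.smooth R).continuousOn.comp
      (f := fun p : (Fin N → ℝ) × (Fin L → ℝ) => (p.1, p.2 R)) (by fun_prop)
      fun p hp => ⟨hp.1, mem_univ _⟩

lemma continuousOn_comp_points (hUinj : ∀ x ∈ U, Function.Injective x)
    {P : (Fin N ⊕ Fin L → ℂ) → ℂ} (hP : AnalyticOnNhd ℂ P (configurations _)) :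
    ContinuousOn (fun p : (Fin N → ℝ) × (Fin L → ℝ) => P fun i => Γ.points i p.1 p.2)
      (U ×ˢ Icc 0 1) :=
  hP.continuousOn.comp (Γ.continuousOn_points.mono (prod_mono_right (subset_univ _)))
    fun _ hp => Γ.points_mem hUinj hp.1 hp.2

end Contours

/-! ### Integration by parts and differentiation of the contour integrals -/

namespace Contours

variable {N L : ℕ} {U : Set (Fin N → ℝ)} (Γ : Contours N L U)

/-- The velocity of the contour of `w_R`. -/
def velocity (R : Fin L) (p : (Fin N → ℝ) × ℝ) : ℂ := fderiv ℝ (Γ.family R) p (0, 1)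

lemma contDiffOn_velocity (hU : IsOpen U) (R : Fin L) :
    ContDiffOn ℝ (⊤ : ℕ∞) (Γ.velocity R) (U ×ˢ univ) :=
  (Γ.contDiffOn_fderiv_family hU R).clm_apply contDiffOn_const

lemma hasFDerivAt_velocity (hU : IsOpen U) (R : Fin L) {x : Fin N → ℝ} (hx : x ∈ U) (s : ℝ) :
    HasFDerivAt (Γ.velocity R) (fderiv ℝ (Γ.velocity R) (x, s)) (x, s) :=
  (((Γ.contDiffOn_velocity hU R).contDiffAt ((isOpen_domain hU).mem_nhds
    ⟨hx, mem_univ _⟩)).differentiableAt (by simp)).hasFDerivAt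

lemma contDiffOn_fderiv_velocity (hU : IsOpen U) (R : Fin L) :
    ContDiffOn ℝ (⊤ : ℕ∞) (fderiv ℝ (Γ.velocity R)) (U ×ˢ univ) :=
  (Γ.contDiffOn_velocity hU R).fderiv_of_isOpen (isOpen_domain hU) (by simp)

lemma hasFDerivAt_velocity_x (hU : IsOpen U) (R : Fin L) {x : Fin N → ℝ} (hx : x ∈ U) (s : ℝ) :
    HasFDerivAt (fun x => Γ.velocity R (x, s))
      ((fderiv ℝ (Γ.velocity R) (x, s)).comp (ContinuousLinearMap.inl ℝ (Fin N → ℝ) ℝ)) x :=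
  HasFDerivAt.comp (g := Γ.velocity R) (f := fun y : Fin N → ℝ => (y, s)) x
    (Γ.hasFDerivAt_velocity hU R hx s) (hasFDerivAt_prodMk_left x s)

lemma hasFDerivAt_velocity_t (hU : IsOpen U) (R : Fin L) {x : Fin N → ℝ} (hx : x ∈ U)
    (t : Fin L → ℝ) : HasFDerivAt (fun t : Fin L → ℝ => Γ.velocity R (x, t R))
      ((fderiv ℝ (Γ.velocity R) (x, t R)).comp ((ContinuousLinearMap.inr ℝ (Fin N → ℝ) ℝ).comp
        (ContinuousLinearMap.proj (R := ℝ) (φ := fun _ => ℝ) R))) t := by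
  have h1 : HasFDerivAt (fun t : Fin L → ℝ => t R)
      (ContinuousLinearMap.proj (R := ℝ) (φ := fun _ => ℝ) R) t :=
    (ContinuousLinearMap.proj (R := ℝ) (φ := fun _ => ℝ) R).hasFDerivAt
  have h2 : HasFDerivAt (fun t : Fin L → ℝ => (x, t R))
      ((ContinuousLinearMap.inr ℝ (Fin N → ℝ) ℝ).comp
        (ContinuousLinearMap.proj (R := ℝ) (φ := fun _ => ℝ) R)) t :=
    HasFDerivAt.comp (g := fun s : ℝ => (x, s)) t (hasFDerivAt_prodMk_right x (t R)) h1
  exact HasFDerivAt.comp (g := Γ.velocity R) t (Γ.hasFDerivAt_velocity hU R hx (t R)) h2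

/-- The variation of the contour of `w_R` in a direction `v` changes along the contour with the
variation of the velocity. -/
lemma hasDerivAt_variation (hU : IsOpen U) (R : Fin L) {x : Fin N → ℝ} (hx : x ∈ U)
    (v : Fin N → ℝ) (s : ℝ) : HasDerivAt (fun s => fderiv ℝ (Γ.family R) (x, s) (v, 0))
      (fderiv ℝ (Γ.velocity R) (x, s) (v, 0)) s := by
  have h1 := Γ.hasFDerivAt_fderiv_family hU R hx s
  have h2 : HasDerivAt (fun s : ℝ => (x, s)) ((0 : Fin N → ℝ), (1 : ℝ)) s :=
    (hasDerivAt_const s x).prodMk (hasDerivAt_id s)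
  have h3 : HasDerivAt (fun s => fderiv ℝ (Γ.family R) (x, s))
      (fderiv ℝ (fderiv ℝ (Γ.family R)) (x, s) (0, 1)) s := h1.comp_hasDerivAt s h2
  have h4 := h3.clm_apply (hasDerivAt_const s ((v, 0) : (Fin N → ℝ) × ℝ))
  have h5 := h1.clm_apply (hasFDerivAt_const ((0, 1) : (Fin N → ℝ) × ℝ) (x, s))
  have h6 : fderiv ℝ (Γ.velocity R) (x, s) = _ := h5.fderiv
  rw [h6]
  simp only [map_zero, add_zero] at h4
  refine h4.congr_deriv ?_
  rw [Γ.fderiv_fderiv_family_symm hU R hx]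
  simp

/-- The contours close up for all nearby `x`, so both endpoints have the same derivative in `x`. -/
lemma variation_closed (hU : IsOpen U) (R : Fin L) {x : Fin N → ℝ} (hx : x ∈ U) (v : Fin N → ℝ) :
    fderiv ℝ (Γ.family R) (x, 0) (v, 0) = fderiv ℝ (Γ.family R) (x, 1) (v, 0) := by
  have h0 := Γ.hasFDerivAt_curve hU R hx 0
  have h1 := Γ.hasFDerivAt_curve hU R hx 1
  have h2 : (fun x => Γ.curve x R 0) =ᶠ[nhds x] fun x => Γ.curve x R 1 :=
    Filter.eventually_of_mem (hU.mem_nhds hx) fun y hy => Γ.closed y hy R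
  have h3 := congrArg (fun l : (Fin N → ℝ) →L[ℝ] ℂ => l v)
    ((h1.congr_of_eventuallyEq h2).unique h0)
  simpa using h3.symm

lemma continuousOn_along {E : Type*} [TopologicalSpace E] {f : (Fin N → ℝ) × ℝ → E}
    (hf : ContinuousOn f (U ×ˢ univ)) (R : Fin L) :
    ContinuousOn (fun p : (Fin N → ℝ) × (Fin L → ℝ) => f (p.1, p.2 R)) (U ×ˢ Icc 0 1) :=
  hf.comp (f := fun p : (Fin N → ℝ) × (Fin L → ℝ) => (p.1, p.2 R)) (by fun_prop)
    fun _ hp => ⟨hp.1, mem_univ _⟩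

lemma continuousOn_section {E : Type*} [TopologicalSpace E]
    {f : (Fin N → ℝ) × (Fin L → ℝ) → E} (hf : ContinuousOn f (U ×ˢ Icc 0 1)) {x : Fin N → ℝ}
    (hx : x ∈ U) : ContinuousOn (fun t => f (x, t)) (Icc 0 1) :=
  hf.comp (f := fun t : Fin L → ℝ => (x, t)) (by fun_prop) fun _ ht => ⟨hx, ht⟩

variable {P Q : (Fin N ⊕ Fin L → ℂ) → ℂ}

lemma hasFDerivAt_h_mul_x (hU : IsOpen U) (hUinj : ∀ x ∈ U, Function.Injective x) {κ : ℝ}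
    (hκ : 0 < κ) (hP : AnalyticOnNhd ℂ P (configurations _)) {x : Fin N → ℝ} (hx : x ∈ U)
    {t : Fin L → ℝ} (ht : t ∈ Icc (0 : Fin L → ℝ) 1) :
    HasFDerivAt (fun x => Γ.h κ x t * P fun i => Γ.points i x t)
      (∑ i, (Γ.h κ x t * nabla (charges N L κ) i P fun i => Γ.points i x t) •
        Γ.pointsDerivX i (x, t)) x :=
  hasFDerivAt_mul_comp (charges N L κ) (fun i => Γ.hasFDerivAt_points_x hU i hx t)
    (Γ.hasFDerivAt_h_x hU hκ hx ht) (hP _ (Γ.points_mem hUinj hx ht)).differentiableAt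

lemma hasFDerivAt_h_mul_t (hU : IsOpen U) (hUinj : ∀ x ∈ U, Function.Injective x) {κ : ℝ}
    (hκ : 0 < κ) (hP : AnalyticOnNhd ℂ P (configurations _)) {x : Fin N → ℝ} (hx : x ∈ U)
    {t : Fin L → ℝ} (ht : ∀ R, t R ∈ Ioo (0 : ℝ) 1) :
    HasFDerivAt (fun t => Γ.h κ x t * P fun i => Γ.points i x t)
      (∑ i, (Γ.h κ x t * nabla (charges N L κ) i P fun i => Γ.points i x t) •
        Γ.pointsDerivT i (x, t)) t :=
  hasFDerivAt_mul_comp (charges N L κ) (fun i => Γ.hasFDerivAt_points_t hU i hx t)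
    (Γ.hasFDerivAt_h_t hU hκ hx ht) (hP _ (Γ.points_mem hUinj hx
      ⟨fun R => (ht R).1.le, fun R => (ht R).2.le⟩)).differentiableAt

lemma continuousOn_h_mul (hUinj : ∀ x ∈ U, Function.Injective x) (κ : ℝ)
    (hP : AnalyticOnNhd ℂ P (configurations _)) :
    ContinuousOn (fun p : (Fin N → ℝ) × (Fin L → ℝ) => Γ.h κ p.1 p.2 *
      P fun i => Γ.points i p.1 p.2) (U ×ˢ Icc 0 1) :=
  (Γ.continuousOn_h κ).mul (Γ.continuousOn_comp_points hUinj hP)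

lemma continuousOn_velocity (hU : IsOpen U) (R : Fin L) :
    ContinuousOn (fun p : (Fin N → ℝ) × (Fin L → ℝ) => Γ.velocity R (p.1, p.2 R))
      (U ×ˢ Icc 0 1) :=
  continuousOn_along (Γ.contDiffOn_velocity hU R).continuousOn R

lemma continuousOn_prod_velocity (hU : IsOpen U) (s : Finset (Fin L)) :
    ContinuousOn (fun p : (Fin N → ℝ) × (Fin L → ℝ) => ∏ R ∈ s, Γ.velocity R (p.1, p.2 R))
      (U ×ˢ Icc 0 1) :=
  continuousOn_finsetProd _ fun R _ => Γ.continuousOn_velocity hU R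

/-- The integrand is the divergence in `t` of the field with components `h P c_R ∏_{S ≠ R} w_S'`,
where `c_R` is a displacement of `w_R`; these components agree on opposite faces of the box. A
constant displacement gives total `w`-derivatives, the variation of the contours gives the effect of
moving them. -/
lemma integral_total_derivative (hU : IsOpen U) (hUinj : ∀ x ∈ U, Function.Injective x) {κ : ℝ}
    (hκ : 0 < κ) (hΓ : Γ.SameEndValues κ) (hP : AnalyticOnNhd ℂ P (configurations _))
    {x : Fin N → ℝ} (hx : x ∈ U) (c c' : Fin L → ℝ → ℂ)
    (hc : ∀ R s, HasDerivAt (c R) (c' R s) s) (hc' : ∀ R, Continuous (c' R))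
    (hper : ∀ R, c R 0 = c R 1) :
    ∫ t in Icc (0 : Fin L → ℝ) 1, ∑ R,
      ((Γ.h κ x t * nabla (charges N L κ) (Sum.inr R) P fun i => Γ.points i x t) * c R (t R) *
        ∏ S, Γ.velocity S (x, t S) +
      (Γ.h κ x t * P fun i => Γ.points i x t) * c' R (t R) *
        ∏ S ∈ Finset.univ.erase R, Γ.velocity S (x, t S)) = 0 := by
  have hcc : ∀ R, Continuous (c R) := fun R =>
    continuous_iff_continuousAt.2 fun s => (hc R s).continuousAt
  have hcR : ∀ R, Continuous fun t : Fin L → ℝ => c R (t R) := fun R =>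
    (hcc R).comp (continuous_apply R)
  have hcR' : ∀ R, Continuous fun t : Fin L → ℝ => c' R (t R) := fun R =>
    (hc' R).comp (continuous_apply R)
  refine integral_divergence_eq_zero
    (fun R t => (Γ.h κ x t * P fun i => Γ.points i x t) *
      (c R (t R) * ∏ S ∈ Finset.univ.erase R, Γ.velocity S (x, t S))) _
    (fun R t => (Γ.h κ x t * P fun i => Γ.points i x t) •
      (c R (t R) • (∑ S ∈ Finset.univ.erase R,
        (∏ T ∈ (Finset.univ.erase R).erase S, Γ.velocity T (x, t T)) •
          (fderiv ℝ (Γ.velocity S) (x, t S)).comp ((ContinuousLinearMap.inr ℝ (Fin N → ℝ) ℝ).comp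
            (ContinuousLinearMap.proj (R := ℝ) (φ := fun _ => ℝ) S))) +
        (∏ S ∈ Finset.univ.erase R, Γ.velocity S (x, t S)) •
          (c' R (t R) • Complex.ofRealCLM.comp
            (ContinuousLinearMap.proj (R := ℝ) (φ := fun _ => ℝ) R))) +
      (c R (t R) * ∏ S ∈ Finset.univ.erase R, Γ.velocity S (x, t S)) •
        (∑ i, (Γ.h κ x t * nabla (charges N L κ) i P fun i => Γ.points i x t) •
        Γ.pointsDerivT i (x, t))) ?_ ?_ ?_ ?_ ?_
  · intro R
    exact (continuousOn_section (Γ.continuousOn_h_mul hUinj κ hP) hx).mul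
      ((hcR R).continuousOn.mul
        (continuousOn_section (Γ.continuousOn_prod_velocity hU (Finset.univ.erase R)) hx))
  · intro t ht R
    have h1 := Γ.hasFDerivAt_h_mul_t hU hUinj hκ hP hx ht
    have h2 : HasFDerivAt (fun t : Fin L → ℝ => t R)
        (ContinuousLinearMap.proj (R := ℝ) (φ := fun _ => ℝ) R) t :=
      (ContinuousLinearMap.proj (R := ℝ) (φ := fun _ => ℝ) R).hasFDerivAt
    have h3 : HasFDerivAt (fun t : Fin L → ℝ => c R (t R)) (c' R (t R) • Complex.ofRealCLM.comp
            (ContinuousLinearMap.proj (R := ℝ) (φ := fun _ => ℝ) R)) t := by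
      refine (HasFDerivAt.comp (g := c R) t (hc R (t R)).hasFDerivAt h2).congr_fderiv ?_
      ext v
      simp [mul_comm]
    have h4 := HasFDerivAt.finsetProd (u := Finset.univ.erase R) fun S
      (_ : S ∈ Finset.univ.erase R) => Γ.hasFDerivAt_velocity_t hU S hx t
    exact h1.mul (h3.mul h4)
  · intro t _ R
    -- The velocities of the other contours do not depend on `t R`.
    have h1 : ∀ S ∈ Finset.univ.erase R, ((∏ T ∈ (Finset.univ.erase R).erase S,
          Γ.velocity T (x, t T)) • (fderiv ℝ (Γ.velocity S) (x, t S)).comp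
          ((ContinuousLinearMap.inr ℝ (Fin N → ℝ) ℝ).comp
            (ContinuousLinearMap.proj (R := ℝ) (φ := fun _ => ℝ) S))) (Pi.single R 1) = 0 := by
      intro S hS
      rw [smul_apply, ContinuousLinearMap.comp_apply, ContinuousLinearMap.comp_apply,
        ContinuousLinearMap.proj_apply, Pi.single_eq_of_ne (Finset.ne_of_mem_erase hS), map_zero,
        map_zero, smul_zero]
    -- Only `w_R` moves with `t R`, and its derivative supplies the velocity missing from the
    -- product.
    have h2 : ∀ i, ((Γ.h κ x t * nabla (charges N L κ) i P fun i => Γ.points i x t) •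
        Γ.pointsDerivT i (x, t)) (Pi.single R 1) = if i = Sum.inr R then
        (Γ.h κ x t * nabla (charges N L κ) (Sum.inr R) P fun i => Γ.points i x t) *
          Γ.velocity R (x, t R) else 0 := by
      rintro (I | S)
      · simp [pointsDerivT]
      · by_cases h : S = R
        · subst h
          simp [pointsDerivT, velocity]
        · simp [pointsDerivT, h]
    simp only [smul_apply] at h1 h2
    simp only [add_apply, smul_apply, sum_apply]
    rw [Finset.sum_congr rfl h1, Finset.sum_congr rfl fun i _ => h2 i, Finset.sum_const_zero,
      Finset.sum_ite_eq' Finset.univ, if_pos (Finset.mem_univ _),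
      ← Finset.mul_prod_erase Finset.univ _ (Finset.mem_univ R)]
    simp
    ring
  · intro R
    refine ContinuousOn.add ?_ ?_
    · refine ((continuousOn_section (Γ.continuousOn_h_mul hUinj κ
        (analyticOnNhd_nabla hP _ _)) hx).mul (hcR R).continuousOn).mul
        (continuousOn_section (Γ.continuousOn_prod_velocity hU Finset.univ) hx)
    · exact ((continuousOn_section (Γ.continuousOn_h_mul hUinj κ hP) hx).mul
        (hcR' R).continuousOn).mul
        (continuousOn_section (Γ.continuousOn_prod_velocity hU (Finset.univ.erase R)) hx)
  · intro t ht R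
    have h1 : (fun i => Γ.points i x (Function.update t R 0)) =
        fun i => Γ.points i x (Function.update t R 1) := by
      funext i
      rcases i with I | S
      · rfl
      · by_cases h : S = R
        · subst h
          simpa [points] using Γ.closed x hx S
        · simp [points, h]
    have h2 : ∀ r : ℝ, ∏ S ∈ Finset.univ.erase R, Γ.velocity S (x, Function.update t R r S) =
        ∏ S ∈ Finset.univ.erase R, Γ.velocity S (x, t S) := fun r =>
      Finset.prod_congr rfl fun S hS => by
        rw [Function.update_of_ne (Finset.ne_of_mem_erase hS)]
    simp only [h2, h1, hΓ x hx t ht R, Function.update_self, hper R]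

/-- The integral of `h P` over the screening contours. -/
def pairing (κ : ℝ) (P : (Fin N ⊕ Fin L → ℂ) → ℂ) (x : Fin N → ℝ) : ℂ :=
  ∫ t in Icc (0 : Fin L → ℝ) 1, (Γ.h κ x t * P fun i => Γ.points i x t) *
    ∏ R, deriv (Γ.curve x R) (t R)

lemma pairing_eq (hU : IsOpen U) (κ : ℝ) (P : (Fin N ⊕ Fin L → ℂ) → ℂ) {x : Fin N → ℝ}
    (hx : x ∈ U) : Γ.pairing κ P x = ∫ t in Icc (0 : Fin L → ℝ) 1,
      (Γ.h κ x t * P fun i => Γ.points i x t) * ∏ R, Γ.velocity R (x, t R) := by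
  simp only [pairing, Γ.deriv_curve hU _ hx, velocity]

lemma continuousOn_pairing_integrand (hU : IsOpen U) (hUinj : ∀ x ∈ U, Function.Injective x)
    (κ : ℝ) (hP : AnalyticOnNhd ℂ P (configurations _)) :
    ContinuousOn (fun p : (Fin N → ℝ) × (Fin L → ℝ) => (Γ.h κ p.1 p.2 *
      P fun i => Γ.points i p.1 p.2) * ∏ R, Γ.velocity R (p.1, p.2 R)) (U ×ˢ Icc 0 1) :=
  (Γ.continuousOn_h_mul hUinj κ hP).mul (Γ.continuousOn_prod_velocity hU _)

lemma integrableOn_pairing (hU : IsOpen U) (hUinj : ∀ x ∈ U, Function.Injective x)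
    (κ : ℝ) (hP : AnalyticOnNhd ℂ P (configurations _)) {x : Fin N → ℝ} (hx : x ∈ U) :
    IntegrableOn (fun t => (Γ.h κ x t * P fun i => Γ.points i x t) *
      ∏ R, Γ.velocity R (x, t R)) (Icc 0 1) :=
  (continuousOn_section (Γ.continuousOn_pairing_integrand hU hUinj κ hP)
    hx).integrableOn_compact isCompact_Icc

/-- Covariant derivatives along the screening charges integrate to zero. -/
lemma pairing_nabla_inr (hU : IsOpen U) (hUinj : ∀ x ∈ U, Function.Injective x) {κ : ℝ}
    (hκ : 0 < κ) (hΓ : Γ.SameEndValues κ) (hP : AnalyticOnNhd ℂ P (configurations _))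
    {x : Fin N → ℝ} (hx : x ∈ U) (R : Fin L) :
    Γ.pairing κ (nabla (charges N L κ) (Sum.inr R) P) x = 0 := by
  -- The displacement is the unit translation of `w_R` alone.
  have h := Γ.integral_total_derivative hU hUinj hκ hΓ hP hx
    (fun S _ => (Pi.single R 1 : Fin L → ℂ) S) (fun _ _ => 0)
    (fun S s => hasDerivAt_const s _) (fun _ => continuous_const) (fun _ => rfl)
  rw [Γ.pairing_eq hU κ _ hx, ← h]
  congr 1
  funext t
  rw [Finset.sum_eq_single R]
  · simp
  · intro S _ hS
    simp [Pi.single_eq_of_ne hS]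
  · simp

/-- The derivatives of the integrals over the screening contours, which may move with `x`. -/
theorem hasFDerivAt_pairing (hU : IsOpen U) (hUinj : ∀ x ∈ U, Function.Injective x) {κ : ℝ}
    (hκ : 0 < κ) (hΓ : Γ.SameEndValues κ) (hP : AnalyticOnNhd ℂ P (configurations _))
    {x : Fin N → ℝ} (hx : x ∈ U) :
    HasFDerivAt (Γ.pairing κ P) (∑ J, Γ.pairing κ (nabla (charges N L κ) (Sum.inl J) P) x •
      Complex.ofRealCLM.comp (ContinuousLinearMap.proj (R := ℝ) (φ := fun _ => ℝ) J)) x := by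
  set F : (Fin N → ℝ) → (Fin L → ℝ) → ℂ := fun x t =>
    (Γ.h κ x t * P fun i => Γ.points i x t) * ∏ R, Γ.velocity R (x, t R) with hF
  set F' : (Fin N → ℝ) → (Fin L → ℝ) → (Fin N → ℝ) →L[ℝ] ℂ := fun x t =>
    (Γ.h κ x t * P fun i => Γ.points i x t) • (∑ R,
      (∏ S ∈ Finset.univ.erase R, Γ.velocity S (x, t S)) •
        (fderiv ℝ (Γ.velocity R) (x, t R)).comp (ContinuousLinearMap.inl ℝ (Fin N → ℝ) ℝ)) +
    (∏ R, Γ.velocity R (x, t R)) •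
      (∑ i, (Γ.h κ x t * nabla (charges N L κ) i P fun i => Γ.points i x t) •
        Γ.pointsDerivX i (x, t)) with hF'
  have hFd : ∀ y ∈ U, ∀ t ∈ Icc (0 : Fin L → ℝ) 1, HasFDerivAt (fun x => F x t) (F' y t) y :=
    fun y hy t ht => (Γ.hasFDerivAt_h_mul_x hU hUinj hκ hP hy ht).mul
      (HasFDerivAt.finsetProd (u := Finset.univ) fun S _ => Γ.hasFDerivAt_velocity_x hU S hy (t S))
  have hFc := Γ.continuousOn_pairing_integrand hU hUinj κ hP
  have hFc' : ContinuousOn (fun p : (Fin N → ℝ) × (Fin L → ℝ) => F' p.1 p.2) (U ×ˢ Icc 0 1) := by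
    refine ContinuousOn.add ?_ ?_
    · refine (Γ.continuousOn_h_mul hUinj κ hP).smul (continuousOn_finsetSum _ fun R _ => ?_)
      refine (Γ.continuousOn_prod_velocity hU _).smul (ContinuousOn.clm_comp ?_ continuousOn_const)
      exact continuousOn_along (Γ.contDiffOn_fderiv_velocity hU R).continuousOn R
    · refine (Γ.continuousOn_prod_velocity hU _).smul (continuousOn_finsetSum _ fun i _ => ?_)
      refine (Γ.continuousOn_h_mul hUinj κ (analyticOnNhd_nabla hP _ _)).smul ?_
      rcases i with I | R
      · exact continuousOn_const
      · exact (continuousOn_along (Γ.contDiffOn_fderiv_family hU R).continuousOn R).clm_comp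
          continuousOn_const
  -- The derivative of the integrand is jointly continuous, hence bounded on a compact neighbourhood
  -- times the box; this is the dominating constant.
  obtain ⟨K, hK, hxK, hKU⟩ := exists_compact_subset hU hx
  obtain ⟨C, hC⟩ := (hK.prod (isCompact_Icc (a := (0 : Fin L → ℝ)) (b :=
    1))).exists_bound_of_continuousOn (hFc'.mono (prod_mono_left hKU))
  have hint' : IntegrableOn (F' x) (Icc 0 1) :=
    (continuousOn_section hFc' hx).integrableOn_compact isCompact_Icc
  have hmain : HasFDerivAt (fun y => ∫ t in Icc (0 : Fin L → ℝ) 1, F y t)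
      (∫ t in Icc (0 : Fin L → ℝ) 1, F' x t) x := by
    refine hasFDerivAt_integral_of_dominated_of_fderiv_le (s := K) (bound := fun _ => C)
      (mem_interior_iff_mem_nhds.1 hxK) ?_ ?_ ?_ ?_ ?_ ?_
    · filter_upwards [hU.mem_nhds hx] with y hy
      exact (continuousOn_section hFc hy).aestronglyMeasurable measurableSet_Icc
    · exact (continuousOn_section hFc hx).integrableOn_compact isCompact_Icc
    · exact hint'.aestronglyMeasurable
    · filter_upwards [ae_restrict_mem measurableSet_Icc] with t ht y hy
      exact hC (y, t) ⟨hy, ht⟩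
    · exact integrableOn_const isCompact_Icc.measure_lt_top.ne
    · filter_upwards [ae_restrict_mem measurableSet_Icc] with t ht y hy
      exact hFd y (hKU hy) t ht
  have heq : Γ.pairing κ P =ᶠ[nhds x] fun y => ∫ t in Icc (0 : Fin L → ℝ) 1, F y t :=
    Filter.eventually_of_mem (hU.mem_nhds hx) fun y hy => Γ.pairing_eq hU κ P hy
  refine (hmain.congr_of_eventuallyEq heq).congr_fderiv ?_
  ext v
  rw [ContinuousLinearMap.integral_apply hint', sum_apply]
  -- The displacement is now the variation of the contours in the direction `v`, so all that their
  -- motion contributes is a vanishing divergence.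
  have hE := Γ.integral_total_derivative hU hUinj hκ hΓ hP hx
    (fun R s => fderiv ℝ (Γ.family R) (x, s) (v, 0))
    (fun R s => fderiv ℝ (Γ.velocity R) (x, s) (v, 0))
    (fun R s => Γ.hasDerivAt_variation hU R hx v s) (fun R => by
      have h1 : Continuous fun s => fderiv ℝ (Γ.velocity R) (x, s) := continuousOn_univ.1
        ((Γ.contDiffOn_fderiv_velocity hU R).continuousOn.comp (f := fun s : ℝ => (x, s))
          (by fun_prop) fun s _ => ⟨hx, mem_univ _⟩)
      exact h1.clm_apply continuous_const)
    (fun R => Γ.variation_closed hU R hx v)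
  have hsplit : ∀ t, F' x t v = (∑ J, (v J : ℂ) * ((Γ.h κ x t *
      nabla (charges N L κ) (Sum.inl J) P fun i => Γ.points i x t) *
        ∏ R, Γ.velocity R (x, t R))) + ∑ R,
      ((Γ.h κ x t * nabla (charges N L κ) (Sum.inr R) P fun i => Γ.points i x t) *
        fderiv ℝ (Γ.family R) (x, t R) (v, 0) * ∏ S, Γ.velocity S (x, t S) +
      (Γ.h κ x t * P fun i => Γ.points i x t) * fderiv ℝ (Γ.velocity R) (x, t R) (v, 0) *
        ∏ S ∈ Finset.univ.erase R, Γ.velocity S (x, t S)) := by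
    intro t
    simp only [hF', add_apply, smul_apply, sum_apply, Fintype.sum_sum_type, pointsDerivX,
      Sum.elim_inl, Sum.elim_inr, smul_eq_mul, ContinuousLinearMap.comp_apply,
      ContinuousLinearMap.inl_apply, ContinuousLinearMap.proj_apply, Complex.ofRealCLM_apply,
      Finset.sum_add_distrib, mul_add, Finset.mul_sum]
    rw [add_comm, add_assoc]
    refine congrArg₂ _ (Finset.sum_congr rfl fun J _ => by ring)
      (congrArg₂ _ (Finset.sum_congr rfl fun J _ => by ring)
        (Finset.sum_congr rfl fun J _ => by ring))
  have hI : ∀ J, IntegrableOn (fun t => (v J : ℂ) * ((Γ.h κ x t *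
      nabla (charges N L κ) (Sum.inl J) P fun i => Γ.points i x t) *
        ∏ R, Γ.velocity R (x, t R))) (Icc 0 1) := fun J =>
    (Γ.integrableOn_pairing hU hUinj κ (analyticOnNhd_nabla hP _ _) hx).const_mul _
  have hsum := integrable_finsetSum (Finset.univ : Finset (Fin N)) fun J _ => hI J
  -- Integrability of the divergence part is obtained by subtraction.
  have hrest := (hint'.apply_continuousLinearMap v).sub hsum
  simp only [hsplit] at hrest ⊢
  rw [integral_add hsum (by
    refine hrest.congr (Filter.Eventually.of_forall fun t => ?_)
    simp), hE, add_zero, integral_finsetSum _ fun J _ => hI J]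
  refine Finset.sum_congr rfl fun J _ => ?_
  rw [integral_const_mul, ← Γ.pairing_eq hU κ _ hx]
  simp [mul_comm]

end Contours

/-! ### The null field equations for the screened vector -/

section FunctionSpaces

variable (ι : Type*) [Fintype ι]

/-- The functions which are analytic on the configurations of distinct points. -/
def analyticFunctions : Submodule ℂ ((ι → ℂ) → ℂ) where
  carrier := {P | AnalyticOnNhd ℂ P (configurations ι)}
  add_mem' hP hQ := hP.add hQ
  zero_mem' := analyticOnNhd_const
  smul_mem' _ _ hP := analyticOnNhd_const.mul hP

variable {ι}

/-- The vector `U⁻(z) v` as a function of the points. -/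
def UminusFun (a : ι → ℂ) : Fock ((ι → ℂ) → ℂ) := fun μ z => MvPowerSeries.coeff μ (Uminus a z)

/-- Evaluation of functions at a point. -/
def evalLin {X : Type*} (x : X) : (X → ℂ) →ₗ[ℂ] ℂ := LinearMap.proj x

lemma mapLin_evalLin_UminusFun (a z : ι → ℂ) : mapLin (evalLin z) (UminusFun a) = Uminus a z := rfl

lemma coeff_virasoro_eval {X : Type*} (x : X) (β α₀ : ℂ) (j : ℕ) (u : Fock (X → ℂ))
    (μ : ℕ+ →₀ ℕ) : MvPowerSeries.coeff μ (virasoro β α₀ (-2 - (j : ℤ)) u) x =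
      MvPowerSeries.coeff μ (virasoro β α₀ (-2 - (j : ℤ)) (mapLin (evalLin x) u)) := by
  rw [virasoro_mapLin, coeff_mapLin]
  rfl

end FunctionSpaces

namespace Contours

variable {N L : ℕ} {U : Set (Fin N → ℝ)} (Γ : Contours N L U)
  {P Q : (Fin N ⊕ Fin L → ℂ) → ℂ}

lemma partialX_pairing (hU : IsOpen U) (hUinj : ∀ x ∈ U, Function.Injective x) {κ : ℝ}
    (hκ : 0 < κ) (hΓ : Γ.SameEndValues κ) (hP : P ∈ analyticFunctions _)
    {x : Fin N → ℝ} (hx : x ∈ U) (J : Fin N) :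
    partialX J (Γ.pairing κ P) x = Γ.pairing κ (nabla (charges N L κ) (Sum.inl J) P) x := by
  rw [partialX, (Γ.hasFDerivAt_pairing hU hUinj hκ hΓ hP hx).fderiv, sum_apply,
    Finset.sum_eq_single J]
  · simp
  · intro I _ hI
    simp [hI]
  · simp

/-- The derivatives of a pairing are again pairings with analytic functions, so the argument can be
iterated. -/
lemma contDiffOn_pairing (hU : IsOpen U) (hUinj : ∀ x ∈ U, Function.Injective x) {κ : ℝ}
    (hκ : 0 < κ) (hΓ : Γ.SameEndValues κ) (hP : P ∈ analyticFunctions _) :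
    ContDiffOn ℝ (⊤ : ℕ∞) (Γ.pairing κ P) U := by
  rw [contDiffOn_infty]
  intro n
  induction n generalizing P with
  | zero =>
    exact contDiffOn_zero.2 fun x hx =>
      (Γ.hasFDerivAt_pairing hU hUinj hκ hΓ hP hx).continuousAt.continuousWithinAt
  | succ n ih =>
    rw [Nat.cast_succ, contDiffOn_succ_iff_fderiv_of_isOpen hU]
    refine ⟨fun x hx => (Γ.hasFDerivAt_pairing hU hUinj hκ hΓ hP
      hx).differentiableAt.differentiableWithinAt, fun h => by simp at h, ?_⟩
    refine ContDiffOn.congr ?_ fun x hx => (Γ.hasFDerivAt_pairing hU hUinj hκ hΓ hP hx).fderiv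
    exact ContDiffOn.sum fun J _ => (ih (analyticOnNhd_nabla hP _ _)).smul contDiffOn_const

lemma nullOp_pairing (hU : IsOpen U) (hUinj : ∀ x ∈ U, Function.Injective x) {κ : ℝ}
    (hκ : 0 < κ) (hΓ : Γ.SameEndValues κ) (hP : P ∈ analyticFunctions _)
    {x : Fin N → ℝ} (hx : x ∈ U) (I : Fin N) :
    nullOp κ I (Γ.pairing κ P) x = (κ : ℂ) / 2 * Γ.pairing κ
        (nabla (charges N L κ) (Sum.inl I) (nabla (charges N L κ) (Sum.inl I) P)) x +
      ∑ J ∈ Finset.univ.erase I,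
        (2 / ((x J : ℂ) - (x I : ℂ)) * Γ.pairing κ (nabla (charges N L κ) (Sum.inl J) P) x +
        (((κ : ℂ) - 6) / (κ : ℂ)) / ((x J : ℂ) - (x I : ℂ)) ^ 2 * Γ.pairing κ P x) := by
  have h1 : partialX I (partialX I (Γ.pairing κ P)) x =
      partialX I (Γ.pairing κ (nabla (charges N L κ) (Sum.inl I) P)) x := by
    have h2 : partialX I (Γ.pairing κ P) =ᶠ[nhds x]
        Γ.pairing κ (nabla (charges N L κ) (Sum.inl I) P) :=
      Filter.eventually_of_mem (hU.mem_nhds hx) fun y hy =>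
        Γ.partialX_pairing hU hUinj hκ hΓ hP hy I
    rw [partialX, h2.fderiv_eq, partialX]
  rw [nullOp, h1, Γ.partialX_pairing hU hUinj hκ hΓ (analyticOnNhd_nabla hP _ _) hx]
  simp only [Γ.partialX_pairing hU hUinj hκ hΓ hP hx]

/-- The integral over the screening contours as a linear functional. -/
lemma exists_pairing_linearMap (hU : IsOpen U) (hUinj : ∀ x ∈ U, Function.Injective x) (κ : ℝ)
    {x : Fin N → ℝ} (hx : x ∈ U) : ∃ T : ((Fin N ⊕ Fin L → ℂ) → ℂ) →ₗ[ℂ] ℂ,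
      ∀ P ∈ analyticFunctions (Fin N ⊕ Fin L), T P = Γ.pairing κ P x := by
  let T₀ : analyticFunctions (Fin N ⊕ Fin L) →ₗ[ℂ] ℂ :=
    { toFun := fun P => Γ.pairing κ P x
      map_add' := fun P Q => by
        simp only [Γ.pairing_eq hU κ _ hx]
        rw [← integral_add (Γ.integrableOn_pairing hU hUinj κ P.2 hx)
          (Γ.integrableOn_pairing hU hUinj κ Q.2 hx)]
        congr 1
        funext t
        simp only [Submodule.coe_add, Pi.add_apply]
        ring
      map_smul' := fun c P => by
        simp only [Γ.pairing_eq hU κ _ hx, RingHom.id_apply, smul_eq_mul]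
        rw [← integral_const_mul]
        congr 1
        funext t
        simp only [Submodule.coe_smul, Pi.smul_apply, smul_eq_mul]
        ring }
  -- Additivity of the integral is available where the integrand is integrable; a purely algebraic
  -- extension to all functions lets `virasoro_mapLin` apply.
  obtain ⟨T, hT⟩ := T₀.exists_extend
  exact ⟨T, fun P hP => LinearMap.congr_fun hT ⟨P, hP⟩⟩

lemma pairing_congr (κ : ℝ) {x : Fin N → ℝ}
    (h : ∀ t ∈ Icc (0 : Fin L → ℝ) 1, P (fun i => Γ.points i x t) = Q fun i => Γ.points i x t) :
    Γ.pairing κ P x = Γ.pairing κ Q x :=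
  setIntegral_congr_fun measurableSet_Icc fun t ht => by simp only [h t ht]

lemma sum_charges {κ : ℝ} : ∑ i, charges N L κ i = totalCharge N L κ := by
  simp [charges, Fintype.sum_sum_type, totalCharge]
  ring

lemma coeff_screened (κ : ℝ) (μ : ℕ+ →₀ ℕ) : MvPowerSeries.coeff μ (Γ.screened κ) =
    Γ.pairing κ (MvPowerSeries.coeff μ (UminusFun (charges N L κ))) := rfl

lemma coeff_UminusFun_mem {ι : Type*} [Fintype ι] [DecidableEq ι] (a : ι → ℂ) (μ : ℕ+ →₀ ℕ) :
    MvPowerSeries.coeff μ (UminusFun a) ∈ analyticFunctions ι := analyticOnNhd_Uminus a μ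

lemma coeff_virasoro_screened (hU : IsOpen U) (hUinj : ∀ x ∈ U, Function.Injective x) (κ : ℝ)
    {x : Fin N → ℝ} (hx : x ∈ U) (β α₀ : ℂ) (j : ℕ) (μ : ℕ+ →₀ ℕ) :
    MvPowerSeries.coeff μ (virasoro β α₀ (-2 - (j : ℤ)) (Γ.screened κ)) x =
      Γ.pairing κ (MvPowerSeries.coeff μ
        (virasoro β α₀ (-2 - (j : ℤ)) (UminusFun (charges N L κ)))) x := by
  obtain ⟨T, hT⟩ := Γ.exists_pairing_linearMap hU hUinj κ hx
  have h1 : mapLin (evalLin x) (Γ.screened κ) = mapLin T (UminusFun (charges N L κ)) := by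
    ext ν
    rw [coeff_mapLin, coeff_mapLin, hT _ (coeff_UminusFun_mem _ ν), coeff_screened]
    rfl
  rw [coeff_virasoro_eval, h1, virasoro_mapLin, coeff_mapLin, hT]
  exact coeff_virasoro_mem _ β α₀ (coeff_UminusFun_mem _) j μ

/-- The right-hand side is the contribution of a point of weight one to the null field operator; it
is therefore a total covariant derivative. -/
lemma nabla_mul_const_div_sub {ι : Type*} [Fintype ι] [DecidableEq ι] (a : ι → ℂ) {i j : ι}
    (hij : j ≠ i) {P : (ι → ℂ) → ℂ} (hP : P ∈ analyticFunctions ι) {z : ι → ℂ}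
    (hz : z ∈ configurations ι) :
    nabla a j (fun z => 2 / (z j - z i) * P z) z =
      2 / (z j - z i) * nabla a j P z - 2 / (z j - z i) ^ 2 * P z := by
  have hne : z j - z i ≠ 0 := sub_ne_zero.2 fun e => hij (hz e)
  have h1 : HasFDerivAt (fun z : ι → ℂ => 2 / (z j - z i)) _ z :=
    ((hasDerivAt_inv hne).comp_hasFDerivAt z
      ((hasFDerivAt_proj j z).sub (hasFDerivAt_proj i z))).const_mul 2
  have h2 := (hP z hz).differentiableAt.hasFDerivAt
  have h3 := h1.fun_mul h2
  rw [nabla, h3.fderiv, nabla]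
  simp [hij.symm]
  ring

/-- The null field equation with `N + L` points is integrated over the contours; the contributions
of the `w_R`, having weight one, drop out. -/
theorem nullOp_screened (hU : IsOpen U) (hUinj : ∀ x ∈ U, Function.Injective x) {κ : ℝ}
    (hκ : 0 < κ) (hΓ : Γ.SameEndValues κ) {x : Fin N → ℝ} (hx : x ∈ U) (I : Fin N)
    {μ : ℕ+ →₀ ℕ} {M : ℕ} (hM : level μ ≤ M) :
    nullOp κ I (MvPowerSeries.coeff μ (Γ.screened κ)) x =
      2 * ∑ j ∈ Finset.range M, (x I : ℂ) ^ j * MvPowerSeries.coeff μ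
        (virasoro (totalCharge N L κ) (backgroundCharge κ) (-2 - (j : ℤ)) (Γ.screened κ)) x := by
  set a := charges N L κ with ha
  set P := MvPowerSeries.coeff μ (UminusFun a) with hPdef
  have hP : P ∈ analyticFunctions _ := coeff_UminusFun_mem a μ
  have hn : ∀ {P : _} (_ : P ∈ analyticFunctions (Fin N ⊕ Fin L)) i,
    nabla a i P ∈ analyticFunctions _ := fun hP i => analyticOnNhd_nabla hP _ _
  have hQ : ∀ R : Fin L, (fun z => 2 / (z (Sum.inr R) - z (Sum.inl I)) * P z) ∈
      analyticFunctions (Fin N ⊕ Fin L) := fun R =>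
    (analyticOnNhd_const_div_sub 2 (by simp)).mul hP
  have hV : ∀ j : ℕ, MvPowerSeries.coeff μ (virasoro (totalCharge N L κ) (backgroundCharge κ)
      (-2 - (j : ℤ)) (UminusFun a)) ∈ analyticFunctions (Fin N ⊕ Fin L) := fun j =>
    coeff_virasoro_mem _ _ _ (coeff_UminusFun_mem a) j μ
  obtain ⟨T, hT⟩ := Γ.exists_pairing_linearMap hU hUinj κ hx
  simp only [Γ.coeff_virasoro_screened hU hUinj κ hx, coeff_screened]
  rw [Γ.nullOp_pairing hU hUinj hκ hΓ hP hx]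
  simp only [← ha]
  have hs := ofReal_sqrt_mul_self hκ
  have hs0 : ((√κ : ℝ) : ℂ) ≠ 0 := by
    rw [Complex.ofReal_ne_zero]; exact (Real.sqrt_pos.2 hκ).ne'
  -- The last sum on the left is added at no cost: it consists of total derivatives in the `w_R` and
  -- completes the equation for all points.
  have hlhs : Γ.pairing κ ((κ / 2 : ℂ) • nabla a (Sum.inl I) (nabla a (Sum.inl I) P) +
      (∑ J ∈ Finset.univ.erase I, ((2 / ((x J : ℂ) - (x I : ℂ))) • nabla a (Sum.inl J) P +
        ((((κ : ℂ) - 6) / (κ : ℂ)) / ((x J : ℂ) - (x I : ℂ)) ^ 2) • P)) +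
      ∑ R, nabla a (Sum.inr R) fun z => 2 / (z (Sum.inr R) - z (Sum.inl I)) * P z) x =
      Γ.pairing κ ((2 : ℂ) • ∑ j ∈ Finset.range M, ((x I : ℂ) ^ j) • MvPowerSeries.coeff μ
        (virasoro (totalCharge N L κ) (backgroundCharge κ) (-2 - (j : ℤ)) (UminusFun a))) x := by
    apply Γ.pairing_congr
    intro t ht
    have hz := Γ.points_mem hUinj hx ht
    set z := fun i => Γ.points i x t with hzdef
    have hzJ : ∀ J, (x J : ℂ) = z (Sum.inl J) := fun J => rfl
    have hnull := nabla_nabla_Uminus a z hz κ (backgroundCharge κ) (Sum.inl I)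
      (by rw [ha, ← hs]; simp only [charges, Sum.elim_inl]; field_simp)
      (by rw [ha, ← hs, backgroundCharge]; simp only [charges, Sum.elim_inl]; field_simp; ring) hM
    rw [ha, sum_charges, ← ha] at hnull
    simp only [Pi.add_apply, Pi.smul_apply, Finset.sum_apply, smul_eq_mul, coeff_virasoro_eval z,
      mapLin_evalLin_UminusFun, hzJ]
    rw [← hnull]
    rw [Finset.sum_erase_eq_sub (Finset.mem_univ _), Finset.sum_erase_eq_sub (Finset.mem_univ _),
      Fintype.sum_sum_type]
    have e1 : ∀ R, nabla a (Sum.inr R) (fun z => 2 / (z (Sum.inr R) - z (Sum.inl I)) * P z) z =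
        2 / (z (Sum.inr R) - z (Sum.inl I)) * nabla a (Sum.inr R) P z -
          2 * (a (Sum.inr R) ^ 2 - 2 * backgroundCharge κ * a (Sum.inr R)) /
            (z (Sum.inr R) - z (Sum.inl I)) ^ 2 * P z := by
      intro R
      have e : a (Sum.inr R) ^ 2 - 2 * backgroundCharge κ * a (Sum.inr R) = 1 := by
        simp only [ha, charges, Sum.elim_inr, backgroundCharge]
        field_simp
        ring
      rw [nabla_mul_const_div_sub a (by simp) hP hz, e, mul_one]
    -- The weight at the `x_J` is `(6 - κ)/(2κ)`.
    have e2 : ∀ J, -(2 * (a (Sum.inl J) ^ 2 - 2 * backgroundCharge κ * a (Sum.inl J))) =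
        ((κ : ℂ) - 6) / κ := by
      intro J
      rw [← hs]
      simp only [ha, charges, Sum.elim_inl, backgroundCharge]
      field_simp
      ring
    have e3 : ∀ J, 2 / (z (Sum.inl J) - z (Sum.inl I)) * nabla a (Sum.inl J) P z +
        ((κ : ℂ) - 6) / κ / (z (Sum.inl J) - z (Sum.inl I)) ^ 2 * P z =
        2 / (z (Sum.inl J) - z (Sum.inl I)) * nabla a (Sum.inl J) P z -
          2 * (a (Sum.inl J) ^ 2 - 2 * backgroundCharge κ * a (Sum.inl J)) /
            (z (Sum.inl J) - z (Sum.inl I)) ^ 2 * P z := by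
      intro J
      rw [← e2 J]
      ring
    simp only [e1, e3]
    have e4 : P = fun z => MvPowerSeries.coeff μ (Uminus a z) := rfl
    simp only [e4]
    ring
  have hQ0 : ∀ R, T (nabla a (Sum.inr R) fun z => 2 / (z (Sum.inr R) - z (Sum.inl I)) * P z) = 0 :=
    fun R => by
      rw [hT _ (hn (hQ R) _)]
      exact Γ.pairing_nabla_inr hU hUinj hκ hΓ (hQ R) hx R
  rw [← hT, ← hT] at hlhs
  · simp only [map_add, map_smul, map_sum, hQ0, Finset.sum_const_zero, add_zero, smul_eq_mul,
      hT _ hP, hT _ (hV _), hT _ (hn hP _), hT _ (hn (hn hP _) _)] at hlhs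
    exact hlhs
  · exact Submodule.smul_mem _ _ (Submodule.sum_mem _ fun j _ => Submodule.smul_mem _ _ (hV j))
  · refine Submodule.add_mem _ (Submodule.add_mem _ (Submodule.smul_mem _ _ (hn (hn hP _) _))
      (Submodule.sum_mem _ fun J _ => Submodule.add_mem _ (Submodule.smul_mem _ _ (hn hP _))
        (Submodule.smul_mem _ _ hP))) (Submodule.sum_mem _ fun R _ => hn (hQ R) _)

end Contours

/-! ### The state is annihilated by the drift operators -/

section Smooth

variable {N : ℕ} {U : Set (Fin N → ℝ)} {φ ψ : (Fin N → ℝ) → ℂ} {x : Fin N → ℝ}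

/-- The functions which are smooth on `U`. -/
def smoothFunctions (U : Set (Fin N → ℝ)) : Submodule ℂ ((Fin N → ℝ) → ℂ) where
  carrier := {φ | ContDiffOn ℝ (⊤ : ℕ∞) φ U}
  add_mem' hφ hψ := hφ.add hψ
  zero_mem' := contDiffOn_const
  smul_mem' _ _ hφ := contDiffOn_const.mul hφ

lemma hasFDerivAt_of_mem_smoothFunctions (hU : IsOpen U) (hφ : φ ∈ smoothFunctions U)
    (hx : x ∈ U) : HasFDerivAt φ (fderiv ℝ φ x) x :=
  ((hφ.contDiffAt (hU.mem_nhds hx)).differentiableAt (by simp)).hasFDerivAt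

lemma partialX_mem (hU : IsOpen U) (hφ : φ ∈ smoothFunctions U) (J : Fin N) :
    partialX J φ ∈ smoothFunctions U :=
  (ContDiffOn.fderiv_of_isOpen (m := (⊤ : ℕ∞)) hφ hU (by simp)).clm_apply contDiffOn_const

lemma mul_mem_smoothFunctions (hφ : φ ∈ smoothFunctions U) (hψ : ψ ∈ smoothFunctions U) :
    (fun x => φ x * ψ x) ∈ smoothFunctions U := ContDiffOn.mul hφ hψ

lemma partialX_congr (hU : IsOpen U) (h : ∀ x ∈ U, φ x = ψ x) (hx : x ∈ U) (J : Fin N) :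
    partialX J φ x = partialX J ψ x := by
  have h1 : φ =ᶠ[nhds x] ψ := Filter.eventually_of_mem (hU.mem_nhds hx) h
  rw [partialX, partialX, h1.fderiv_eq]

lemma partialX_add (hU : IsOpen U) (hφ : φ ∈ smoothFunctions U) (hψ : ψ ∈ smoothFunctions U)
    (hx : x ∈ U) (J : Fin N) :
    partialX J (φ + ψ) x = partialX J φ x + partialX J ψ x := by
  rw [partialX, ((hasFDerivAt_of_mem_smoothFunctions hU hφ hx).add
    (hasFDerivAt_of_mem_smoothFunctions hU hψ hx)).fderiv, add_apply]
  rfl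

lemma partialX_smul (hU : IsOpen U) (c : ℂ) (hφ : φ ∈ smoothFunctions U)
    (hx : x ∈ U) (J : Fin N) : partialX J (c • φ) x = c * partialX J φ x := by
  rw [partialX, ((hasFDerivAt_of_mem_smoothFunctions hU hφ hx).const_smul c).fderiv, smul_apply]
  rfl

lemma partialX_mul (hU : IsOpen U) (hφ : φ ∈ smoothFunctions U) (hψ : ψ ∈ smoothFunctions U)
    (hx : x ∈ U) (J : Fin N) :
    partialX J (fun x => φ x * ψ x) x = partialX J φ x * ψ x + φ x * partialX J ψ x := by
  rw [partialX, ((hasFDerivAt_of_mem_smoothFunctions hU hφ hx).fun_mul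
    (hasFDerivAt_of_mem_smoothFunctions hU hψ hx)).fderiv]
  simp [partialX]
  ring

lemma nullOp_add (hU : IsOpen U) (hφ : φ ∈ smoothFunctions U) (hψ : ψ ∈ smoothFunctions U)
    (hx : x ∈ U) (κ : ℝ) (I : Fin N) :
    nullOp κ I (φ + ψ) x = nullOp κ I φ x + nullOp κ I ψ x := by
  simp only [nullOp, partialX_add hU hφ hψ hx]
  rw [partialX_congr (ψ := partialX I φ + partialX I ψ) hU
    (fun y hy => partialX_add hU hφ hψ hy I) hx,
    partialX_add hU (partialX_mem hU hφ I) (partialX_mem hU hψ I) hx, mul_add, add_add_add_comm,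
    ← Finset.sum_add_distrib]
  congr 1
  refine Finset.sum_congr rfl fun J _ => ?_
  rw [Pi.add_apply]
  ring

lemma nullOp_smul (hU : IsOpen U) (c : ℂ) (hφ : φ ∈ smoothFunctions U)
    (hx : x ∈ U) (κ : ℝ) (I : Fin N) : nullOp κ I (c • φ) x = c * nullOp κ I φ x := by
  simp only [nullOp, partialX_smul hU c hφ hx]
  rw [partialX_congr (ψ := c • partialX I φ) hU (fun y hy => partialX_smul hU c hφ hy I) hx,
    partialX_smul hU c (partialX_mem hU hφ I) hx, mul_add, Finset.mul_sum]
  congr 1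
  · ring
  · refine Finset.sum_congr rfl fun J _ => ?_
    rw [Pi.smul_apply, smul_eq_mul]
    ring

/-- On non-smooth functions `nullOp` need not be additive. The extension agrees with it on smooth
ones and may be passed through `G_f`. -/
lemma exists_nullOp_linearMap (hU : IsOpen U) (hx : x ∈ U) (κ : ℝ) (I : Fin N) :
    ∃ T : ((Fin N → ℝ) → ℂ) →ₗ[ℂ] ℂ, ∀ φ ∈ smoothFunctions U, T φ = nullOp κ I φ x := by
  let T₀ : smoothFunctions U →ₗ[ℂ] ℂ :=
    { toFun := fun φ => nullOp κ I φ x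
      map_add' := fun φ ψ => nullOp_add hU φ.2 ψ.2 hx κ I
      map_smul' := fun c φ => nullOp_smul hU c φ.2 hx κ I }
  obtain ⟨T, hT⟩ := T₀.exists_extend
  exact ⟨T, fun φ hφ => LinearMap.congr_fun hT ⟨φ, hφ⟩⟩

end Smooth

namespace Contours

variable {N L : ℕ} {U : Set (Fin N → ℝ)} (Γ : Contours N L U)

lemma coeff_screened_mem (hU : IsOpen U) (hUinj : ∀ x ∈ U, Function.Injective x) {κ : ℝ}
    (hκ : 0 < κ) (hΓ : Γ.SameEndValues κ) (μ : ℕ+ →₀ ℕ) :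
    MvPowerSeries.coeff μ (Γ.screened κ) ∈ smoothFunctions U :=
  Γ.contDiffOn_pairing hU hUinj hκ hΓ (coeff_UminusFun_mem _ μ)

theorem smoothOn_state (hU : IsOpen U) (hUinj : ∀ x ∈ U, Function.Injective x) {κ : ℝ}
    (hκ : 0 < κ) (hΓ : Γ.SameEndValues κ) (μ : ℕ+ →₀ ℕ) :
    SLEData.SmoothOn U (MvPowerSeries.coeff μ (Γ.state κ)) := fun s =>
  coeff_opG_mem (smoothFunctions U) _ _ (Γ.coeff_screened_mem hU hUinj hκ hΓ) μ s

/-- The derivatives of the state in the direction of the Loewner vector field. -/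
lemma sum_pPoly_mul_pderiv_state (κ : ℝ) (I : Fin N) (μ : ℕ+ →₀ ℕ) :
    ∑ i ∈ (MvPowerSeries.coeff μ (Γ.state κ)).vars,
        pPoly (fun x : Fin N → ℝ => (x I : ℂ)) i *
          MvPolynomial.pderiv i (MvPowerSeries.coeff μ (Γ.state κ)) =
      -∑ j ∈ Finset.range (level μ + 1),
        MvPolynomial.C ((fun x : Fin N → ℝ => (x I : ℂ)) ^ j) * MvPowerSeries.coeff μ
          (opG (totalCharge N L κ) (backgroundCharge κ)
            (virasoro (totalCharge N L κ) (backgroundCharge κ) (-2 - (j : ℤ)) (Γ.screened κ))) := by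
  classical
  set η := MvPowerSeries.coeff μ (Γ.state κ) with hη
  have hpd : ∀ i, MvPolynomial.pderiv i η = -∑ j ∈ Finset.range (level μ + 1),
      residue _ i j * MvPowerSeries.coeff μ (opG (totalCharge N L κ) (backgroundCharge κ)
        (virasoro (totalCharge N L κ) (backgroundCharge κ) (-2 - (j : ℤ)) (Γ.screened κ))) :=
    fun i => pderiv_opG _ _ _ _ _
  have hzero : ∀ i, i ∉ Finset.range (level μ + 1) → MvPolynomial.pderiv i η = 0 := by
    intro i hi
    rw [hpd, Finset.sum_eq_zero, neg_zero]
    intro j hj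
    rw [Finset.mem_range] at hi hj
    rw [residue_of_lt (A := (Fin N → ℝ) → ℂ) (show j < i by omega), zero_mul]
  -- The variables of `η` and the range bounded by the level are compared through their union, since
  -- the derivatives vanish outside either set.
  have h1 : ∑ i ∈ η.vars, pPoly (fun x : Fin N → ℝ => (x I : ℂ)) i * MvPolynomial.pderiv i η =
      ∑ i ∈ η.vars ∪ Finset.range (level μ + 1),
        pPoly (fun x : Fin N → ℝ => (x I : ℂ)) i * MvPolynomial.pderiv i η := by
    refine Finset.sum_subset Finset.subset_union_left fun i _ hi => ?_
    rw [MvPolynomial.pderiv_eq_zero_of_notMem_vars hi, mul_zero]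
  have h2 : ∑ i ∈ Finset.range (level μ + 1),
      pPoly (fun x : Fin N → ℝ => (x I : ℂ)) i * MvPolynomial.pderiv i η =
      ∑ i ∈ η.vars ∪ Finset.range (level μ + 1),
        pPoly (fun x : Fin N → ℝ => (x I : ℂ)) i * MvPolynomial.pderiv i η := by
    refine Finset.sum_subset Finset.subset_union_right fun i _ hi => ?_
    rw [hzero i hi, mul_zero]
  rw [h1, ← h2]
  simp only [hpd, mul_neg, Finset.sum_neg_distrib]
  refine congrArg Neg.neg ?_
  simp only [Finset.mul_sum]
  rw [Finset.sum_comm]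
  refine Finset.sum_congr rfl fun j hj => ?_
  rw [← sum_pPoly_mul_residue (A := (Fin N → ℝ) → ℂ) (fun x => (x I : ℂ)) (Finset.mem_range.1 hj),
    Finset.sum_mul]
  exact Finset.sum_congr rfl fun i _ => (mul_assoc _ _ _).symm

/-- The null field operators act on the coefficients of the state as `2 ∑_k x_I^{-2-k} L_k`. -/
lemma nullOp_coeff_state (hU : IsOpen U) (hUinj : ∀ x ∈ U, Function.Injective x) {κ : ℝ}
    (hκ : 0 < κ) (hΓ : Γ.SameEndValues κ) (I : Fin N) (μ : ℕ+ →₀ ℕ) (s : ℕ →₀ ℕ) {x : Fin N → ℝ}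
    (hx : x ∈ U) :
    nullOp κ I (MvPolynomial.coeff s (MvPowerSeries.coeff μ (Γ.state κ))) x =
      2 * ∑ j ∈ Finset.range (level μ + 1), (x I : ℂ) ^ j *
        MvPolynomial.coeff s (MvPowerSeries.coeff μ
          (opG (totalCharge N L κ) (backgroundCharge κ)
            (virasoro (totalCharge N L κ) (backgroundCharge κ) (-2 - (j : ℤ))
              (Γ.screened κ)))) x := by
  obtain ⟨T, hT⟩ := exists_nullOp_linearMap hU hx κ I
  rw [← hT _ (Γ.smoothOn_state hU hUinj hκ hΓ μ s), state, ← coeff_opG_mapLin]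
  -- Both vectors have complex coefficients and need agree only up to level `level μ`, where one
  -- truncation of the sum over `j` serves all components.
  have h1 : MvPowerSeries.coeff μ (opG (totalCharge N L κ) (backgroundCharge κ)
      (mapLin T (Γ.screened κ))) = MvPowerSeries.coeff μ
      (opG (totalCharge N L κ) (backgroundCharge κ) (∑ j ∈ Finset.range (level μ + 1),
        (2 * (x I : ℂ) ^ j) • mapLin (evalLin x) (virasoro (totalCharge N L κ) (backgroundCharge κ)
          (-2 - (j : ℤ)) (Γ.screened κ)))) := by
    refine coeff_opG_congr _ _ fun ν hν => ?_
    rw [coeff_mapLin, hT _ (Γ.coeff_screened_mem hU hUinj hκ hΓ ν),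
      Γ.nullOp_screened hU hUinj hκ hΓ hx I (hν.trans (Nat.le_succ _)), map_sum, Finset.mul_sum]
    refine Finset.sum_congr rfl fun j _ => ?_
    rw [map_smul, coeff_mapLin, smul_eq_mul, mul_assoc]
    rfl
  rw [h1, coeff_opG_sum, MvPolynomial.coeff_sum, Finset.mul_sum]
  refine Finset.sum_congr rfl fun j _ => ?_
  rw [coeff_opG_smul, MvPolynomial.coeff_C_mul, coeff_opG_mapLin, mul_assoc]
  rfl

/-- The two halves, `nullOp_coeff_state` and `sum_pPoly_mul_pderiv_state`, are opposite. -/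
theorem coeff_driftOp_state (hU : IsOpen U) (hUinj : ∀ x ∈ U, Function.Injective x) {κ : ℝ}
    (hκ : 0 < κ) (hΓ : Γ.SameEndValues κ) (I : Fin N) (μ : ℕ+ →₀ ℕ) (s : ℕ →₀ ℕ) {x : Fin N → ℝ}
    (hx : x ∈ U) :
    MvPolynomial.coeff s (driftOp κ I (MvPowerSeries.coeff μ (Γ.state κ))) x = 0 := by
  classical
  set η := MvPowerSeries.coeff μ (Γ.state κ) with hη
  have h1 : MvPolynomial.coeff s (∑ s ∈ η.support,
      MvPolynomial.monomial s (nullOp κ I (MvPolynomial.coeff s η))) x =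
      nullOp κ I (MvPolynomial.coeff s η) x := by
    rw [MvPolynomial.coeff_sum]
    simp only [MvPolynomial.coeff_monomial]
    rw [Finset.sum_ite_eq' η.support]
    split_ifs with h
    · rfl
    · rw [MvPolynomial.notMem_support_iff.1 h]
      obtain ⟨T, hT⟩ := exists_nullOp_linearMap hU hx κ I
      rw [← hT 0 (Submodule.zero_mem _), map_zero]
      rfl
  rw [driftOp, MvPolynomial.coeff_add, Pi.add_apply, h1,
    Γ.nullOp_coeff_state hU hUinj hκ hΓ I μ s hx, Γ.sum_pPoly_mul_pderiv_state κ I μ, two_mul (-_),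
    ← neg_add, ← two_mul, MvPolynomial.coeff_neg, ← Nat.cast_ofNat (R := SLEData N),
    ← map_natCast (MvPolynomial.C (R := (Fin N → ℝ) → ℂ)), MvPolynomial.coeff_C_mul,
    MvPolynomial.coeff_sum]
  simp only [MvPolynomial.coeff_C_mul, Pi.neg_apply, Pi.mul_apply, Finset.sum_apply, Pi.pow_apply]
  simp

end Contours

/-! ### The local martingale property -/

section Values

variable {N : ℕ} {U : Set (Fin N → ℝ)} {η : SLEData N}

/-- The image of the inverse series is an inverse of the image, and inverses are unique. -/
lemma map_pPoly {A B : Type*} [CommRing A] [CommRing B] (φ : A →+* B) (x : A) (i : ℕ) :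
    MvPolynomial.map φ (pPoly x i) = pPoly (φ x) i := by
  have hinv : ∀ {C : Type _} [CommRing C] (y : C),
      (fSeries C - PowerSeries.C (MvPolynomial.C y) * PowerSeries.X) * PowerSeries.invOfUnit
        (fSeries C - PowerSeries.C (MvPolynomial.C y) * PowerSeries.X) 1 = 1 := fun y =>
    PowerSeries.mul_invOfUnit _ _ (by simp [constantCoeff_fSeries])
  have hinvB : (fSeries B - PowerSeries.C (MvPolynomial.C (φ x)) * PowerSeries.X) *
      PowerSeries.invOfUnit
        (fSeries B - PowerSeries.C (MvPolynomial.C (φ x)) * PowerSeries.X) 1 = 1 :=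
    PowerSeries.mul_invOfUnit _ _ (by simp [constantCoeff_fSeries])
  have hf : PowerSeries.map (MvPolynomial.map φ) (fSeries A) = fSeries B := by
    ext1 n
    rw [PowerSeries.coeff_map, fSeries, fSeries, PowerSeries.coeff_mk, PowerSeries.coeff_mk]
    split_ifs <;> simp
  have h1 := congrArg (PowerSeries.map (MvPolynomial.map (σ := ℕ) φ)) (hinv x)
  rw [map_mul, map_one, map_sub, map_mul, hf, PowerSeries.map_C, PowerSeries.map_X,
    MvPolynomial.map_C, mul_comm] at h1
  have h2 := congrArg (PowerSeries.coeff i) (left_inv_eq_right_inv h1 hinvB)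
  rw [PowerSeries.coeff_map] at h2
  exact h2

lemma value_eq_sum (η : SLEData N) (x : Fin N → ℝ) (g : ℕ → ℝ) :
    η.value x g = ∑ s ∈ η.support, MvPolynomial.coeff s η x * ∏ i ∈ s.support, (g i : ℂ) ^ s i := by
  rw [SLEData.value, MvPolynomial.eval_map, MvPolynomial.eval₂_eq]
  rfl

lemma value_pPoly (x : Fin N → ℝ) (g : ℕ → ℝ) (I : Fin N) (i : ℕ) :
    SLEData.value (pPoly (fun x : Fin N → ℝ => (x I : ℂ)) i) x g =
      ((MvPolynomial.eval g (pPoly (x I) i) : ℝ) : ℂ) := by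
  have h := MvPolynomial.map_eval Complex.ofRealHom g (pPoly (x I) i)
  rw [map_pPoly] at h
  rw [SLEData.value, map_pPoly]
  exact h.symm

lemma value_congr {k : ℕ} (hk : η.vars ⊆ Finset.range k) (x : Fin N → ℝ) {g g' : ℕ → ℝ}
    (h : ∀ i < k, g i = g' i) : η.value x g = η.value x g' := by
  rw [value_eq_sum, value_eq_sum]
  refine Finset.sum_congr rfl fun s hs => congrArg _ (Finset.prod_congr rfl fun i hi => ?_)
  rw [h i (Finset.mem_range.1 (hk ((MvPolynomial.mem_vars_iff_mem_support i).2 ⟨s, hs, hi⟩)))]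

lemma value_fun_eq (η : SLEData N) (g : ℕ → ℝ) : (fun x => η.value x g) =
    ∑ s ∈ η.support, (∏ i ∈ s.support, (g i : ℂ) ^ s i) • MvPolynomial.coeff s η := by
  funext x
  rw [value_eq_sum, Finset.sum_apply]
  exact Finset.sum_congr rfl fun s _ => mul_comm _ _

lemma value_mem (hη : η.SmoothOn U) (g : ℕ → ℝ) :
    (fun x => η.value x g) ∈ smoothFunctions U := by
  rw [value_fun_eq]
  exact Submodule.sum_mem _ fun s _ => Submodule.smul_mem _ _ (hη s)

lemma value_driftOp (hU : IsOpen U) (hη : η.SmoothOn U) {x : Fin N → ℝ} (hx : x ∈ U) (κ : ℝ)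
    (I : Fin N) (g : ℕ → ℝ) : (driftOp κ I η).value x g =
      nullOp κ I (fun x => η.value x g) x +
        2 * ∑ i ∈ η.vars, ((MvPolynomial.eval g (pPoly (x I) i) : ℝ) : ℂ) *
          SLEData.value (MvPolynomial.pderiv i η) x g := by
  obtain ⟨T, hT⟩ := exists_nullOp_linearMap hU hx κ I
  rw [← hT _ (value_mem hη g), value_fun_eq, map_sum]
  simp only [← value_pPoly]
  simp only [SLEData.value, driftOp, map_add, map_sum, map_mul, MvPolynomial.map_monomial,
    MvPolynomial.eval_monomial, map_smul, hT _ (hη _), smul_eq_mul, Finsupp.prod, map_ofNat]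
  refine congrArg₂ _ (Finset.sum_congr rfl fun s _ => mul_comm _ _) rfl

/-- Used with `l` the coordinates of a finite truncation, to identify the analytic derivative in
`g_i` with the formal `pderiv`. -/
lemma exists_hasFDerivAt_eval {E : Type*} [NormedAddCommGroup E] [NormedSpace ℝ E]
    (l : ℕ → E →L[ℝ] ℂ) (q : MvPolynomial ℕ ℂ) (y v : E) (i : ℕ)
    (hv : ∀ j, l j v = if i = j then 1 else 0) :
    ∃ D : E →L[ℝ] ℂ, HasFDerivAt (fun y => MvPolynomial.eval (fun j => l j y) q) D y ∧
      D v = MvPolynomial.eval (fun j => l j y) (MvPolynomial.pderiv i q) := by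
  induction q using MvPolynomial.induction_on with
  | C c =>
    refine ⟨0, ?_, by simp⟩
    simp only [MvPolynomial.eval_C]
    exact hasFDerivAt_const c y
  | add p q hp hq =>
    obtain ⟨D, hD, hDv⟩ := hp
    obtain ⟨D', hD', hDv'⟩ := hq
    refine ⟨D + D', ?_, by rw [add_apply, hDv, hDv', map_add, map_add]⟩
    simp only [map_add]
    exact hD.add hD'
  | mul_X p j hp =>
    obtain ⟨D, hD, hDv⟩ := hp
    have h1 := hD.fun_mul (l j).hasFDerivAt
    refine ⟨_, by simpa only [map_mul, MvPolynomial.eval_X] using h1, ?_⟩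
    · rw [Derivation.leibniz, MvPolynomial.pderiv_X, add_apply, smul_apply, smul_apply, hDv, hv]
      by_cases h : i = j
      · subst h
        simp
      · simp [h, Ne.symm h]

lemma vars_pderiv_subset {σ R : Type*} [CommSemiring R] (i : σ) (p : MvPolynomial σ R) :
    (MvPolynomial.pderiv i p).vars ⊆ p.vars := by
  classical
  intro j hj
  obtain ⟨d, hd, hjd⟩ := (MvPolynomial.mem_vars_iff_mem_support j).1 hj
  rw [MvPolynomial.mem_support_iff, MvPolynomial.coeff_pderiv] at hd
  refine (MvPolynomial.mem_vars_iff_mem_support j).2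
    ⟨_, MvPolynomial.mem_support_iff.2 (left_ne_zero_of_mul hd), ?_⟩
  rw [Finsupp.mem_support_iff] at hjd ⊢
  rw [Finsupp.add_apply]
  omega

/-- A sequence with prescribed first `k` terms. -/
def extendLin (k j : ℕ) : (Fin k → ℝ) →L[ℝ] ℝ :=
  if h : j < k then ContinuousLinearMap.proj (R := ℝ) (φ := fun _ => ℝ) ⟨j, h⟩ else 0

lemma extendLin_restrict {k : ℕ} (g : ℕ → ℝ) {j : ℕ} (hj : j < k) :
    extendLin k j (fun i => g i) = g j := by
  simp [extendLin, hj]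

lemma extendLin_single {k : ℕ} (i : Fin k) (j : ℕ) :
    extendLin k j (Pi.single i 1) = if (i : ℕ) = j then 1 else 0 := by
  rw [extendLin]
  split_ifs with h1 h2 h2
  · subst h2
    simp
  · have : (⟨j, h1⟩ : Fin k) ≠ i := fun e => h2 (by rw [← e])
    simp [this]
  · exact absurd (h2 ▸ i.2) h1
  · simp

lemma fderiv_value {k : ℕ} (hk : η.vars ⊆ Finset.range k) (x : Fin N → ℝ) (g : ℕ → ℝ)
    (i : Fin k) (c : ℂ) :
    fderiv ℝ (fun y : Fin k → ℝ => η.value x (fun j => extendLin k j y) / c)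
      (fun i => g i) (Pi.single i 1) = SLEData.value (MvPolynomial.pderiv (i : ℕ) η) x g / c := by
  obtain ⟨D, hD, hDv⟩ := exists_hasFDerivAt_eval
    (fun j => Complex.ofRealCLM.comp (extendLin k j))
    (MvPolynomial.map (Pi.evalRingHom (fun _ => ℂ) x) η) (fun i => g i) (Pi.single i 1) i
    (fun j => by
      rw [ContinuousLinearMap.comp_apply, extendLin_single]
      split_ifs <;> simp)
  have h1 : HasFDerivAt (fun y : Fin k → ℝ => η.value x (fun j => extendLin k j y) / c)
      (c⁻¹ • D) (fun i => g i) := by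
    refine (hD.const_smul c⁻¹).congr_of_eventuallyEq (Filter.Eventually.of_forall fun y => ?_)
    exact div_eq_inv_mul _ _
  rw [h1.fderiv, smul_apply, hDv, MvPolynomial.pderiv_map, smul_eq_mul, div_eq_inv_mul]
  refine congrArg _ ?_
  refine value_congr (η := MvPolynomial.pderiv (i : ℕ) η) (k := k) (g := fun j =>
    extendLin k j (fun i => g i)) ?_ x fun j hj => extendLin_restrict g hj
  exact (vars_pderiv_subset _ _).trans hk

lemma contDiffOn_value (hη : η.SmoothOn U) {Z : (Fin N → ℝ) → ℂ} (hZ : Z ∈ smoothFunctions U)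
    (hZ0 : ∀ x ∈ U, Z x ≠ 0) (k : ℕ) :
    ContDiffOn ℝ (⊤ : ℕ∞) (fun p : (Fin N → ℝ) × (Fin k → ℝ) =>
      η.value p.1 (fun j => extendLin k j p.2) / Z p.1) (U ×ˢ univ) := by
  have hfst : MapsTo (Prod.fst : (Fin N → ℝ) × (Fin k → ℝ) → _) (U ×ˢ univ) U := fun p hp => hp.1
  simp only [div_eq_mul_inv, value_eq_sum]
  refine ContDiffOn.mul (ContDiffOn.sum fun s _ => ContDiffOn.mul ?_ (ContDiff.contDiffOn ?_)) ?_
  · exact (hη s).comp contDiffOn_fst hfst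
  · refine contDiff_prod fun i _ => ContDiff.pow ?_ _
    exact (Complex.ofRealCLM.comp ((extendLin k i).comp
      (ContinuousLinearMap.snd ℝ (Fin N → ℝ) (Fin k → ℝ)))).contDiff
  · exact ContDiffOn.inv (ContDiffOn.comp (g := Z) hZ contDiffOn_fst hfst) fun p hp => hZ0 _ hp.1

end Values

/-! ### The generator as a transform by the partition function -/

section Generator

variable {N : ℕ} {U : Set (Fin N → ℝ)} {φ ψ : (Fin N → ℝ) → ℂ} {x : Fin N → ℝ}

lemma nullOp_congr (hU : IsOpen U) (h : ∀ x ∈ U, φ x = ψ x) (hx : x ∈ U) (κ : ℝ) (I : Fin N) :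
    nullOp κ I φ x = nullOp κ I ψ x := by
  have h1 := fun y hy J => partialX_congr (x := y) hU h hy J
  rw [nullOp, nullOp, partialX_congr hU (fun y hy => h1 y hy I) hx, h x hx]
  simp only [h1 x hx]

/-- The potential is absorbed by the factor `φ`. When `φ = Z` is annihilated, what remains is `Z`
times the part of the generator acting in `x`, the cross term being the drift `κ ∂_I log Z`. -/
lemma nullOp_mul (hU : IsOpen U) (hφ : φ ∈ smoothFunctions U) (hψ : ψ ∈ smoothFunctions U)
    (hx : x ∈ U) (κ : ℝ) (I : Fin N) :
    nullOp κ I (fun x => φ x * ψ x) x = nullOp κ I φ x * ψ x +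
      φ x * ((κ : ℂ) / 2 * partialX I (partialX I ψ) x +
        ∑ J ∈ Finset.univ.erase I, 2 / ((x J : ℂ) - (x I : ℂ)) * partialX J ψ x) +
      κ * partialX I φ x * partialX I ψ x := by
  have h1 : partialX I (partialX I fun x => φ x * ψ x) x =
      partialX I ((fun x => partialX I φ x * ψ x) + fun x => φ x * partialX I ψ x) x :=
    partialX_congr hU (fun y hy => partialX_mul hU hφ hψ hy I) hx I
  have hφ' := partialX_mem hU hφ I
  have hψ' := partialX_mem hU hψ I
  rw [nullOp, h1, partialX_add hU (mul_mem_smoothFunctions hφ' hψ)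
    (mul_mem_smoothFunctions hφ hψ') hx, partialX_mul hU hφ' hψ hx, partialX_mul hU hφ hψ' hx]
  simp only [partialX_mul hU hφ hψ hx]
  have h2 : ∀ J, 2 / ((x J : ℂ) - (x I : ℂ)) * (partialX J φ x * ψ x + φ x * partialX J ψ x) +
      (((κ : ℂ) - 6) / κ) / ((x J : ℂ) - (x I : ℂ)) ^ 2 * (φ x * ψ x) =
      (2 / ((x J : ℂ) - (x I : ℂ)) * partialX J φ x +
        (((κ : ℂ) - 6) / κ) / ((x J : ℂ) - (x I : ℂ)) ^ 2 * φ x) * ψ x +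
      φ x * (2 / ((x J : ℂ) - (x I : ℂ)) * partialX J ψ x) := fun J => by ring
  simp only [h2]
  rw [Finset.sum_add_distrib, ← Finset.sum_mul, ← Finset.mul_sum, nullOp]
  ring

/-- The generator of multiple SLE is the drift operator conjugated with the partition function. -/
lemma generator_value {η : SLEData N} (hU : IsOpen U) (hη : η.SmoothOn U)
    {Z : (Fin N → ℝ) → ℂ} (hZ : Z ∈ smoothFunctions U) (hZ0 : ∀ x ∈ U, Z x ≠ 0) {κ : ℝ}
    {I : Fin N} (hnull : ∀ x ∈ U, nullOp κ I Z x = 0) {k : ℕ} (hk : η.vars ⊆ Finset.range k)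
    (hx : x ∈ U) (g : ℕ → ℝ) :
    generator κ Z I (fun p : (Fin N → ℝ) × (Fin k → ℝ) =>
      η.value p.1 (fun j => extendLin k j p.2) / Z p.1) x g =
      (driftOp κ I η).value x g / Z x := by
  have hV := value_mem hη g
  have hW : (fun x => η.value x g / Z x) ∈ smoothFunctions U := by
    simp only [div_eq_mul_inv]
    exact mul_mem_smoothFunctions hV (ContDiffOn.inv hZ hZ0)
  have hres : (fun x' => η.value x' (fun j => extendLin k j fun i => g i) / Z x') =
      fun x' => η.value x' g / Z x' := by
    funext x'
    rw [value_congr hk x' fun j hj => extendLin_restrict g hj]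
  -- The function is written as `Z` times the quotient, so that `nullOp_mul` and the null equation
  -- for `Z` apply.
  have hmul : nullOp κ I (fun x => η.value x g) x =
      nullOp κ I (fun x => Z x * (η.value x g / Z x)) x :=
    nullOp_congr hU (fun y hy => (mul_div_cancel₀ _ (hZ0 y hy)).symm) hx κ I
  rw [nullOp_mul hU hZ hW hx, hnull x hx] at hmul
  have hvars : ∑ i ∈ η.vars, ((MvPolynomial.eval g (pPoly (x I) i) : ℝ) : ℂ) *
      SLEData.value (MvPolynomial.pderiv i η) x g =
      ∑ i : Fin k, ((MvPolynomial.eval g (pPoly (x I) i) : ℝ) : ℂ) *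
        SLEData.value (MvPolynomial.pderiv (i : ℕ) η) x g := by
    rw [Fin.sum_univ_eq_sum_range (fun i => ((MvPolynomial.eval g (pPoly (x I) i) : ℝ) : ℂ) *
      SLEData.value (MvPolynomial.pderiv i η) x g) k]
    refine Finset.sum_subset hk fun i _ hi => ?_
    rw [MvPolynomial.pderiv_eq_zero_of_notMem_vars hi]
    simp [SLEData.value]
  rw [value_driftOp hU hη hx, hmul, hvars, generator]
  simp only [hres, fderiv_value hk]
  have hz := hZ0 x hx
  have hlast : ∑ i : Fin k, 2 * ((MvPolynomial.eval g (pPoly (x I) i) : ℝ) : ℂ) *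
      (SLEData.value (MvPolynomial.pderiv (i : ℕ) η) x g / Z x) =
      2 * (∑ i : Fin k, ((MvPolynomial.eval g (pPoly (x I) i) : ℝ) : ℂ) *
        SLEData.value (MvPolynomial.pderiv (i : ℕ) η) x g) / Z x := by
    rw [Finset.mul_sum, Finset.sum_div]
    exact Finset.sum_congr rfl fun i _ => by ring
  rw [hlast]
  field_simp
  ring

end Generator

/-- The localizing times lie strictly below `τ`, so the stopped processes see only values before
`τ`. -/
lemma IsLocalMartingaleOn.congr {Ω : Type*} {mΩ : MeasurableSpace Ω} {ℱ : Filtration ℝ≥0 mΩ}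
    {P : Measure Ω} {τ : Ω → WithTop ℝ≥0} {M M' : ℝ≥0 → Ω → ℂ}
    (hM : IsLocalMartingaleOn ℱ P τ M)
    (h : ∀ (t : ℝ≥0) (ω : Ω), (t : WithTop ℝ≥0) < τ ω → M t ω = M' t ω) :
    IsLocalMartingaleOn ℱ P τ M' := by
  obtain ⟨σ, h1, h2, h3, h4, h5⟩ := hM
  refine ⟨σ, h1, h2, h3, h4, fun n => ?_⟩
  have h6 : stoppedProcess M' (σ n) = stoppedProcess M (σ n) := by
    funext t ω
    have h7 : min (t : WithTop ℝ≥0) (σ n ω) < τ ω := (min_le_right _ _).trans_lt (h3 n ω)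
    have h8 : (((min (t : WithTop ℝ≥0) (σ n ω)).untopA : ℝ≥0) : WithTop ℝ≥0) =
        min (t : WithTop ℝ≥0) (σ n ω) := by
      rw [WithTop.untopA_eq_untop (ne_top_of_lt h7), WithTop.coe_untop]
    rw [stoppedProcess, stoppedProcess]
    exact (h _ ω (h8.symm ▸ h7)).symm
  rw [h6]
  exact h5 n

namespace Contours

variable {N L : ℕ} {U : Set (Fin N → ℝ)} (Γ : Contours N L U)

/-- `U⁻` has constant term one, so `Z` is the level-zero component and inherits smoothness and the
null field equation. -/
lemma partitionFunction_eq (κ : ℝ) :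
    Γ.partitionFunction κ = MvPowerSeries.coeff 0 (Γ.screened κ) := by
  funext x
  have h : ∀ z, MvPowerSeries.coeff 0 (Uminus (charges N L κ) z) = 1 := fun z =>
    Finsupp.prod_zero_index (h := fun (n : ℕ+) (k : ℕ) =>
      ((∑ i, charges N L κ i * z i ^ (n : ℕ)) / ((n : ℕ) : ℂ)) ^ k / (k.factorial : ℂ))
  rw [coeff_screened, partitionFunction, pairing]
  refine congrArg _ (funext fun t => ?_)
  rw [show MvPowerSeries.coeff 0 (UminusFun (charges N L κ)) (fun i => Γ.points i x t) = 1 from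
    h fun i => Γ.points i x t, mul_one]

lemma nullOp_partitionFunction (hU : IsOpen U) (hUinj : ∀ x ∈ U, Function.Injective x) {κ : ℝ}
    (hκ : 0 < κ) (hΓ : Γ.SameEndValues κ) {x : Fin N → ℝ} (hx : x ∈ U) (I : Fin N) :
    nullOp κ I (Γ.partitionFunction κ) x = 0 := by
  -- At level zero the truncation `M = 0` is allowed, and the sum of generators is empty.
  rw [partitionFunction_eq, Γ.nullOp_screened hU hUinj hκ hΓ hx I
    (M := 0) (by simp [level])]
  simp

theorem isLocalMartingaleOn_state (hU : IsOpen U) (hUinj : ∀ x ∈ U, Function.Injective x) {κ : ℝ}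
    (hκ : 0 < κ) (hΓ : Γ.SameEndValues κ) {Ω : Type*} {mΩ : MeasurableSpace Ω}
    {ℱ : Filtration ℝ≥0 mΩ} {P : Measure Ω} {x₀ : Fin N → ℝ} {τ : Ω → WithTop ℝ≥0}
    {X : ℝ≥0 → Ω → Fin N → ℝ} {g : ℝ≥0 → Ω → ℕ → ℝ} {q : Fin N → Ω → Measure ℝ≥0}
    (hX : IsMultipleSLE ℱ P κ U (Γ.partitionFunction κ) x₀ τ X g q) (μ : ℕ+ →₀ ℕ) :
    IsLocalMartingaleOn ℱ P τ fun t ω =>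
      SLEData.value (MvPowerSeries.coeff μ (Γ.state κ)) (X t ω) (g t ω) /
        Γ.partitionFunction κ (X t ω) := by
  set η := MvPowerSeries.coeff μ (Γ.state κ) with hηdef
  have hη : η.SmoothOn U := Γ.smoothOn_state hU hUinj hκ hΓ μ
  have hZ : Γ.partitionFunction κ ∈ smoothFunctions U := by
    rw [partitionFunction_eq]
    exact Γ.coeff_screened_mem hU hUinj hκ hΓ 0
  have hZ0 : ∀ x ∈ U, Γ.partitionFunction κ x ≠ 0 := by
    obtain ⟨c, hc⟩ := hX.partition_pos
    intro x hx h
    obtain ⟨r, hr, hcr⟩ := hc x hx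
    rw [h, mul_zero] at hcr
    exact hr.ne (by exact_mod_cast hcr)
  -- A coefficient of the state involves finitely many of the `f_m`, so it gives an admissible test
  -- function of `X` and `k` of the `g_m`.
  obtain ⟨k, hk⟩ : ∃ k, η.vars ⊆ Finset.range k := Finset.exists_nat_subset_range _
  have hgen : ∀ x ∈ U, ∀ I (g : ℕ → ℝ), generator κ (Γ.partitionFunction κ) I
      (fun p : (Fin N → ℝ) × (Fin k → ℝ) =>
        η.value p.1 (fun j => extendLin k j p.2) / Γ.partitionFunction κ p.1) x g = 0 := by
    intro x hx I g
    rw [generator_value hU hη hZ hZ0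
      (fun y hy => Γ.nullOp_partitionFunction hU hUinj hκ hΓ hy I) hk hx, value_eq_sum,
      Finset.sum_eq_zero, zero_div]
    intro s _
    rw [Γ.coeff_driftOp_state hU hUinj hκ hΓ I μ s hx, zero_mul]
  refine (hX.martingale_problem k _ (contDiffOn_value hη hZ hZ0 k)).congr fun t ω ht => ?_
  -- For `s ≤ t < τ` the process is still in `U`, where the generator of the test function vanishes.
  have hint : ∀ I, ∫ s in Iic t, generator κ (Γ.partitionFunction κ) I
      (fun p : (Fin N → ℝ) × (Fin k → ℝ) =>
        η.value p.1 (fun j => extendLin k j p.2) / Γ.partitionFunction κ p.1)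
        (X s ω) (g s ω) ∂(q I ω) = 0 := fun I =>
    setIntegral_eq_zero_of_forall_eq_zero fun s hs => hgen _
      (hX.X_mem ω s ((WithTop.coe_le_coe.2 hs).trans_lt ht)) I _
  simp only [hint, Finset.sum_const_zero, sub_zero]
  rw [value_congr hk (X t ω) fun j hj => extendLin_restrict (g t ω) hj]

end Contours

end CoulombGas

end

theorem theorem5p4 (N L : ℕ) (hN : 2 ≤ N) (hL : 2 * L ≤ N) (κ : ℝ) (hκ : 0 < κ) (hκ' : κ < 8)
    (U : Set (Fin N → ℝ)) (hU : IsOpen U) (hUinj : ∀ x ∈ U, Function.Injective x)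
    (Γ : Contours N L U) (hΓ : Γ.SameEndValues κ) :
    IsConformalOperator (A := (Fin N → ℝ) → ℂ) (totalCharge N L κ) (backgroundCharge κ)
      (opG (totalCharge N L κ) (backgroundCharge κ)) ∧
    (∀ μ : ℕ+ →₀ ℕ, SLEData.SmoothOn U (MvPowerSeries.coeff μ (Γ.state κ))) ∧
    (∀ (I : Fin N) (μ : ℕ+ →₀ ℕ) (s : ℕ →₀ ℕ), ∀ x ∈ U,
      MvPolynomial.coeff s (driftOp κ I (MvPowerSeries.coeff μ (Γ.state κ))) x = 0) ∧
    (∀ (Ω : Type*) (mΩ : MeasurableSpace Ω) (ℱ : Filtration ℝ≥0 mΩ) (P : Measure Ω)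
      (_ : IsProbabilityMeasure P) (x₀ : Fin N → ℝ) (τ : Ω → WithTop ℝ≥0)
      (X : ℝ≥0 → Ω → Fin N → ℝ) (g : ℝ≥0 → Ω → ℕ → ℝ) (q : Fin N → Ω → Measure ℝ≥0),
      IsMultipleSLE ℱ P κ U (Γ.partitionFunction κ) x₀ τ X g q →
      ∀ μ : ℕ+ →₀ ℕ, IsLocalMartingaleOn ℱ P τ fun t ω =>
        SLEData.value (MvPowerSeries.coeff μ (Γ.state κ)) (X t ω) (g t ω) /
          Γ.partitionFunction κ (X t ω)) := by
  refine ⟨isConformalOperator_opG _ _, fun μ => Γ.smoothOn_state hU hUinj hκ hΓ μ,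
    fun I μ s x hx => Γ.coeff_driftOp_state hU hUinj hκ hΓ I μ s hx, ?_⟩
  intro Ω mΩ ℱ P _ x₀ τ X g q hX μ
  exact Γ.isLocalMartingaleOn_state hU hUinj hκ hΓ hX μ
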